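/- **Theorem (The Randomized Approximate QFT).** Fix the following conventions. On $n$ qubits, input integers $x\in\{0,\dots,2^n-1\}$ are stored with the most significant bit on the first qubit, output integers $y$ with the least significant bit on the first qubit, and $$\mathrm{QFT}\,|x\rangle = 2^{-n/2}\sum_{y=0}^{2^n-1} e^{2\pi i xy/2^n}|y\rangle .$$ (This is the QFT modulo $2^n$ in the qubit order of the usual QFT circuits without final swaps.) A *circuit* is a sequence of layers of arbitrary one- and two-qubit unitary gates, the gates of one layer acting on disjoint qubits; its depth is the number of layers and its gate count the number of gates. Ancillas start in $|0\rangle$ and are returned to $|0\rangle$. Let $X|x\rangle=|x+1 \bmod 2^n\rangle$, $Z|x\rangle=e^{2\pi i x/2^n}|x\rangle$ be the Weyl–Heisenberg operators, $V(r_1,r_2)=X^{r_1}Z^{r_2}$ and $\hat V=\mathrm{QFT}\,V\,\mathrm{QFT}^\dagger$. For a block size $m\ge 1$, cut the qubits into $\lceil n/m\rceil$ consecutive blocks $0,1,2,\dots$ of $m$ qubits (the last one possibly shorter); let $m_i$ be the length of block $i$, and let $X_i$ and $Y_i$ be the integers read from block $i$ in the input and in the output bit order. The *optimistic QFT* $\mathrm{OQFT}_m$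 is the following sequence of operations: (1) a QFT on every even-indexed block; (2) the phase $\exp(2\pi i X_{i+1}Y_i/2^{m_i+m_{i+1}})$ for every even $i$; (3) a QFT on every odd-indexed block and an inverse QFT on every even-indexed block; (4) the phase $\exp(2\pi i X_{i+1}Y_i/2^{m_i+m_{i+1}})$ for every odd $i$; (5) a QFT on every even-indexed block. (For the last block there is no block $i+1$ and no phase.) Then there is a constant $K>0$ such that for all $n\in\mathbb N$ and $0<\epsilon\le 1$ with $n/\epsilon\ge 2$ there are a block size $m\ge 1$ with $m\le K\log(n/\epsilon)$, a number $a\le K\,n/\log(n/\epsilon)$ of ancillas, and for each pair $(r_1,r_2)\in\{0,\dots,2^n-1\}^2$ a circuit $C_{r_1,r_2}$ on $n+a$ qubits with at most $K\,n\log(n/\epsilon)$ gates and depth at most $K\log(n/\epsilon)$, such that: * $C_{r_1,r_2}$ implements exactly the conjugated optimistic QFT: $C_{r_1,r_2}(|\psi\rangle\otimes|0^a\rangle)=\big(\hat V^\dagger\,\mathrm{OQFT}_m\,V\,|\psi\rangle\big)\otimes|0^a\rangle$ for every state $|\psi\rangle$ of $n$ qubits, where $V=V(r_1,r_2)$ and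 $\hat V=\mathrm{QFT}\,V\,\mathrm{QFT}^\dagger$; * for uniformly random $r_1,r_2$, on every input unit vector $|\psi\rangle\in(\mathbb C^2)^{\otimes n}$ the expected error is at most $\epsilon$: $$\frac1{4^n}\sum_{r_1,r_2=0}^{2^n-1}\Big\|\,C_{r_1,r_2}(|\psi\rangle\otimes|0^a\rangle)-\mathrm{QFT}|\psi\rangle\otimes|0^a\rangle\Big\|^2\le\epsilon .$$ -/

import Mathlib

noncomputable section

namespace RandQFT

/-! ## Registers, gates and circuits -/

/-- Computational basis labels of a register whose qubits are indexed by `Q`. -/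
abbrev Basis (Q : Type) : Type := Q → Fin 2

/-- The Hilbert space of the register, with its Euclidean norm. -/
abbrev QState (Q : Type) : Type := EuclideanSpace ℂ (Basis Q)

/-- Linear operators on the register, as matrices in the computational basis
(rows: output labels, columns: input labels). -/
abbrev Op (Q : Type) : Type := Matrix (Basis Q) (Basis Q) ℂ

/-- Application of an operator to a state. -/
def Op.app {Q : Type} [Fintype Q] [DecidableEq Q] (A : Op Q) (ψ : QState Q) : QState Q :=
  Matrix.toEuclideanLin A ψ

/-- A gate is an arbitrary unitary on one qubit or on two distinct qubits. -/
inductive Gate (Q : Type) : Type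
  | one (p : Q) (u : Matrix.unitaryGroup (Fin 2) ℂ) : Gate Q
  | two (p q : Q) (hpq : p ≠ q) (u : Matrix.unitaryGroup (Fin 2 × Fin 2) ℂ) : Gate Q

/-- The qubits that a gate touches. -/
def Gate.support {Q : Type} [DecidableEq Q] : Gate Q → Finset Q
  | .one p _ => {p}
  | .two p q _ _ => {p, q}

/-- The operator of a gate on the whole register: the gate's unitary on its qubits, tensored with
the identity on all the other qubits. -/
def Gate.op {Q : Type} [Fintype Q] [DecidableEq Q] : Gate Q → Op Q
  | .one p u => Matrix.of fun y x =>
      if ∀ k, k ≠ p → y k = x k then u.1 (y p) (x p) else 0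
  | .two p q _ u => Matrix.of fun y x =>
      if ∀ k, k ≠ p → k ≠ q → y k = x k then u.1 (y p, y q) (x p, x q) else 0

/-- A (unitary, measurement-free) circuit: a sequence of layers, the first one being applied first;
the gates of one layer act on pairwise disjoint sets of qubits. -/
structure Circuit (Q : Type) [DecidableEq Q] : Type where
  layers : List (List (Gate Q))
  disjoint : ∀ L ∈ layers, L.Pairwise fun g h => Disjoint g.support h.support

/-- Number of layers. -/
def Circuit.depth {Q : Type} [DecidableEq Q] (c : Circuit Q) : ℕ := c.layers.length

/-- Total number of gates. -/
def Circuit.gateCount {Q : Type} [DecidableEq Q] (c : Circuit Q) : ℕ :=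
  (c.layers.map List.length).sum

/-- The operator of a list of layers, the head of the list being applied first. The gates of a
layer commute, so the order of the product within a layer is immaterial. -/
def layersOp {Q : Type} [Fintype Q] [DecidableEq Q] : List (List (Gate Q)) → Op Q
  | [] => 1
  | L :: Ls => layersOp Ls * (L.map Gate.op).prod

/-- The unitary induced by a circuit. -/
def Circuit.op {Q : Type} [Fintype Q] [DecidableEq Q] (c : Circuit Q) : Op Q :=
  layersOp c.layers

/-- The state `ψ ⊗ |0…0⟩` of `n` data qubits and `a` ancilla qubits. -/
def withAncilla {n : ℕ} (a : ℕ) (ψ : QState (Fin n)) : QState (Fin n ⊕ Fin a) :=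
  WithLp.toLp 2 fun z =>
    if ∀ j : Fin a, z (Sum.inr j) = 0 then ψ (fun i => z (Sum.inl i)) else 0

/-- The circuit implements the operator `A` exactly, with `a` ancillas that start in `|0…0⟩` and
are returned to `|0…0⟩`. -/
def Implements {n a : ℕ} (c : Circuit (Fin n ⊕ Fin a)) (A : Op (Fin n)) : Prop :=
  ∀ ψ : QState (Fin n), c.op.app (withAncilla a ψ) = withAncilla a (A.app ψ)

/-! ## The quantum Fourier transform

Input integers are stored with the most significant bit on the first qubit, output integers with
the least significant bit on the first qubit (the usual convention for QFT circuits without final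
swaps). With `x` and `y` read in this way, the QFT sends `|x⟩` to `2^(-n/2) ∑_y exp(2πi x y / 2^n) |y⟩`.
-/

/-- The integer stored in the qubits `a, …, b - 1`, most significant bit first. -/
def inVal {n : ℕ} (a b : ℕ) (x : Basis (Fin n)) : ℕ :=
  ∑ k : Fin n, if a ≤ k.val ∧ k.val < b then (x k).val * 2 ^ (b - 1 - k.val) else 0

/-- The integer stored in the qubits `a, …, b - 1`, least significant bit first. -/
def outVal {n : ℕ} (a b : ℕ) (y : Basis (Fin n)) : ℕ :=
  ∑ k : Fin n, if a ≤ k.val ∧ k.val < b then (y k).val * 2 ^ (k.val - a) else 0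

/-- The Fourier transform modulo `2^(b - a)` on the qubits `a, …, b - 1`, tensored with the
identity on the other qubits. -/
def qftOn (n a b : ℕ) : Op (Fin n) := Matrix.of fun y x =>
  if ∀ k : Fin n, (k.val < a ∨ b ≤ k.val) → y k = x k then
    Complex.exp (2 * Real.pi * Complex.I * ((inVal a b x : ℂ) * (outVal a b y : ℂ)) / 2 ^ (b - a))
      / (Real.sqrt (2 ^ (b - a)) : ℂ)
  else 0

/-- The exact quantum Fourier transform modulo `2^n` on `n` qubits. -/
def qft (n : ℕ) : Op (Fin n) := qftOn n 0 n

/-! ## The optimistic quantum Fourier transform -/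

/-- The phase rotation `exp(2πi X Y / 2^(c - a))`, where `Y` is the (output) integer on the qubits
`a, …, b - 1` and `X` is the (input) integer on the qubits `b, …, c - 1`. -/
def phaseOn (n a b c : ℕ) : Op (Fin n) := Matrix.diagonal fun x =>
  Complex.exp (2 * Real.pi * Complex.I * ((inVal b c x : ℂ) * (outVal a b x : ℂ)) / 2 ^ (c - a))

/-- First qubit of block `i` when `n` qubits are cut into blocks of `m` qubits (the last block may
be shorter; beyond it blocks are empty). Block `i` is `blockStart n m i, …, blockStart n m (i+1) - 1`. -/
def blockStart (n m i : ℕ) : ℕ := min n (m * i)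

/-- The indices of the blocks of parity `p`, among the `⌈n/m⌉` blocks. -/
def blocksOfParity (n m p : ℕ) : List ℕ :=
  (List.range ((n + m - 1) / m)).filter fun i => i % 2 = p

/-- The Fourier transform on every block of parity `p`. -/
def qftBlocks (n m p : ℕ) : Op (Fin n) :=
  ((blocksOfParity n m p).map fun i =>
    qftOn n (blockStart n m i) (blockStart n m (i + 1))).prod

/-- The phase rotation `exp(2πi X_{i+1} Y_i / 2^{m_i + m_{i+1}})` for every `i` of parity `p`, where
`m_i` is the length of block `i` (so the exponent is `2m` for full blocks); for the last block there
is no block `i + 1`, `X_{i+1} = 0`, and nothing happens. -/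
def phaseBlocks (n m p : ℕ) : Op (Fin n) :=
  ((blocksOfParity n m p).map fun i =>
    phaseOn n (blockStart n m i) (blockStart n m (i + 1)) (blockStart n m (i + 2))).prod

/-- The optimistic QFT with block size `m`. Read from right to left: QFT on the even blocks; phases
for even `i`; QFT on the odd blocks and inverse QFT on the even ones; phases for odd `i`;
QFT on the even blocks. -/
def optimisticQFT (n m : ℕ) : Op (Fin n) :=
  qftBlocks n m 0 * phaseBlocks n m 1 * (qftBlocks n m 1 * (qftBlocks n m 0).conjTranspose)
    * phaseBlocks n m 0 * qftBlocks n m 0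

/-! ## Weyl–Heisenberg operators -/

/-- `X_{2^n} |x⟩ = |x + 1 mod 2^n⟩`. -/
def shiftX (n : ℕ) : Op (Fin n) := Matrix.of fun y x =>
  if inVal 0 n y = (inVal 0 n x + 1) % 2 ^ n then 1 else 0

/-- `Z_{2^n} |x⟩ = exp(2πi x / 2^n) |x⟩`. -/
def clockZ (n : ℕ) : Op (Fin n) := Matrix.diagonal fun x =>
  Complex.exp (2 * Real.pi * Complex.I * (inVal 0 n x : ℂ) / 2 ^ n)

/-- `V(r₁, r₂) = X_{2^n}^{r₁} Z_{2^n}^{r₂}`. -/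
def weyl (n r₁ r₂ : ℕ) : Op (Fin n) := shiftX n ^ r₁ * clockZ n ^ r₂

/-- The conjugate `QFT · V(r₁, r₂) · QFT†` of a Weyl–Heisenberg operator. -/
def weylHat (n r₁ r₂ : ℕ) : Op (Fin n) :=
  qft n * weyl n r₁ r₂ * (qft n).conjTranspose

/-- The optimistic QFT conjugated by a Weyl–Heisenberg operator: `V̂† · OQFT · V`. -/
def conjugatedOQFT (n m r₁ r₂ : ℕ) : Op (Fin n) :=
  (weylHat n r₁ r₂).conjTranspose * optimisticQFT n m * weyl n r₁ r₂

end RandQFT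

end

/-! The error part rests on the fact that Weyl–Heisenberg operators form a one-design. Averaging
over `r₂` removes the coherences between basis states (Parseval), and averaging over `r₁` spreads
every basis state uniformly. Hence on every unit vector the expected error equals the squared
Frobenius distance between optimistic and exact QFT, divided by `2 ^ n` (`expected_error_eq`). Only
an average over basis inputs has to be bounded, although the worst-case error of the optimistic QFT
may be large.

The exact QFT obeys a recursion over blocks (`qftOn_split`): transform the qubits so far, couple the
new block to all earlier outputs by a phase, transform the new block. The optimistic QFT deviates
from it in two ways. Each phase sees only the neighbouring block, which changes angles by at most `2
^ (-m)` turns (`fnorm_blockPhase_sub_sq_le`). And a phase `P` of even index acts before the phases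
of odd index instead of after them, which costs a commutator of the preceding block's phase with `S
= F† P F`, where `F` is the QFT of the shared block (`fnorm_phase_commutator_sq_le`).

To bound this commutator, let `D` be the periodic phase `exp(-2πi X / 2 ^ m)` on the shared block.
Conjugation by `F` turns `D` into a cyclic shift by one, and `P` varies slowly along this shift
except at the wrap-around, so `S` almost commutes with `D`. Thus `S` mostly moves `X` by a small
cyclic distance. The preceding block's phase is slowly varying in `X`, so it changes noticeably only
if `X` crosses the ends of its range, which is rare. With `m = 3 * j` a block contributes squared
error `O(2 ^ (-j))`, the triangle inequality over at most `n` blocks gives `n ^ 2 * 2 ^ 9 / 2 ^ j`,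
and `j` of order `log (n / ε)` suffices.

The circuit part writes `V` and the adjoint of `V̂` as a layer of one-qubit phases and the addition
of a constant, in input and in output bit order respectively. A block is added to by phases in its
Fourier basis in depth `O(m)`. The carries into the blocks come from a carry-lookahead tree with
`O(n / m)` ancillas (`exists_adder`); they are erased afterwards because complementing the sum
reproduces the same carries (`CTree.Added.carry_flip`). All other pieces reduce to the linear-depth
QFT circuit `realizes_qftE`. -/

noncomputable section

set_option linter.unusedSectionVars false

namespace RandQFT

open Matrix

section

variable {Q : Type} [Fintype Q] [DecidableEq Q]

/-! ## Gates -/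

/-- `A` acts as an operator on the qubits of `S`, tensored with the identity. -/
def IsLocal (S : Finset Q) (A : Op Q) : Prop :=
  (∀ y x, A y x ≠ 0 → ∀ q ∉ S, y q = x q) ∧
  ∀ y x y' x' : Basis Q, (∀ q ∈ S, y q = y' q) → (∀ q ∈ S, x q = x' q) →
    (∀ q ∉ S, y q = x q) → (∀ q ∉ S, y' q = x' q) → A y x = A y' x'

/-- The sum over intermediate labels has one possible nonzero term: `B` cannot change the bits in
`S` and `A` cannot change the others, so the intermediate label is `x` on `S` and `y` elsewhere. -/
theorem IsLocal.mul_apply {S T : Finset Q} {A B : Op Q} (hA : IsLocal S A) (hB : IsLocal T B)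
    (hST : Disjoint S T) (y x : Basis Q) :
    (A * B) y x = A y (S.piecewise x y) * B (S.piecewise x y) x := by
  rw [Matrix.mul_apply]
  refine Finset.sum_eq_single _ ?_ (by simp)
  intro z _ hz
  by_contra hne
  have h1 := hA.1 y z (left_ne_zero_of_mul hne)
  have h2 := hB.1 z x (right_ne_zero_of_mul hne)
  apply hz
  funext q
  by_cases hq : q ∈ S
  · rw [Finset.piecewise_eq_of_mem _ _ _ hq]
    exact h2 q (Finset.disjoint_left.1 hST hq)
  · rw [Finset.piecewise_eq_of_notMem _ _ _ hq]
    exact (h1 q hq).symm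

/-- Each product is a single term by `IsLocal.mul_apply`. If `y` and `x` agree outside `S ∪ T`, the
corresponding factors see the same local bits; otherwise both products vanish. -/
theorem IsLocal.commute {S T : Finset Q} {A B : Op Q} (hA : IsLocal S A) (hB : IsLocal T B)
    (hST : Disjoint S T) : Commute A B := by
  have hTS := hST.symm
  ext y x
  rw [hA.mul_apply hB hST, hB.mul_apply hA hTS]
  by_cases hyx : ∀ q, q ∉ S → q ∉ T → y q = x q
  · rw [mul_comm]
    congr 1
    · apply hB.2
      · intro q hq
        rw [Finset.piecewise_eq_of_notMem _ _ _ (Finset.disjoint_right.1 hST hq)]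
      · intro q hq
        rw [Finset.piecewise_eq_of_mem _ _ _ hq]
      · intro q hq
        by_cases hqS : q ∈ S
        · rw [Finset.piecewise_eq_of_mem _ _ _ hqS]
        · rw [Finset.piecewise_eq_of_notMem _ _ _ hqS, hyx q hqS hq]
      · intro q hq
        rw [Finset.piecewise_eq_of_notMem _ _ _ hq]
    · apply hA.2
      · intro q hq
        rw [Finset.piecewise_eq_of_notMem _ _ _ (Finset.disjoint_left.1 hST hq)]
      · intro q hq
        rw [Finset.piecewise_eq_of_mem _ _ _ hq]
      · intro q hq
        rw [Finset.piecewise_eq_of_notMem _ _ _ hq]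
      · intro q hq
        by_cases hqT : q ∈ T
        · rw [Finset.piecewise_eq_of_mem _ _ _ hqT]
        · rw [Finset.piecewise_eq_of_notMem _ _ _ hqT, hyx q hq hqT]
  · push Not at hyx
    obtain ⟨q, hqS, hqT, hq⟩ := hyx
    have h1 : B (S.piecewise x y) x = 0 := by
      by_contra hne
      have := hB.1 _ _ hne q hqT
      rw [Finset.piecewise_eq_of_notMem _ _ _ hqS] at this
      exact hq this
    have h2 : A (T.piecewise x y) x = 0 := by
      by_contra hne
      have := hA.1 _ _ hne q hqS
      rw [Finset.piecewise_eq_of_notMem _ _ _ hqT] at this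
      exact hq this
    rw [h1, h2, mul_zero, mul_zero]

theorem Gate.isLocal_op (g : Gate Q) : IsLocal g.support g.op := by
  cases g with
  | one p u =>
    refine ⟨fun y x h q hq => ?_, fun y x y' x' hy hx h h' => ?_⟩
    · simp only [Gate.op, Matrix.of_apply, ne_eq, ite_eq_right_iff, Classical.not_imp] at h
      exact h.1 q (by simpa [Gate.support] using hq)
    · simp only [Gate.support, Finset.mem_singleton] at hy hx h h'
      simp only [Gate.op, Matrix.of_apply]
      rw [if_pos h, if_pos h', hy p rfl, hx p rfl]
  | two p q hpq u =>
    refine ⟨fun y x h r hr => ?_, fun y x y' x' hy hx h h' => ?_⟩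
    · simp only [Gate.op, Matrix.of_apply, ne_eq, ite_eq_right_iff, Classical.not_imp] at h
      simp only [Gate.support, Finset.mem_insert, Finset.mem_singleton, not_or] at hr
      exact h.1 r hr.1 hr.2
    · simp only [Gate.support, Finset.mem_insert, Finset.mem_singleton, not_or, and_imp] at hy hx h h'
      simp only [Gate.op, Matrix.of_apply]
      rw [if_pos h, if_pos h', hy p (Or.inl rfl), hx p (Or.inl rfl), hy q (Or.inr rfl),
        hx q (Or.inr rfl)]

theorem Gate.one_op_mul_apply (p : Q) (u : unitaryGroup (Fin 2) ℂ) (A : Op Q) (y x : Basis Q) :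
    ((Gate.one p u).op * A) y x = ∑ b, u.1 (y p) b * A (Function.update y p b) x := by
  rw [Matrix.mul_apply]
  symm
  refine Finset.sum_of_injOn (fun b => Function.update y p b) ?_ (by simp) ?_ ?_
  · intro b _ b' _ h
    simpa using congrFun h p
  · intro z _ hz
    simp only [Gate.op, Matrix.of_apply]
    rw [if_neg, zero_mul]
    intro h
    refine hz ⟨z p, by simp, ?_⟩
    funext q
    by_cases hq : q = p
    · subst hq; simp
    · simp [hq, h q hq]
  · intro b _
    simp only [Gate.op, Matrix.of_apply]
    rw [if_pos]
    · simp
    · intro k hk; simp [hk]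

theorem Gate.two_op_mul_apply (p q : Q) (hpq : p ≠ q) (u : unitaryGroup (Fin 2 × Fin 2) ℂ)
    (A : Op Q) (y x : Basis Q) :
    ((Gate.two p q hpq u).op * A) y x = ∑ b : Fin 2 × Fin 2, u.1 (y p, y q) b *
      A (Function.update (Function.update y p b.1) q b.2) x := by
  rw [Matrix.mul_apply]
  symm
  refine Finset.sum_of_injOn
    (fun b : Fin 2 × Fin 2 => Function.update (Function.update y p b.1) q b.2) ?_ (by simp) ?_ ?_
  · intro b _ b' _ h
    have h1 := congrFun h p
    have h2 := congrFun h q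
    simp [hpq] at h1 h2
    exact Prod.ext h1 h2
  · intro z _ hz
    simp only [Gate.op, Matrix.of_apply]
    rw [if_neg, zero_mul]
    intro h
    refine hz ⟨(z p, z q), by simp, ?_⟩
    funext r
    by_cases hq : r = q
    · subst hq; simp
    · by_cases hp : r = p
      · subst hp; simp [hpq]
      · simp [hq, hp, h r hp hq]
  · intro b _
    simp only [Gate.op, Matrix.of_apply]
    rw [if_pos]
    · simp [hpq]
    · intro k hk hk'; simp [hk, hk']

/-- The adjoint gate. -/
def Gate.dag : Gate Q → Gate Q
  | .one p u => .one p (star u)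
  | .two p q h u => .two p q h (star u)

theorem Gate.support_dag {Q : Type} [DecidableEq Q] (g : Gate Q) : g.dag.support = g.support := by
  cases g <;> rfl

theorem Gate.op_dag (g : Gate Q) : g.dag.op = g.opᴴ := by
  cases g with
  | one p u =>
    ext y x
    simp only [Gate.dag, Gate.op, Matrix.of_apply, Matrix.conjTranspose_apply]
    by_cases h : ∀ k, k ≠ p → y k = x k
    · rw [if_pos h, if_pos fun k hk => (h k hk).symm]; rfl
    · rw [if_neg h, if_neg fun h' => h fun k hk => (h' k hk).symm, star_zero]
  | two p q hpq u =>
    ext y x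
    simp only [Gate.dag, Gate.op, Matrix.of_apply, Matrix.conjTranspose_apply]
    by_cases h : ∀ k, k ≠ p → k ≠ q → y k = x k
    · rw [if_pos h, if_pos fun k hk hk' => (h k hk hk').symm]; rfl
    · rw [if_neg h, if_neg fun h' => h fun k hk hk' => (h' k hk hk').symm, star_zero]

theorem Gate.conjTranspose_op_mul_op (g : Gate Q) : g.opᴴ * g.op = 1 := by
  rw [← Gate.op_dag]
  cases g with
  | one p u =>
    ext y x
    rw [Gate.dag, Gate.one_op_mul_apply]
    have hu : ∀ i j, ∑ b, (star u).1 i b * u.1 b j = (1 : Matrix (Fin 2) (Fin 2) ℂ) i j := by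
      intro i j
      rw [← Matrix.mul_apply]
      exact congrFun (congrFun (Unitary.coe_star_mul_self u) i) j
    by_cases h : ∀ k, k ≠ p → y k = x k
    · have : ∀ b, (Gate.one p u).op (Function.update y p b) x = u.1 b (x p) := by
        intro b
        simp only [Gate.op, Matrix.of_apply]
        rw [if_pos (fun k hk => by simp [hk, h k hk])]
        simp
      simp only [this, hu, Matrix.one_apply]
      congr 1
      apply propext
      constructor
      · intro hp; funext k
        by_cases hk : k = p
        · rw [hk, hp]
        · exact h k hk
      · rintro rfl; rfl
    · have : ∀ b, (Gate.one p u).op (Function.update y p b) x = 0 := by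
        intro b
        simp only [Gate.op, Matrix.of_apply]
        rw [if_neg]
        intro h'
        refine h fun k hk => ?_
        simpa [hk] using h' k hk
      simp only [this, mul_zero, Finset.sum_const_zero]
      rw [Matrix.one_apply_ne]
      rintro rfl
      exact h fun _ _ => rfl
  | two p q hpq u =>
    ext y x
    rw [Gate.dag, Gate.two_op_mul_apply]
    have hu : ∀ i j, ∑ b, (star u).1 i b * u.1 b j =
        (1 : Matrix (Fin 2 × Fin 2) (Fin 2 × Fin 2) ℂ) i j := by
      intro i j
      rw [← Matrix.mul_apply]
      exact congrFun (congrFun (Unitary.coe_star_mul_self u) i) j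
    by_cases h : ∀ k, k ≠ p → k ≠ q → y k = x k
    · have : ∀ b : Fin 2 × Fin 2, (Gate.two p q hpq u).op
          (Function.update (Function.update y p b.1) q b.2) x = u.1 b (x p, x q) := by
        intro b
        simp only [Gate.op, Matrix.of_apply]
        rw [if_pos (fun k hk hk' => by simp [hk, hk', h k hk hk'])]
        simp [hpq]
      simp only [this, hu, Matrix.one_apply]
      congr 1
      apply propext
      constructor
      · intro hp; funext k
        by_cases hk : k = p
        · rw [hk]; exact congrArg Prod.fst hp
        · by_cases hk' : k = q
          · rw [hk']; exact congrArg Prod.snd hp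
          · exact h k hk hk'
      · rintro rfl; rfl
    · have : ∀ b : Fin 2 × Fin 2, (Gate.two p q hpq u).op
          (Function.update (Function.update y p b.1) q b.2) x = 0 := by
        intro b
        simp only [Gate.op, Matrix.of_apply]
        rw [if_neg]
        intro h'
        refine h fun k hk hk' => ?_
        simpa [hk, hk'] using h' k hk hk'
      simp only [this, mul_zero, Finset.sum_const_zero]
      rw [Matrix.one_apply_ne]
      rintro rfl
      exact h fun _ _ _ => rfl

theorem Gate.op_mem_unitaryGroup (g : Gate Q) : g.op ∈ unitaryGroup (Basis Q) ℂ :=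
  Matrix.mem_unitaryGroup_iff'.2 g.conjTranspose_op_mul_op

/-! ## Realizing operators by circuits -/

theorem layersOp_append (L M : List (List (Gate Q))) :
    layersOp (L ++ M) = layersOp M * layersOp L := by
  induction L with
  | nil => simp [layersOp]
  | cons a L ih => rw [List.cons_append, layersOp, ih, layersOp, mul_assoc]

theorem layersOp_commute {L : List (List (Gate Q))} {A : Op Q}
    (h : ∀ l ∈ L, ∀ g ∈ l, Commute g.op A) : Commute (layersOp L) A := by
  induction L with
  | nil => exact Commute.one_left _
  | cons a L ih =>
    rw [layersOp]
    refine (ih fun l hl => h l (List.mem_cons_of_mem _ hl)).mul_left ?_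
    refine Commute.list_prod_left _ _ ?_
    intro B hB
    obtain ⟨g, hg, rfl⟩ := List.mem_map.1 hB
    exact h a List.mem_cons_self g hg

/-- Some circuit of depth at most `d` with at most `g` gates, all of them inside `S`, has the
operator `A`. -/
def Realizes (S : Finset Q) (d g : ℕ) (A : Op Q) : Prop :=
  ∃ c : Circuit Q, (∀ L ∈ c.layers, ∀ h ∈ L, h.support ⊆ S) ∧ c.depth ≤ d ∧ c.gateCount ≤ g ∧
    c.op = A

theorem Realizes.mono {S T : Finset Q} {d d' g g' : ℕ} {A : Op Q} (h : Realizes S d g A)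
    (hS : S ⊆ T) (hd : d ≤ d') (hg : g ≤ g') : Realizes T d' g' A := by
  obtain ⟨c, h1, h2, h3, h4⟩ := h
  exact ⟨c, fun L hL k hk => (h1 L hL k hk).trans hS, h2.trans hd, h3.trans hg, h4⟩

theorem Realizes.congr_op {S : Finset Q} {d g : ℕ} {A B : Op Q} (h : Realizes S d g A)
    (hAB : A = B) : Realizes S d g B := hAB ▸ h

theorem Realizes.one (S : Finset Q) : Realizes S 0 0 (1 : Op Q) :=
  ⟨⟨[], by simp⟩, by simp, by simp [Circuit.depth], by simp [Circuit.gateCount], rfl⟩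

theorem Gate.realizes (g : Gate Q) : Realizes g.support 1 1 g.op :=
  ⟨⟨[[g]], by simp⟩, by simp, by simp [Circuit.depth], by simp [Circuit.gateCount],
    by simp [Circuit.op, layersOp]⟩

theorem Realizes.mul {S : Finset Q} {d d' g g' : ℕ} {A B : Op Q} (hA : Realizes S d g A)
    (hB : Realizes S d' g' B) : Realizes S (d + d') (g + g') (A * B) := by
  obtain ⟨a, a1, a2, a3, rfl⟩ := hA
  obtain ⟨b, b1, b2, b3, rfl⟩ := hB
  refine ⟨⟨b.layers ++ a.layers, ?_⟩, ?_, ?_, ?_, ?_⟩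
  · intro L hL
    rcases List.mem_append.1 hL with h | h
    exacts [b.disjoint L h, a.disjoint L h]
  · intro L hL
    rcases List.mem_append.1 hL with h | h
    exacts [b1 L h, a1 L h]
  · simp only [Circuit.depth, List.length_append] at *; omega
  · simp only [Circuit.gateCount, List.map_append, List.sum_append] at *; omega
  · simp [Circuit.op, layersOp_append]

/-- The two layer lists are merged index by index. The product splits because a layer inside `S`
commutes with every remaining layer inside `T`. -/
theorem exists_parallel_layers {S T : Finset Q} (hST : Disjoint S T) :
    ∀ (d : ℕ) (L M : List (List (Gate Q))), L.length ≤ d → M.length ≤ d →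
    (∀ l ∈ L, l.Pairwise fun g h => Disjoint g.support h.support) →
    (∀ l ∈ M, l.Pairwise fun g h => Disjoint g.support h.support) →
    (∀ l ∈ L, ∀ g ∈ l, g.support ⊆ S) → (∀ l ∈ M, ∀ g ∈ l, g.support ⊆ T) →
    ∃ N : List (List (Gate Q)), N.length ≤ d ∧
      (∀ l ∈ N, l.Pairwise fun g h => Disjoint g.support h.support) ∧
      (∀ l ∈ N, ∀ g ∈ l, g.support ⊆ S ∪ T) ∧
      (N.map List.length).sum = (L.map List.length).sum + (M.map List.length).sum ∧
      layersOp N = layersOp L * layersOp M := by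
  intro d
  induction d with
  | zero =>
    intro L M hL hM _ _ _ _
    rw [Nat.le_zero, List.length_eq_zero_iff] at hL hM
    subst hL hM
    exact ⟨[], by simp [layersOp]⟩
  | succ d ih =>
    intro L M hL hM pL pM sL sM
    rcases L with _ | ⟨a, L⟩
    · refine ⟨M, hM, pM, fun l hl g hg => (sM l hl g hg).trans Finset.subset_union_right, by simp,
        by simp [layersOp]⟩
    rcases M with _ | ⟨b, M⟩
    · refine ⟨a :: L, hL, pL, fun l hl g hg => (sL l hl g hg).trans Finset.subset_union_left,
        by simp, by simp [layersOp]⟩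
    simp only [List.length_cons, Nat.add_le_add_iff_right] at hL hM
    obtain ⟨N, n1, n2, n3, n4, n5⟩ := ih L M hL hM (fun l hl => pL l (List.mem_cons_of_mem _ hl))
      (fun l hl => pM l (List.mem_cons_of_mem _ hl)) (fun l hl => sL l (List.mem_cons_of_mem _ hl))
      (fun l hl => sM l (List.mem_cons_of_mem _ hl))
    refine ⟨(a ++ b) :: N, by simpa using n1, ?_, ?_, ?_, ?_⟩
    · intro l hl
      rcases List.mem_cons.1 hl with rfl | hl
      · rw [List.pairwise_append]
        refine ⟨pL a List.mem_cons_self, pM b List.mem_cons_self, fun g hg h hh => ?_⟩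
        exact Finset.disjoint_of_subset_left (sL a List.mem_cons_self g hg)
          (Finset.disjoint_of_subset_right (sM b List.mem_cons_self h hh) hST)
      · exact n2 l hl
    · intro l hl g hg
      rcases List.mem_cons.1 hl with rfl | hl
      · rcases List.mem_append.1 hg with h | h
        · exact (sL a List.mem_cons_self g h).trans Finset.subset_union_left
        · exact (sM b List.mem_cons_self g h).trans Finset.subset_union_right
      · exact n3 l hl g hg
    · simp only [List.map_cons, List.sum_cons, List.length_append, n4]; omega
    · have hc : Commute (layersOp M) (a.map Gate.op).prod := by
        refine layersOp_commute fun l hl g hg => Commute.list_prod_right _ _ fun B hB => ?_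
        obtain ⟨h, hh, rfl⟩ := List.mem_map.1 hB
        refine g.isLocal_op.commute h.isLocal_op ?_
        exact (Finset.disjoint_of_subset_left (sL a List.mem_cons_self h hh)
          (Finset.disjoint_of_subset_right (sM l (List.mem_cons_of_mem _ hl) g hg) hST)).symm
      simp only [layersOp, n5, List.map_append, List.prod_append]
      rw [mul_assoc, mul_assoc, ← mul_assoc (layersOp M), hc.eq, mul_assoc]

/-- Unlike in `Realizes.mul`, the depths are not added; every logarithmic depth bound rests on this.
-/
theorem Realizes.par {S T : Finset Q} {d g g' : ℕ} {A B : Op Q} (hA : Realizes S d g A)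
    (hB : Realizes T d g' B) (hST : Disjoint S T) : Realizes (S ∪ T) d (g + g') (A * B) := by
  obtain ⟨a, a1, a2, a3, rfl⟩ := hA
  obtain ⟨b, b1, b2, b3, rfl⟩ := hB
  obtain ⟨N, n1, n2, n3, n4, n5⟩ := exists_parallel_layers hST d a.layers b.layers a2 b2 a.disjoint
    b.disjoint a1 b1
  refine ⟨⟨N, n2⟩, n3, n1, ?_, n5⟩
  simp only [Circuit.gateCount] at *
  omega

theorem Realizes.list_par {ι : Type*} (l : List ι) (S : ι → Finset Q) (A : ι → Op Q) (d g : ℕ)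
    (h : ∀ i ∈ l, Realizes (S i) d g (A i)) (hd : l.Pairwise fun i j => Disjoint (S i) (S j)) :
    Realizes (Finset.univ.filter fun q => ∃ i ∈ l, q ∈ S i) d (l.length * g)
      (l.map A).prod := by
  induction l with
  | nil => simpa using (Realizes.one _).mono (Finset.Subset.refl _) (Nat.zero_le d) le_rfl
  | cons i l ih =>
    rw [List.pairwise_cons] at hd
    have := (h i List.mem_cons_self).par (ih (fun j hj => h j (List.mem_cons_of_mem _ hj)) hd.2) ?_
    · rw [List.map_cons, List.prod_cons]
      refine this.mono ?_ le_rfl ?_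
      · intro q hq
        simpa using hq
      · rw [List.length_cons]; apply le_of_eq; ring
    · rw [Finset.disjoint_left]
      intro q hq hq'
      obtain ⟨j, hj, hqj⟩ := (Finset.mem_filter.1 hq').2
      exact Finset.disjoint_left.1 (hd.1 j hj) hq hqj

theorem Realizes.list_prod {ι : Type*} (l : List ι) (S : Finset Q) (A : ι → Op Q) (d g : ℕ)
    (h : ∀ i ∈ l, Realizes S d g (A i)) :
    Realizes S (l.length * d) (l.length * g) (l.map A).prod := by
  induction l with
  | nil => simpa using Realizes.one S
  | cons i l ih =>
    have := (h i List.mem_cons_self).mul (ih fun j hj => h j (List.mem_cons_of_mem _ hj))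
    rw [List.map_cons, List.prod_cons]
    refine this.mono (Finset.Subset.refl _) ?_ ?_ <;>
    · rw [List.length_cons]; apply le_of_eq; ring

theorem exists_layers_conjTranspose (L : List (List (Gate Q)))
    (hL : ∀ l ∈ L, l.Pairwise fun g h => Disjoint g.support h.support) :
    ∀ S : Finset Q, (∀ l ∈ L, ∀ g ∈ l, g.support ⊆ S) →
    ∃ N : List (List (Gate Q)), N.length = L.length ∧
      (∀ l ∈ N, l.Pairwise fun g h => Disjoint g.support h.support) ∧
      (∀ l ∈ N, ∀ g ∈ l, g.support ⊆ S) ∧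
      (N.map List.length).sum = (L.map List.length).sum ∧ layersOp N = (layersOp L)ᴴ := by
  intro S
  induction L with
  | nil => intro _; exact ⟨[], by simp [layersOp]⟩
  | cons a L ih =>
    intro hS
    obtain ⟨N, n1, n2, n3, n4, n5⟩ := ih (fun l hl => hL l (List.mem_cons_of_mem _ hl))
      (fun l hl => hS l (List.mem_cons_of_mem _ hl))
    -- The layer is reversed so that its product is literally the adjoint, without an appeal to
    -- commutativity inside the layer.
    refine ⟨N ++ [(a.map Gate.dag).reverse], by simp [n1], ?_, ?_, by simp [n4]; ring, ?_⟩
    · intro l hl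
      rcases List.mem_append.1 hl with h | h
      · exact n2 l h
      · rw [List.mem_singleton] at h
        subst h
        rw [List.pairwise_reverse, List.pairwise_map]
        refine (hL a List.mem_cons_self).imp fun {g h} hgh => ?_
        rw [Gate.support_dag, Gate.support_dag]
        exact hgh.symm
    · intro l hl g hg
      rcases List.mem_append.1 hl with h | h
      · exact n3 l h g hg
      · rw [List.mem_singleton] at h
        subst h
        rw [List.mem_reverse, List.mem_map] at hg
        obtain ⟨k, hk, rfl⟩ := hg
        rw [Gate.support_dag]
        exact hS a List.mem_cons_self k hk
    · rw [layersOp_append, n5]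
      simp only [layersOp, one_mul, Matrix.conjTranspose_mul]
      rw [Matrix.conjTranspose_list_prod, List.map_reverse, List.map_map, List.map_map]
      congr 2
      exact congrArg _ (List.map_congr_left fun g _ => g.op_dag)

theorem Realizes.conjTranspose {S : Finset Q} {d g : ℕ} {A : Op Q} (hA : Realizes S d g A) :
    Realizes S d g Aᴴ := by
  obtain ⟨a, a1, a2, a3, rfl⟩ := hA
  obtain ⟨N, n1, n2, n3, n4, n5⟩ := exists_layers_conjTranspose a.layers a.disjoint S a1
  exact ⟨⟨N, n2⟩, n3, n1.le.trans a2, n4.le.trans a3, n5⟩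

theorem Realizes.mem_unitaryGroup {S : Finset Q} {d g : ℕ} {A : Op Q} (hA : Realizes S d g A) :
    A ∈ unitaryGroup (Basis Q) ℂ := by
  obtain ⟨c, _, _, _, rfl⟩ := hA
  simp only [Circuit.op]
  induction c.layers with
  | nil => exact one_mem _
  | cons a L ih =>
    refine mul_mem ih (list_prod_mem ?_)
    intro B hB
    obtain ⟨g, _, rfl⟩ := List.mem_map.1 hB
    exact g.op_mem_unitaryGroup

theorem Realizes.conjTranspose_mul_self {S : Finset Q} {d g : ℕ} {A : Op Q}
    (hA : Realizes S d g A) : Aᴴ * A = 1 :=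
  Matrix.mem_unitaryGroup_iff'.1 hA.mem_unitaryGroup

theorem Realizes.mul_conjTranspose_self {S : Finset Q} {d g : ℕ} {A : Op Q}
    (hA : Realizes S d g A) : A * Aᴴ = 1 :=
  Matrix.mem_unitaryGroup_iff.1 hA.mem_unitaryGroup

theorem Realizes.commute {S T : Finset Q} {d g d' g' : ℕ} {A B : Op Q} (hA : Realizes S d g A)
    (hB : Realizes T d' g' B) (hST : Disjoint S T) : Commute A B := by
  obtain ⟨a, a1, _, _, rfl⟩ := hA
  obtain ⟨b, b1, _, _, rfl⟩ := hB
  refine layersOp_commute fun l hl g hg => (layersOp_commute fun l' hl' h hh => ?_).symm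
  refine h.isLocal_op.commute g.isLocal_op ?_
  exact (Finset.disjoint_of_subset_left (a1 l hl g hg)
    (Finset.disjoint_of_subset_right (b1 l' hl' h hh) hST)).symm

/-! ## Action on basis states -/

/-- `A` sends the basis state `|z⟩` to the basis state `|z'⟩`. -/
def Maps (A : Op Q) (z z' : Basis Q) : Prop := A *ᵥ Pi.single z 1 = Pi.single z' 1

theorem Maps.one (z : Basis Q) : Maps 1 z z := Matrix.one_mulVec _

theorem Maps.mul {A B : Op Q} {z z' z'' : Basis Q} (hA : Maps A z' z'') (hB : Maps B z z') :
    Maps (A * B) z z'' := by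
  unfold Maps at *
  rw [← Matrix.mulVec_mulVec, hB, hA]

/-- This is how uncomputation is proved: to see that the inverse erases something, the forward
circuit is run from the erased state. -/
theorem Maps.conjTranspose {A : Op Q} {z z' : Basis Q} (h : Maps A z z') (hA : Aᴴ * A = 1) :
    Maps Aᴴ z' z := by
  unfold Maps at *
  rw [← h, Matrix.mulVec_mulVec, hA, Matrix.one_mulVec]

theorem maps_iff {A : Op Q} {z z' : Basis Q} :
    Maps A z z' ↔ ∀ y, A y z = if y = z' then 1 else 0 := by
  unfold Maps
  rw [funext_iff]
  refine forall_congr' fun y => ?_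
  rw [Matrix.mulVec_single_one, Matrix.col_apply, Pi.single_apply]

end

section

/-! ## Phases -/

/-- `exp(2πi t)`. -/
def ee (t : ℝ) : ℂ := Complex.exp (2 * Real.pi * Complex.I * t)

theorem ee_add (s t : ℝ) : ee (s + t) = ee s * ee t := by
  rw [ee, ee, ee, ← Complex.exp_add]; congr 1; push_cast; ring

@[simp] theorem ee_zero : ee 0 = 1 := by simp [ee]

theorem ee_intCast (n : ℤ) : ee n = 1 := by
  rw [ee, Complex.exp_eq_one_iff]
  exact ⟨n, by push_cast; ring⟩

theorem ee_natCast (n : ℕ) : ee n = 1 := by exact_mod_cast ee_intCast n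

theorem ee_add_intCast (t : ℝ) (n : ℤ) : ee (t + n) = ee t := by rw [ee_add, ee_intCast, mul_one]

theorem ee_add_natCast (t : ℝ) (n : ℕ) : ee (t + n) = ee t := by rw [ee_add, ee_natCast, mul_one]

theorem star_ee (t : ℝ) : star (ee t) = ee (-t) := by
  rw [ee, ee, Complex.star_def, ← Complex.exp_conj]
  congr 1
  simp [Complex.conj_ofReal, Complex.conj_ofNat]

theorem ee_neg_mul_self (t : ℝ) : ee (-t) * ee t = 1 := by
  rw [← ee_add, neg_add_cancel, ee_zero]

theorem ee_half : ee (1 / 2) = -1 := by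
  rw [ee, ← Complex.exp_pi_mul_I]; congr 1; push_cast; ring

theorem norm_ee (t : ℝ) : ‖ee t‖ = 1 := by
  rw [ee, Complex.norm_exp]; simp

variable {Q : Type} [Fintype Q] [DecidableEq Q]

/-- The diagonal operator with phases `exp(2πi φ)`. -/
def pdiag (φ : Basis Q → ℝ) : Op Q := Matrix.diagonal fun z => ee (φ z)

theorem pdiag_mul (φ ψ : Basis Q → ℝ) : pdiag φ * pdiag ψ = pdiag fun z => φ z + ψ z := by
  simp only [pdiag, Matrix.diagonal_mul_diagonal, ee_add]

theorem pdiag_zero : pdiag (fun _ : Basis Q => 0) = 1 := by simp [pdiag]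

theorem pdiag_commute (φ ψ : Basis Q → ℝ) : Commute (pdiag φ) (pdiag ψ) := by
  unfold Commute SemiconjBy
  rw [pdiag_mul, pdiag_mul]
  simp only [add_comm]

theorem pdiag_conjTranspose (φ : Basis Q → ℝ) : (pdiag φ)ᴴ = pdiag fun z => - φ z := by
  rw [pdiag, Matrix.diagonal_conjTranspose, pdiag]
  congr 1
  funext z
  exact star_ee _

theorem pdiag_list_prod {ι : Type*} (l : List ι) (φ : ι → Basis Q → ℝ) :
    (l.map fun i => pdiag (φ i)).prod = pdiag fun z => (l.map fun i => φ i z).sum := by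
  induction l with
  | nil => simp [pdiag_zero]
  | cons i l ih => simp only [List.map_cons, List.prod_cons, ih, pdiag_mul, List.sum_cons]

theorem diagonal_ee_mem_unitaryGroup {ι : Type*} [Fintype ι] [DecidableEq ι] (θ : ι → ℝ) :
    Matrix.diagonal (fun i => ee (θ i)) ∈ unitaryGroup ι ℂ := by
  rw [Matrix.mem_unitaryGroup_iff', Matrix.star_eq_conjTranspose, Matrix.diagonal_conjTranspose,
    Matrix.diagonal_mul_diagonal, ← Matrix.diagonal_one]
  congr 1
  funext i
  simp only [Pi.star_apply, star_ee, ee_neg_mul_self]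

theorem realizes_pdiag_one (p : Q) (θ : Fin 2 → ℝ) :
    Realizes {p} 1 1 (pdiag fun z => θ (z p)) := by
  have := (Gate.one p ⟨_, diagonal_ee_mem_unitaryGroup θ⟩).realizes
  refine this.congr_op ?_
  ext y x
  simp only [pdiag, Gate.op, Matrix.of_apply, Matrix.diagonal_apply]
  by_cases h : y = x
  · subst h; simp
  · rw [if_neg h]
    split_ifs with h1 h2
    · exact absurd (funext fun k => by by_cases hk : k = p; exacts [hk ▸ h2, h1 k hk]) h
    · rfl
    · rfl

theorem realizes_pdiag_two {p q : Q} (hpq : p ≠ q) (θ : Fin 2 → Fin 2 → ℝ) :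
    Realizes {p, q} 1 1 (pdiag fun z => θ (z p) (z q)) := by
  have := (Gate.two p q hpq ⟨_, diagonal_ee_mem_unitaryGroup fun i => θ i.1 i.2⟩).realizes
  refine this.congr_op ?_
  ext y x
  simp only [pdiag, Gate.op, Matrix.of_apply, Matrix.diagonal_apply]
  by_cases h : y = x
  · subst h; simp
  · rw [if_neg h]
    split_ifs with h1 h2
    · refine absurd (funext fun k => ?_) h
      by_cases hk : k = p
      · rw [hk]; exact congrArg Prod.fst h2
      · by_cases hk' : k = q
        · rw [hk']; exact congrArg Prod.snd h2
        · exact h1 k hk hk'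
    · rfl
    · rfl

/-- The Hadamard gate. -/
def hadamard : Matrix (Fin 2) (Fin 2) ℂ :=
  Matrix.of fun y x => ee ((x.val : ℝ) * y.val / 2) / (Real.sqrt 2 : ℂ)

theorem hadamard_mem_unitaryGroup : hadamard ∈ unitaryGroup (Fin 2) ℂ := by
  have h2 : (Real.sqrt 2 : ℂ) * (Real.sqrt 2 : ℂ) = 2 := by
    rw [← Complex.ofReal_mul, Real.mul_self_sqrt (by norm_num)]; norm_num
  have h0 : (Real.sqrt 2 : ℂ) ≠ 0 := by
    intro h; rw [h] at h2; norm_num at h2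
  have e1 : ee (1 / 2) = -1 := ee_half
  have e2 : ee (2⁻¹) = -1 := by rw [← e1]; norm_num
  rw [Matrix.mem_unitaryGroup_iff']
  ext i j
  fin_cases i <;> fin_cases j <;>
    simp [hadamard, Matrix.mul_apply, Matrix.star_apply, e2, Complex.conj_ofReal] <;>
    field_simp <;> simp [pow_two, h2]; norm_num

/-! ## The Fourier transform on a sequence of qubits -/

/-- The integer stored in the qubits `e 0, …, e (k - 1)`, least significant bit first. -/
def outE {Q : Type} {k : ℕ} (e : Fin k → Q) (z : Basis Q) : ℕ := ∑ j, (z (e j)).val * 2 ^ j.val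

/-- The integer stored in the qubits `e 0, …, e (k - 1)`, most significant bit first. -/
def inE {Q : Type} {k : ℕ} (e : Fin k → Q) (z : Basis Q) : ℕ :=
  ∑ j, (z (e j)).val * 2 ^ (k - 1 - j.val)

/-- The Fourier transform modulo `2 ^ k` on the qubits `e 0, …, e (k - 1)`. -/
def qftE {k : ℕ} (e : Fin k → Q) : Op Q := Matrix.of fun y x =>
  if ∀ q, (∀ j, q ≠ e j) → y q = x q then
    ee ((inE e x : ℝ) * outE e y / 2 ^ k) / (Real.sqrt (2 ^ k) : ℂ)
  else 0

/-- Intermediate stage of the QFT circuit: Hadamard gates have been applied to the qubits `e j`,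
`2 * j < s`, and the phases for the pairs in `R` have been acquired. -/
def stageOp {k : ℕ} (e : Fin k → Q) (s : ℕ) (R : Finset (Fin k × Fin k)) : Op Q :=
  Matrix.of fun y x =>
    if ∀ q, (∀ j, 2 * j.val < s → q ≠ e j) → y q = x q then
      ee (∑ r ∈ R, ((x (e r.1)).val * (y (e r.2)).val : ℝ) / 2 ^ (r.1.val - r.2.val + 1))
        / (Real.sqrt 2 : ℂ) ^ ((s + 1) / 2)
    else 0

theorem stageOp_zero {k : ℕ} (e : Fin k → Q) : stageOp e 0 ∅ = 1 := by
  ext y x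
  simp only [stageOp, Matrix.of_apply, Matrix.one_apply, funext_iff]
  simp

theorem stageOp_succ_of_odd {k : ℕ} (e : Fin k → Q) {s : ℕ} (hs : s % 2 = 1)
    (R : Finset (Fin k × Fin k)) : stageOp e (s + 1) R = stageOp e s R := by
  ext y x
  have h1 : ∀ j : Fin k, 2 * j.val < s + 1 ↔ 2 * j.val < s := fun j => by omega
  have h2 : (s + 1 + 1) / 2 = (s + 1) / 2 := by omega
  simp only [stageOp, Matrix.of_apply, h1, h2]

/-- At time `2 * j` qubit `e j` is untouched, so the only intermediate bit is `x (e j)`. The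
Hadamard entry is then the phase `x y / 2` of the diagonal pair `(j, j)`. By `hR` no earlier phase
involves the output bit of `e j`. -/
theorem hadamard_mul_stageOp {k : ℕ} {e : Fin k → Q} (he : Function.Injective e) (j : Fin k)
    (R : Finset (Fin k × Fin k)) (hR : ∀ r ∈ R, r.2 ≠ j) :
    (Gate.one (e j) ⟨_, hadamard_mem_unitaryGroup⟩).op * stageOp e (2 * j.val) R =
      stageOp e (2 * j.val + 1) (insert (j, j) R) := by
  ext y x
  rw [Gate.one_op_mul_apply, Finset.sum_eq_single (x (e j))]
  · simp only [stageOp, Matrix.of_apply, hadamard]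
    have hiff : (∀ q, (∀ i : Fin k, 2 * i.val < 2 * j.val → q ≠ e i) →
        Function.update y (e j) (x (e j)) q = x q) ↔
        ∀ q, (∀ i : Fin k, 2 * i.val < 2 * j.val + 1 → q ≠ e i) → y q = x q := by
      constructor
      · intro h q hq
        have hqj : q ≠ e j := hq j (by omega)
        simpa [hqj] using h q fun i hi => hq i (by omega)
      · intro h q hq
        by_cases hqj : q = e j
        · rw [hqj]; simp
        · rw [Function.update_of_ne hqj]
          refine h q fun i hi => ?_
          rcases Nat.lt_or_ge (2 * i.val) (2 * j.val) with h' | h'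
          · exact hq i h'
          · have : i = j := Fin.ext (by omega)
            rw [this]; exact hqj
    by_cases h : ∀ q, (∀ i : Fin k, 2 * i.val < 2 * j.val + 1 → q ≠ e i) → y q = x q
    · rw [if_pos h, if_pos (hiff.2 h), Finset.sum_insert, ee_add]
      · have h3 : (2 * j.val + 1 + 1) / 2 = (2 * j.val + 1) / 2 + 1 := by omega
        rw [h3, pow_succ]
        have h4 : ∑ r ∈ R, ((x (e r.1)).val * (Function.update y (e j) (x (e j)) (e r.2)).val : ℝ)
            / 2 ^ (r.1.val - r.2.val + 1) =
            ∑ r ∈ R, ((x (e r.1)).val * (y (e r.2)).val : ℝ) / 2 ^ (r.1.val - r.2.val + 1) := by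
          refine Finset.sum_congr rfl fun r hr => ?_
          rw [Function.update_of_ne (he.ne (hR r hr))]
        rw [h4]
        generalize (∑ r ∈ R, ((x (e r.1)).val * (y (e r.2)).val : ℝ) /
          2 ^ (r.1.val - r.2.val + 1)) = w
        simp only [Nat.sub_self]
        ring_nf
      · intro h'
        exact hR _ h' rfl
    · rw [if_neg h, if_neg (fun h' => h (hiff.1 h')), mul_zero]
  · intro b _ hb
    simp only [stageOp, Matrix.of_apply]
    rw [if_neg, mul_zero]
    intro h
    refine hb ?_
    have := h (e j) fun i hi h' => by
      have := he h'
      rw [this] at hi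
      exact lt_irrefl _ hi
    simpa using this
  · simp

/-- A phase for the pair `(i, j)` with `j < i` has to see the output bit of `e j` and the input bit
of `e i`. At time `i + j` this is so: the Hadamard gates act at times `2 * j` and `2 * i`, before
and after it. The condition `hs` says that the first qubit of each pair still carries its input bit.
-/
theorem pdiag_mul_stageOp {k : ℕ} (e : Fin k → Q) (he : Function.Injective e) {s : ℕ}
    {R R' : Finset (Fin k × Fin k)} (hR : Disjoint R R') (hs : ∀ r ∈ R', s ≤ 2 * r.1.val) :
    (pdiag fun z => ∑ r ∈ R', ((z (e r.1)).val * (z (e r.2)).val : ℝ) /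
      2 ^ (r.1.val - r.2.val + 1)) * stageOp e s R = stageOp e s (R ∪ R') := by
  ext y x
  rw [pdiag, Matrix.diagonal_mul]
  simp only [stageOp, Matrix.of_apply]
  split_ifs with h
  · rw [Finset.sum_union hR, ee_add]
    have : ∑ r ∈ R', ((y (e r.1)).val * (y (e r.2)).val : ℝ) / 2 ^ (r.1.val - r.2.val + 1) =
        ∑ r ∈ R', ((x (e r.1)).val * (y (e r.2)).val : ℝ) / 2 ^ (r.1.val - r.2.val + 1) := by
      refine Finset.sum_congr rfl fun r hr => ?_
      rw [h (e r.1)]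
      intro j hj h'
      have := he h'
      have := hs r hr
      subst j
      omega
    rw [this]; ring
  · simp

/-- Distinct pairs with the same sum of indices share no qubit, so all their phases fit in one
layer. This scheduling makes the QFT depth linear rather than quadratic. -/
theorem realizes_pair_phases {k : ℕ} {e : Fin k → Q} (he : Function.Injective e) (t : ℕ) :
    Realizes (Finset.univ.filter fun q => ∃ j, q = e j) 1 k
      (pdiag fun z => ∑ r ∈ Finset.univ.filter (fun r : Fin k × Fin k =>
        r.2 < r.1 ∧ r.1.val + r.2.val = t), ((z (e r.1)).val * (z (e r.2)).val : ℝ) /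
      2 ^ (r.1.val - r.2.val + 1)) := by
  classical
  have key := Realizes.list_par (List.finRange k)
    (fun j => Finset.univ.filter fun q => q = e j ∧ (∃ i : Fin k, j < i ∧ i.val + j.val = t) ∨
      ∃ i : Fin k, j < i ∧ i.val + j.val = t ∧ q = e i)
    (fun j => pdiag fun z => ∑ i : Fin k, if j < i ∧ i.val + j.val = t then
      ((z (e i)).val * (z (e j)).val : ℝ) / 2 ^ (i.val - j.val + 1) else 0) 1 1 ?_ ?_
  · rw [pdiag_list_prod] at key
    refine (key.mono ?_ le_rfl (by simp)).congr_op ?_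
    · intro q hq
      simp only [Finset.mem_filter, Finset.mem_univ, true_and] at hq ⊢
      rcases hq with ⟨j, _, ⟨rfl, _⟩ | ⟨i, _, _, rfl⟩⟩
      exacts [⟨j, rfl⟩, ⟨i, rfl⟩]
    · congr 1
      funext z
      rw [Finset.sum_filter, Fintype.sum_prod_type, Finset.sum_comm, ← List.ofFn_eq_map,
        List.sum_ofFn]
  · intro j _
    by_cases h : ∃ i : Fin k, j < i ∧ i.val + j.val = t
    · obtain ⟨i, hi, hit⟩ := h
      have hu : ∀ i' : Fin k, (j < i' ∧ i'.val + j.val = t) ↔ i' = i := by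
        intro i'
        constructor
        · rintro ⟨_, h⟩; exact Fin.ext (by omega)
        · rintro rfl; exact ⟨hi, hit⟩
      have := realizes_pdiag_two (he.ne hi.ne') fun a b => (a.val * b.val : ℝ) /
        2 ^ (i.val - j.val + 1)
      refine (this.mono ?_ le_rfl le_rfl).congr_op ?_
      · intro q hq
        simp only [Finset.mem_insert, Finset.mem_singleton] at hq
        simp only [Finset.mem_filter, Finset.mem_univ, true_and]
        rcases hq with rfl | rfl
        · exact Or.inr ⟨i, hi, hit, rfl⟩
        · exact Or.inl ⟨rfl, i, hi, hit⟩
      · congr 1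
        funext z
        simp only [hu, Finset.sum_ite_eq', Finset.mem_univ, if_true]
    · refine ((Realizes.one _).mono (Finset.Subset.refl _) zero_le_one zero_le_one).congr_op ?_
      rw [← pdiag_zero]
      congr 1
      funext z
      symm
      refine Finset.sum_eq_zero fun i _ => ?_
      rw [if_neg fun h' => h ⟨i, h'⟩]
  · refine (List.nodup_finRange k).imp ?_
    intro j j' hjj
    rw [Finset.disjoint_left]
    intro q hq hq'
    simp only [Finset.mem_filter, Finset.mem_univ, true_and] at hq hq'
    have hne : j.val ≠ j'.val := fun h => hjj (Fin.ext h)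
    rcases hq with ⟨rfl, i, hi, hit⟩ | ⟨i, hi, hit, rfl⟩ <;>
      rcases hq' with ⟨h, i', hi', hit'⟩ | ⟨i', hi', hit', h⟩ <;>
      · have := congrArg Fin.val (he h)
        simp only [Fin.lt_def] at hi hi'
        omega

/-- The Fourier transform on `k` qubits is realized in depth and size linear and quadratic
in `k`. -/
theorem realizes_stageOp {k : ℕ} {e : Fin k → Q} (he : Function.Injective e) (t : ℕ)
    (ht : t ≤ 2 * k) :
    Realizes (Finset.univ.filter fun q => ∃ j, q = e j) (2 * t) ((k + 1) * t)
      (stageOp e t (Finset.univ.filter fun r => r.2 ≤ r.1 ∧ r.1.val + r.2.val < t)) := by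
  induction t with
  | zero =>
    have : (Finset.univ.filter fun r : Fin k × Fin k => r.2 ≤ r.1 ∧ r.1.val + r.2.val < 0) = ∅ := by
      simp
    rw [this, stageOp_zero]
    simpa using Realizes.one _
  | succ t ih =>
    have ih := ih (by omega)
    set R := Finset.univ.filter fun r : Fin k × Fin k => r.2 ≤ r.1 ∧ r.1.val + r.2.val < t with hR
    set R' := Finset.univ.filter fun r : Fin k × Fin k => r.2 < r.1 ∧ r.1.val + r.2.val = t with hR'
    have hs : ∀ r ∈ R', t + 1 ≤ 2 * r.1.val := by
      intro r hr
      simp only [hR', Finset.mem_filter, Finset.mem_univ, true_and, Fin.lt_def] at hr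
      omega
    rcases Nat.mod_two_eq_zero_or_one t with h0 | h1
    -- Even times `2 * j` start with the Hadamard gate on `e j`; odd times bring only pair phases.
    · have hj : t / 2 < k := by omega
      set j : Fin k := ⟨t / 2, hj⟩ with hjdef
      have hjt : t = 2 * j.val := by simp only [hjdef]; omega
      have hH := hadamard_mul_stageOp he j R (by
        intro r hr h
        simp only [hR, Finset.mem_filter, Finset.mem_univ, true_and, Fin.le_def] at hr
        rw [h] at hr
        omega)
      rw [← hjt] at hH
      have hg := (Gate.realizes (Gate.one (e j) ⟨_, hadamard_mem_unitaryGroup⟩)).mono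
        (T := Finset.univ.filter fun q => ∃ j, q = e j) (by
          intro q hq
          simp only [Gate.support, Finset.mem_singleton] at hq
          simp only [Finset.mem_filter, Finset.mem_univ, true_and]
          exact ⟨j, hq⟩) le_rfl le_rfl
      have hD := pdiag_mul_stageOp e he (s := t + 1) (R := insert (j, j) R) (R' := R') (by
        rw [Finset.disjoint_left]
        intro r hr hr'
        simp only [hR, hR', Finset.mem_insert, Finset.mem_filter, Finset.mem_univ, true_and,
          Fin.lt_def, Fin.le_def] at hr hr'
        rcases hr with rfl | hr
        · exact lt_irrefl _ hr'.1
        · omega) hs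
      refine (((realizes_pair_phases he t).mul (hg.mul ih)).mono (Finset.Subset.refl _)
        (by omega) (by ring_nf; omega)).congr_op ?_
      rw [hH, hD]
      congr 1
      ext ⟨a, b⟩
      simp only [hR, hR', Finset.mem_union, Finset.mem_insert, Finset.mem_filter, Finset.mem_univ,
        true_and, Fin.lt_def, Fin.le_def, Prod.mk.injEq, Fin.ext_iff]
      omega
    · have hD := pdiag_mul_stageOp e he (s := t + 1) (R := R) (R' := R') (by
        rw [Finset.disjoint_left]
        intro r hr hr'
        simp only [hR, hR', Finset.mem_filter, Finset.mem_univ, true_and] at hr hr'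
        omega) hs
      refine (((realizes_pair_phases he t).mul ih).mono (Finset.Subset.refl _)
        (by omega) (by ring_nf; omega)).congr_op ?_
      rw [← stageOp_succ_of_odd e h1, hD]
      congr 1
      ext ⟨a, b⟩
      simp only [hR, hR', Finset.mem_union, Finset.mem_filter, Finset.mem_univ,
        true_and, Fin.lt_def, Fin.le_def]
      omega

/-- In the expansion of the product into pairs of bits, the pairs with `r.1 < r.2` contribute
integers, which a phase does not see. Only the pairs handled by the circuit remain. -/
theorem exists_inE_mul_outE_div {k : ℕ} (e : Fin k → Q) (x y : Basis Q) :
    ∃ N : ℕ, (inE e x : ℝ) * outE e y / 2 ^ k =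
      ∑ r ∈ Finset.univ.filter (fun r : Fin k × Fin k => r.2 ≤ r.1 ∧ r.1.val + r.2.val < 2 * k),
        ((x (e r.1)).val * (y (e r.2)).val : ℝ) / 2 ^ (r.1.val - r.2.val + 1) + N := by
  refine ⟨∑ r : Fin k × Fin k, if r.2 ≤ r.1 then 0 else
    (x (e r.1)).val * (y (e r.2)).val * 2 ^ (r.2.val - r.1.val - 1), ?_⟩
  rw [inE, outE]
  push_cast
  rw [Finset.sum_mul_sum, ← Fintype.sum_prod_type', Finset.sum_div, Finset.sum_filter,
    ← Finset.sum_add_distrib]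
  refine Finset.sum_congr rfl fun r _ => ?_
  obtain ⟨i, j⟩ := r
  have hi := i.2
  have hj := j.2
  by_cases h : j ≤ i
  · rw [if_pos h, if_pos ⟨h, by simp only; omega⟩, add_zero]
    rw [div_eq_div_iff (by positivity) (by positivity)]
    have : (2 : ℝ) ^ k = 2 ^ (k - 1 - i.val) * 2 ^ j.val * 2 ^ (i.val - j.val + 1) := by
      rw [← pow_add, ← pow_add]; congr 1
      simp only [Fin.le_def] at h; omega
    rw [this]; ring
  · rw [if_neg h, if_neg fun h' => h h'.1, zero_add, div_eq_iff (by positivity)]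
    have : (2 : ℝ) ^ (k - 1 - i.val) * 2 ^ j.val = 2 ^ (j.val - i.val - 1) * 2 ^ k := by
      rw [← pow_add, ← pow_add]; congr 1
      simp only [Fin.le_def] at h; omega
    calc _ = ((x (e i)).val * (y (e j)).val : ℝ) * (2 ^ (k - 1 - i.val) * 2 ^ j.val) := by ring
      _ = _ := by rw [this]; ring

theorem stageOp_two_mul {k : ℕ} (e : Fin k → Q) :
    stageOp e (2 * k) (Finset.univ.filter fun r => r.2 ≤ r.1 ∧ r.1.val + r.2.val < 2 * k) =
      qftE e := by
  ext y x
  simp only [stageOp, qftE, Matrix.of_apply]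
  have h1 : ∀ j : Fin k, 2 * j.val < 2 * k ↔ True := fun j => by simp
  simp only [h1, true_imp_iff]
  obtain ⟨N, hN⟩ := exists_inE_mul_outE_div e x y
  rw [hN, ee_add_natCast]
  have h2 : (2 * k + 1) / 2 = k := by omega
  have h3 : (Real.sqrt (2 ^ k) : ℂ) = (Real.sqrt 2 : ℂ) ^ k := by
    rw [← Complex.ofReal_pow]
    congr 1
    rw [← Real.sqrt_sq (pow_nonneg (Real.sqrt_nonneg 2) k), ← pow_mul, mul_comm k 2, pow_mul,
      Real.sq_sqrt (by norm_num)]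
  rw [h2, h3]

theorem realizes_qftE {k : ℕ} {e : Fin k → Q} (he : Function.Injective e) :
    Realizes (Finset.univ.filter fun q => ∃ j, q = e j) (4 * k) (2 * k * (k + 1)) (qftE e) := by
  refine ((realizes_stageOp he (2 * k) le_rfl).mono (Finset.Subset.refl _) (by omega)
    (by apply le_of_eq; ring)).congr_op (stageOp_two_mul e)

end

section

variable {Q : Type} [Fintype Q] [DecidableEq Q]

/-! ## Addition in the Fourier basis -/

/-- The qubits `e 0, …, e (k - 1)`. -/
def qubitsOf {k : ℕ} (e : Fin k → Q) : Finset Q := Finset.univ.filter fun q => ∃ j, q = e j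

theorem mem_qubitsOf {k : ℕ} {e : Fin k → Q} {q : Q} : q ∈ qubitsOf e ↔ ∃ j, q = e j := by
  simp [qubitsOf]

theorem notMem_qubitsOf {k : ℕ} {e : Fin k → Q} {q : Q} : q ∉ qubitsOf e ↔ ∀ j, q ≠ e j := by
  simp [qubitsOf]

theorem outE_congr {k : ℕ} {e : Fin k → Q} {x y : Basis Q} (h : ∀ j, x (e j) = y (e j)) :
    outE e x = outE e y := by
  simp only [outE, h]

/-- Phase rotations in the Fourier basis add `w z` to the integer stored in the qubits of `e`. -/
theorem maps_qftE_conj {k : ℕ} {e : Fin k → Q} (he : Function.Injective e) {w : Basis Q → ℕ}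
    {z z' : Basis Q} (hw : ∀ x, (∀ q ∉ qubitsOf e, x q = z q) → w x = w z)
    (hz : ∀ q ∉ qubitsOf e, z' q = z q) (hout : outE e z' ≡ outE e z + w z [MOD 2 ^ k]) :
    Maps (qftE e * (pdiag (fun x => -(w x * inE e x / 2 ^ k : ℝ)) * (qftE e)ᴴ)) z z' := by
  have hU := (realizes_qftE he).mul_conjTranspose_self
  -- The column `z` of the inverse transform carries the phases `-X z / 2 ^ k`, so the extra phase
  -- `-w X / 2 ^ k` turns it into the column `z'`. Applying the transform then yields the basis
  -- state `z'`.
  have key : (pdiag (fun x => -(w x * inE e x / 2 ^ k : ℝ)) * (qftE e)ᴴ) *ᵥ Pi.single z 1 =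
      (qftE e)ᴴ *ᵥ Pi.single z' 1 := by
    funext x
    simp only [Matrix.mulVec_single_one, Matrix.col_apply]
    rw [pdiag, Matrix.diagonal_mul]
    simp only [Matrix.conjTranspose_apply, qftE, Matrix.of_apply]
    by_cases h : ∀ q, (∀ j, q ≠ e j) → z q = x q
    · rw [if_pos h, if_pos fun q hq => (hz q (notMem_qubitsOf.2 hq)).trans (h q hq)]
      rw [hw x fun q hq => (h q (notMem_qubitsOf.1 hq)).symm]
      rw [star_div₀, star_div₀, star_ee, star_ee, ← mul_div_assoc, ← ee_add]
      congr 1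
      obtain ⟨N, hN⟩ := (Nat.modEq_iff_dvd.1 hout)
      have hN' : (outE e z : ℝ) + w z - outE e z' = 2 ^ k * N := by exact_mod_cast hN
      have : (outE e z : ℝ) + w z = outE e z' + 2 ^ k * N := by linarith
      rw [show -((w z : ℝ) * inE e x / 2 ^ k) + -((inE e x : ℝ) * outE e z / 2 ^ k) =
        -((inE e x : ℝ) * outE e z' / 2 ^ k) + ((-(inE e x : ℤ) * N : ℤ) : ℝ) by
          push_cast
          field_simp
          linear_combination -(inE e x : ℝ) * this]
      rw [ee_add_intCast]
    · rw [if_neg h, if_neg fun h' => h fun q hq => (hz q (notMem_qubitsOf.2 hq)).symm.trans (h' q hq)]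
      simp
  unfold Maps
  rw [← Matrix.mulVec_mulVec, key, Matrix.mulVec_mulVec, hU, Matrix.one_mulVec]

/-- The phase is linear in the stored integer, so it splits into one term per bit, hence into one-
or two-qubit gates. -/
theorem mul_inE_div {k : ℕ} (e : Fin k → Q) (w : Basis Q → ℝ) (x : Basis Q) :
    -(w x * inE e x / 2 ^ k : ℝ) = ((List.finRange k).map fun j =>
      -(w x * ((x (e j)).val * 2 ^ (k - 1 - j.val)) / 2 ^ k : ℝ)).sum := by
  rw [← List.ofFn_eq_map, List.sum_ofFn, inE, Finset.sum_neg_distrib, ← Finset.sum_div,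
    ← Finset.mul_sum]
  push_cast
  rfl

/-- Addition in the Fourier basis: inverse QFT, phases, QFT. The depth `9 * k` is `4 * k + k + 4 *
k`. -/
theorem exists_add_const {k : ℕ} {e : Fin k → Q} (he : Function.Injective e) (r : ℕ) :
    ∃ A : Op Q, Realizes (qubitsOf e) (9 * k) (4 * k * (k + 1) + k) A ∧
      ∀ z z' : Basis Q, (∀ q ∉ qubitsOf e, z' q = z q) → outE e z' ≡ outE e z + r [MOD 2 ^ k] →
        Maps A z z' := by
  refine ⟨_, ?_, fun z z' h h' => maps_qftE_conj he (w := fun _ => r) (fun _ _ => rfl) h h'⟩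
  have hD : Realizes (qubitsOf e) (k * 1) (k * 1) (pdiag fun x => -((r : ℝ) * inE e x / 2 ^ k)) := by
    have := Realizes.list_prod (List.finRange k) (qubitsOf e) (fun j => pdiag fun x : Basis Q =>
      -((r : ℝ) * ((x (e j)).val * 2 ^ (k - 1 - j.val)) / 2 ^ k : ℝ)) 1 1 fun j _ =>
        (realizes_pdiag_one (e j) fun b => -((r : ℝ) * (b.val * 2 ^ (k - 1 - j.val)) / 2 ^ k)).mono
          (by intro q hq; exact mem_qubitsOf.2 ⟨j, by simpa using hq⟩) le_rfl le_rfl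
    rw [List.length_finRange] at this
    refine this.congr_op ?_
    rw [pdiag_list_prod]
    congr 1
    funext x
    exact (mul_inE_div e (fun _ => (r : ℝ)) x).symm
  exact ((realizes_qftE he).mul (hD.mul (realizes_qftE he).conjTranspose)).mono
    (Finset.Subset.refl _) (by omega) (by ring_nf; omega)

/-- Each phase now depends on the control `c` and one bit of the register, so a two-qubit gate
suffices. This lets a block absorb its own addend and the incoming carry at the same time. -/
theorem exists_add_ctrl {k : ℕ} {e : Fin k → Q} (he : Function.Injective e) (r : ℕ) {c : Q}
    (hc : c ∉ qubitsOf e) :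
    ∃ A : Op Q, Realizes (insert c (qubitsOf e)) (9 * k) (4 * k * (k + 1) + k) A ∧
      ∀ z z' : Basis Q, (∀ q ∉ qubitsOf e, z' q = z q) →
        outE e z' ≡ outE e z + (r + (z c).val) [MOD 2 ^ k] → Maps A z z' := by
  refine ⟨_, ?_, fun z z' h h' => maps_qftE_conj he (w := fun x => r + (x c).val)
    (fun x hx => by simp only [hx c hc]) h h'⟩
  have hD : Realizes (insert c (qubitsOf e)) (k * 1) (k * 1)
      (pdiag fun x => -(((r + (x c).val : ℕ) : ℝ) * inE e x / 2 ^ k)) := by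
    have := Realizes.list_prod (List.finRange k) (insert c (qubitsOf e)) (fun j => pdiag
      fun x : Basis Q => -(((r + (x c).val : ℕ) : ℝ) * ((x (e j)).val * 2 ^ (k - 1 - j.val)) /
        2 ^ k : ℝ)) 1 1 fun j _ =>
        (realizes_pdiag_two (p := c) (q := e j) (notMem_qubitsOf.1 hc j) fun a b =>
          -(((r + a.val : ℕ) : ℝ) * (b.val * 2 ^ (k - 1 - j.val)) / 2 ^ k)).mono
          (by
            refine Finset.insert_subset_insert _ ?_
            intro q hq; exact mem_qubitsOf.2 ⟨j, by simpa using hq⟩) le_rfl le_rfl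
    rw [List.length_finRange] at this
    refine this.congr_op ?_
    rw [pdiag_list_prod]
    congr 1
    funext x
    exact (mul_inE_div e (fun x => ((r + (x c).val : ℕ) : ℝ)) x).symm
  have hF := (realizes_qftE he).mono (Finset.subset_insert c (qubitsOf e)) le_rfl le_rfl
  exact (hF.mul (hD.mul hF.conjTranspose)).mono
    (Finset.Subset.refl _) (by omega) (by ring_nf; omega)

/-! ## Reversible logic -/

theorem qubitsOf_const (t : Q) : qubitsOf (fun _ : Fin 1 => t) = {t} := by
  ext q; simp [mem_qubitsOf]

theorem outE_const (t : Q) (z : Basis Q) : outE (fun _ : Fin 1 => t) z = (z t).val := by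
  simp [outE]

theorem update_off {t q : Q} (z : Basis Q) (b : Fin 2) (h : q ∉ qubitsOf (fun _ : Fin 1 => t)) :
    Function.update z t b q = z q := by
  rw [qubitsOf_const, Finset.mem_singleton] at h
  exact Function.update_of_ne h _ _

/-- The logic gates NOT, CNOT and Toffoli are all treated as additions modulo `2` on a one-qubit
register, of `1`, of a bit, and of a product of two bits. -/
theorem exists_not (t : Q) : ∃ A : Op Q, Realizes {t} 9 9 A ∧
    ∀ z, Maps A z (Function.update z t (z t + 1)) := by
  obtain ⟨A, hA, h⟩ := exists_add_const (e := fun _ : Fin 1 => t)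
    (Function.injective_of_subsingleton _) 1
  rw [qubitsOf_const] at hA
  refine ⟨A, hA, fun z => h z _ (fun q hq => update_off z _ hq) ?_⟩
  rw [outE_const, outE_const, Function.update_self, Fin.val_add]
  exact Nat.mod_modEq _ _

theorem exists_cnot {c t : Q} (hct : c ≠ t) : ∃ A : Op Q, Realizes {c, t} 9 9 A ∧
    ∀ z, Maps A z (Function.update z t (z t + z c)) := by
  obtain ⟨A, hA, h⟩ := exists_add_ctrl (e := fun _ : Fin 1 => t)
    (Function.injective_of_subsingleton _) 0 (c := c) (by rw [qubitsOf_const]; simpa using hct)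
  rw [qubitsOf_const] at hA
  refine ⟨A, hA, fun z => h z _ (fun q hq => update_off z _ hq) ?_⟩
  rw [outE_const, outE_const, Function.update_self, Fin.val_add, zero_add]
  exact Nat.mod_modEq _ _

theorem conj_pdiag_of_maps {C : Op Q} {f : Basis Q → Basis Q} (hC : ∀ z, Maps C z (f z))
    (hf : ∀ z, f (f z) = z) (φ : Basis Q → ℝ) :
    C * (pdiag φ * C) = pdiag fun z => φ (f z) := by
  ext y x
  rw [Matrix.mul_apply, Finset.sum_eq_single (f x)]
  · rw [pdiag, Matrix.diagonal_mul, maps_iff.1 (hC x), maps_iff.1 (hC (f x)), hf, if_pos rfl, pdiag,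
      Matrix.diagonal_apply]
    by_cases h : y = x
    · subst h; simp
    · simp [h]
  · intro z _ hz
    rw [pdiag, Matrix.diagonal_mul, maps_iff.1 (hC x), if_neg hz, mul_zero, mul_zero]
  · simp

/-- The three-qubit phase comes from two-qubit gates through `2 a b = a + b - (a ⊕ b)`, with `a ⊕ b`
held temporarily in `b` between two CNOTs. -/
theorem realizes_ccz {a b t : Q} (hab : a ≠ b) (hat : a ≠ t) (hbt : b ≠ t) :
    Realizes {a, b, t} 21 21 (pdiag fun z : Basis Q =>
      -((((z a).val * (z b).val : ℕ) : ℝ) * (z t).val / 2)) := by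
  obtain ⟨C, hC, hm⟩ := exists_cnot hab
  have hC' := hC.mono (T := {a, b, t}) (by intro q; simp; tauto) le_rfl le_rfl
  have h1 := (realizes_pdiag_two hbt fun i j => -((i.val : ℝ) * j.val / 4)).mono
    (T := {a, b, t}) (by intro q; simp; tauto) le_rfl le_rfl
  have h2 := (realizes_pdiag_two hbt fun i j => ((i.val : ℝ) * j.val / 4)).mono
    (T := {a, b, t}) (by intro q; simp; tauto) le_rfl le_rfl
  have h3 := (realizes_pdiag_two hat fun i j => -((i.val : ℝ) * j.val / 4)).mono
    (T := {a, b, t}) (by intro q; simp; tauto) le_rfl le_rfl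
  refine (h1.mul ((hC'.mul (h2.mul hC')).mul h3)).congr_op ?_
  rw [conj_pdiag_of_maps hm, pdiag_mul, pdiag_mul]
  · congr 1
    funext z
    simp only [Function.update_self, Function.update_of_ne hbt.symm]
    generalize z a = i
    generalize z b = j
    generalize z t = k
    fin_cases i <;> fin_cases j <;> fin_cases k <;> norm_num
  · intro z
    funext q
    by_cases h : q = b
    · subst h
      simp only [Function.update_self, Function.update_of_ne hab]
      generalize z a = i
      generalize z q = j
      fin_cases i <;> fin_cases j <;> rfl
    · simp only [Function.update_of_ne h]

theorem exists_toffoli {a b t : Q} (hab : a ≠ b) (hat : a ≠ t) (hbt : b ≠ t) :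
    ∃ A : Op Q, Realizes {a, b, t} 29 29 A ∧
      ∀ z, Maps A z (Function.update z t (z t + z a * z b)) := by
  have he : Function.Injective (fun _ : Fin 1 => t) := Function.injective_of_subsingleton _
  refine ⟨_, ?_, fun z => maps_qftE_conj he (w := fun x => (x a).val * (x b).val) ?_
    (fun q hq => update_off z _ hq) ?_⟩
  · have hF := realizes_qftE he
    rw [← qubitsOf, qubitsOf_const] at hF
    have hF' := hF.mono (T := {a, b, t}) (by intro q; simp; tauto) le_rfl le_rfl
    refine (hF'.mul (Realizes.mul (g := 21) (d := 21) ?_ hF'.conjTranspose)).mono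
      (Finset.Subset.refl _) (by norm_num) (by norm_num)
    refine (realizes_ccz hab hat hbt).congr_op ?_
    congr 1
    funext z
    simp [inE]
  · intro x hx
    rw [qubitsOf_const] at hx
    simp only [hx a (by simpa using hat), hx b (by simpa using hbt)]
  · rw [outE_const, outE_const, Function.update_self, Fin.val_add, Fin.val_mul]
    exact (Nat.mod_modEq _ _).trans (Nat.ModEq.add_left _ (Nat.mod_modEq _ _))

end

section

variable {Q : Type} [Fintype Q] [DecidableEq Q]

/-! ## Integers stored in lists of qubits -/

theorem outE_eq_finFunctionFinEquiv {k : ℕ} (e : Fin k → Q) (z : Basis Q) :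
    outE e z = (finFunctionFinEquiv fun j => z (e j)).val := by
  rw [finFunctionFinEquiv_apply]; rfl

theorem outE_lt {k : ℕ} (e : Fin k → Q) (z : Basis Q) : outE e z < 2 ^ k := by
  rw [outE_eq_finFunctionFinEquiv]; exact Fin.is_lt _

theorem eq_of_outE_eq {k : ℕ} {e : Fin k → Q} {z z' : Basis Q} (h : outE e z = outE e z') (j : Fin k) :
    z (e j) = z' (e j) := by
  rw [outE_eq_finFunctionFinEquiv, outE_eq_finFunctionFinEquiv] at h
  exact congrFun (finFunctionFinEquiv.injective (Fin.ext h)) j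

theorem exists_outE_eq {k : ℕ} {e : Fin k → Q} (he : Function.Injective e) (z : Basis Q) {v : ℕ}
    (hv : v < 2 ^ k) : ∃ z' : Basis Q, (∀ q ∉ qubitsOf e, z' q = z q) ∧ outE e z' = v := by
  refine ⟨Function.extend e (finFunctionFinEquiv.symm ⟨v, hv⟩) z, fun q hq => ?_, ?_⟩
  · apply Function.extend_apply'
    rintro ⟨j, rfl⟩
    exact notMem_qubitsOf.1 hq j rfl
  · rw [outE_eq_finFunctionFinEquiv]
    simp only [he.extend_apply]
    rw [show (fun j => finFunctionFinEquiv.symm ⟨v, hv⟩ j) = finFunctionFinEquiv.symm ⟨v, hv⟩ from rfl,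
      Equiv.apply_symm_apply]

/-- The integer stored in a list of qubits, least significant bit first. -/
def outL {Q : Type} (l : List Q) (z : Basis Q) : ℕ := outE l.get z

theorem qubitsOf_get (l : List Q) : qubitsOf l.get = l.toFinset := by
  ext q
  rw [mem_qubitsOf, List.mem_toFinset, List.mem_iff_get]
  simp only [eq_comm]

theorem outL_nil (z : Basis Q) : outL [] z = 0 := by simp [outL, outE]

theorem outL_cons (q : Q) (l : List Q) (z : Basis Q) :
    outL (q :: l) z = (z q).val + 2 * outL l z := by
  unfold outL outE
  refine (Fin.sum_univ_succ (n := l.length) _).trans ?_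
  simp only [List.get_cons_zero, Fin.val_zero, pow_zero, mul_one, Fin.val_succ,
    Finset.mul_sum]
  congr 1
  refine Finset.sum_congr rfl fun j _ => ?_
  change (z (l.get j)).val * 2 ^ (j.val + 1) = _
  ring

theorem outL_append (l m : List Q) (z : Basis Q) :
    outL (l ++ m) z = outL l z + 2 ^ l.length * outL m z := by
  induction l with
  | nil => simp [outL_nil]
  | cons q l ih => rw [List.cons_append, outL_cons, outL_cons, ih, List.length_cons]; ring

theorem outL_lt (l : List Q) (z : Basis Q) : outL l z < 2 ^ l.length := outE_lt _ _

theorem outL_congr {l : List Q} {z z' : Basis Q} (h : ∀ q ∈ l, z q = z' q) : outL l z = outL l z' :=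
  outE_congr fun j => h _ (List.get_mem l j)

theorem eq_of_outL_eq {l : List Q} {z z' : Basis Q} (h : outL l z = outL l z') {q : Q} (hq : q ∈ l) :
    z q = z' q := by
  obtain ⟨j, rfl⟩ := List.mem_iff_get.1 hq
  exact eq_of_outE_eq h j

theorem exists_outL_eq {l : List Q} (hl : l.Nodup) (z : Basis Q) {v : ℕ} (hv : v < 2 ^ l.length) :
    ∃ z' : Basis Q, (∀ q ∉ l, z' q = z q) ∧ outL l z' = v := by
  obtain ⟨z', h, h'⟩ := exists_outE_eq (List.nodup_iff_injective_get.1 hl) z hv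
  refine ⟨z', fun q hq => h q ?_, h'⟩
  rwa [qubitsOf_get, List.mem_toFinset]

/-- Bitwise complement is the reflection `v ↦ 2 ^ k - 1 - v`; the erasure of the carries depends on
it. -/
theorem outL_flip_add (l : List Q) (z : Basis Q) {f : Basis Q} (h : ∀ q ∈ l, f q = z q + 1) :
    outL l f + outL l z + 1 = 2 ^ l.length := by
  induction l with
  | nil => simp [outL_nil]
  | cons q l ih =>
    have ih := ih fun q hq => h q (List.mem_cons_of_mem _ hq)
    rw [outL_cons, outL_cons, List.length_cons, pow_succ, ← ih, h q List.mem_cons_self]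
    have : (z q + 1).val + (z q).val = 1 := by
      generalize z q = b
      fin_cases b <;> rfl
    omega

/-- The bit that tells whether `v` is at least `N`. -/
def carryBit (N v : ℕ) : Fin 2 := if N ≤ v then 1 else 0

theorem carryBit_of_le {N v : ℕ} (h : N ≤ v) : carryBit N v = 1 := if_pos h

theorem carryBit_of_lt {N v : ℕ} (h : v < N) : carryBit N v = 0 := if_neg (not_le.2 h)

/-- Bound on the gate count of an addition on at most `m + 1` qubits. -/
def addCost (m : ℕ) : ℕ := 4 * (m + 1) * (m + 2) + (m + 1)

theorem addCost_bound {k m : ℕ} (h : k ≤ m + 1) : 4 * k * (k + 1) + k ≤ addCost m := by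
  unfold addCost
  have : 4 * k * (k + 1) ≤ 4 * (m + 1) * (m + 2) :=
    Nat.mul_le_mul (Nat.mul_le_mul_left 4 h) (by omega)
  omega

theorem exists_add_list {l : List Q} (hl : l.Nodup) (r : ℕ) {m : ℕ} (hm : l.length ≤ m + 1) :
    ∃ A : Op Q, Realizes l.toFinset (9 * (m + 1)) (addCost m) A ∧
      ∀ z z' : Basis Q, (∀ q ∉ l, z' q = z q) → outL l z' ≡ outL l z + r [MOD 2 ^ l.length] →
        Maps A z z' := by
  obtain ⟨A, hA, h⟩ := exists_add_const (List.nodup_iff_injective_get.1 hl) r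
  rw [qubitsOf_get] at hA
  refine ⟨A, hA.mono (Finset.Subset.refl _) (by omega) (addCost_bound hm), fun z z' hz h' =>
    h z z' (fun q hq => hz q ?_) h'⟩
  rwa [qubitsOf_get, List.mem_toFinset] at hq

theorem exists_add_ctrl_list {l : List Q} (hl : l.Nodup) (r : ℕ) {c : Q} (hc : c ∉ l) {m : ℕ}
    (hm : l.length ≤ m + 1) :
    ∃ A : Op Q, Realizes (insert c l.toFinset) (9 * (m + 1)) (addCost m) A ∧
      ∀ z z' : Basis Q, (∀ q ∉ l, z' q = z q) →
        outL l z' ≡ outL l z + (r + (z c).val) [MOD 2 ^ l.length] → Maps A z z' := by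
  obtain ⟨A, hA, h⟩ := exists_add_ctrl (List.nodup_iff_injective_get.1 hl) r (c := c)
    (by rwa [qubitsOf_get, List.mem_toFinset])
  rw [qubitsOf_get] at hA
  refine ⟨A, hA.mono (Finset.Subset.refl _) (by omega) (addCost_bound hm), fun z z' hz h' =>
    h z z' (fun q hq => hz q ?_) h'⟩
  rwa [qubitsOf_get, List.mem_toFinset] at hq

/-- The carry of the addition of `r` to a block of qubits is computed into one ancilla. -/
theorem exists_carry {l : List Q} {g : Q} (hl : (l ++ [g]).Nodup) {r : ℕ} (hr : r ≤ 2 ^ l.length)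
    {m : ℕ} (hm : l.length ≤ m) :
    ∃ A : Op Q, Realizes (l ++ [g]).toFinset (18 * (m + 1)) (2 * addCost m) A ∧
      ∀ z : Basis Q, z g = 0 →
        Maps A z (Function.update z g (carryBit (2 ^ l.length) (outL l z + r))) := by
  have hl' := (List.nodup_append.1 hl).1
  have hg : g ∉ l := fun h => (List.nodup_append.1 hl).2.2 g h g (by simp) rfl
  obtain ⟨A, hA, hAm⟩ := exists_add_list hl r (m := m) (by simpa using hm)
  obtain ⟨B, hB, hBm⟩ := exists_add_list hl' r (m := m) (by omega)
  have hB' := hB.mono (T := (l ++ [g]).toFinset) (by intro q; simp; tauto) le_rfl le_rfl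
  -- `A` adds `r` to the register extended by `g` as its top bit, so the carry lands in `g`. The
  -- inverse of `B` then subtracts `r` from `l` alone and restores it.
  refine ⟨Bᴴ * A, (hB'.conjTranspose.mul hA).mono (Finset.Subset.refl _) (by omega) (by omega), ?_⟩
  intro z hzg
  set b : Fin 2 := carryBit (2 ^ l.length) (outL l z + r) with hb
  set z2 := Function.update z g b with hz2
  have hpos : 0 < 2 ^ l.length := by positivity
  obtain ⟨z1, h1, h1'⟩ := exists_outL_eq hl' z2 (v := (outL l z + r) % 2 ^ l.length)
    (Nat.mod_lt _ hpos)
  have hout2 : outL l z2 = outL l z := outL_congr fun q hq => by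
    rw [hz2, Function.update_of_ne]; rintro rfl; exact hg hq
  have hz1g : z1 g = b := by rw [h1 g hg, hz2, Function.update_self]
  have hlt := outL_lt l z
  refine Maps.mul (z' := z1) (Maps.conjTranspose (hBm z2 z1 h1 ?_) hB.conjTranspose_mul_self)
    (hAm z z1 ?_ ?_)
  · rw [h1', hout2]
    exact Nat.mod_modEq _ _
  · intro q hq
    simp only [List.mem_append, List.mem_singleton, not_or] at hq
    rw [h1 q hq.1, hz2, Function.update_of_ne hq.2]
  · rw [outL_append, outL_append, outL_cons, outL_cons, outL_nil, outL_nil, hz1g, hzg, h1']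
    have : (outL l z + r) % 2 ^ l.length + 2 ^ l.length * (b.val + 2 * 0) = outL l z + r := by
      rw [hb]
      rcases Nat.lt_or_ge (outL l z + r) (2 ^ l.length) with h | h
      · rw [carryBit_of_lt h, Nat.mod_eq_of_lt h]; simp
      · rw [carryBit_of_le h, Nat.mod_eq_sub_mod h, Nat.mod_eq_of_lt (by omega)]
        simp only [Fin.val_one]
        omega
    rw [this]
    simp
    rfl

/-- NOT gates on a list of qubits. -/
theorem exists_not_list {l : List Q} (hl : l.Nodup) :
    ∃ A : Op Q, Realizes l.toFinset 9 (9 * l.length) A ∧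
      ∀ z : Basis Q, Maps A z fun q => if q ∈ l then z q + 1 else z q := by
  induction l with
  | nil => exact ⟨1, by simpa using (Realizes.one (∅ : Finset Q)).mono (Finset.Subset.refl _) (Nat.zero_le 9) le_rfl,
      fun z => by simpa using Maps.one z⟩
  | cons q l ih =>
    obtain ⟨hq, hl'⟩ := List.nodup_cons.1 hl
    obtain ⟨A, hA, hAm⟩ := ih hl'
    obtain ⟨N, hN, hNm⟩ := exists_not q
    refine ⟨N * A, ?_, fun z => ?_⟩
    · refine (hN.par hA (by simpa using hq)).mono ?_ le_rfl ?_
      · intro r; simp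
      · rw [List.length_cons]; omega
    · have := (hNm _).mul (hAm z)
      convert this using 1
      funext r
      by_cases h : r = q
      · subst h; simp [hq]
      · simp [h]

/-! ## Carry-lookahead trees -/

/-- A carry-lookahead tree. A leaf is a block of data qubits (least significant first) together with
the number to be added to it, ancillas for the "generate" and "propagate" bits of the block, and an
ancilla for the carry into the block. A node has ancillas for its generate and propagate bits; the
first subtree is the less significant one. -/
inductive CTree (Q : Type) : Type
  | leaf (l : List Q) (r : ℕ) (g p c : Q) : CTree Q
  | node (a b : CTree Q) (g p : Q) : CTree Q

namespace CTree

/-- All data qubits. -/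
def data : CTree Q → List Q
  | leaf l _ _ _ _ => l
  | node a b _ _ => a.data ++ b.data

/-- The number to be added. -/
def addend : CTree Q → ℕ
  | leaf _ r _ _ _ => r
  | node a b _ _ => a.addend + 2 ^ a.data.length * b.addend

/-- The generate bit. -/
def gen : CTree Q → Q
  | leaf _ _ g _ _ => g
  | node _ _ g _ => g

/-- The propagate bit. -/
def prop : CTree Q → Q
  | leaf _ _ _ p _ => p
  | node _ _ _ p => p

/-- The qubit of the carry into the first block. -/
def first : CTree Q → Q
  | leaf _ _ _ _ c => c
  | node a _ _ _ => a.first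

/-- All generate and propagate bits. -/
def gps : CTree Q → Finset Q
  | leaf _ _ g p _ => {g, p}
  | node a b g p => (a.gps ∪ b.gps) ∪ {g, p}

/-- The qubits of the carries into the blocks, except the first one. -/
def carries : CTree Q → Finset Q
  | leaf _ _ _ _ _ => ∅
  | node a b _ _ => insert b.first (a.carries ∪ b.carries)

/-- All qubits. -/
def qs : CTree Q → Finset Q
  | leaf l _ g p c => (l ++ [g, p, c]).toFinset
  | node a b g p => (a.qs ∪ b.qs) ∪ {g, p}

def height : CTree Q → ℕ
  | leaf _ _ _ _ _ => 0
  | node a b _ _ => max a.height b.height + 1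

def nodes : CTree Q → ℕ
  | leaf _ _ _ _ _ => 0
  | node a b _ _ => a.nodes + b.nodes + 1

def leaves : CTree Q → ℕ
  | leaf _ _ _ _ _ => 1
  | node a b _ _ => a.leaves + b.leaves

/-- All qubits of the tree are distinct, and the blocks have at most `m` qubits. -/
def WF (m : ℕ) : CTree Q → Prop
  | leaf l r g p c => (l ++ [g, p, c]).Nodup ∧ r < 2 ^ l.length ∧ l.length ≤ m
  | node a b g p => a.WF m ∧ b.WF m ∧ Disjoint a.qs b.qs ∧ g ≠ p ∧ g ∉ a.qs ∧ g ∉ b.qs ∧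
      p ∉ a.qs ∧ p ∉ b.qs

/-- The carry out of the tree when the carry into it is `c`. -/
def carry : CTree Q → Basis Q → Fin 2 → Fin 2
  | leaf l r _ _ _, z, c => carryBit (2 ^ l.length) (outL l z + r + c.val)
  | node a b _ _, z, c => b.carry z (a.carry z c)

/-- The generate and propagate bits are correct. -/
def GPok : CTree Q → Basis Q → Prop
  | leaf l r g p c, z => z g = carry (leaf l r g p c) z 0 ∧
      z p = carry (leaf l r g p c) z 0 + carry (leaf l r g p c) z 1
  | node a b g p, z => a.GPok z ∧ b.GPok z ∧ z g = carry (node a b g p) z 0 ∧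
      z p = carry (node a b g p) z 0 + carry (node a b g p) z 1

/-- The carries into the blocks are correct, relative to the carry into the first block. -/
def Cok : CTree Q → Basis Q → Prop
  | leaf _ _ _ _ _, _ => True
  | node a b _ _, z => a.Cok z ∧ b.Cok z ∧ z b.first = a.carry z (z a.first)

/-- On every block, `z'` is the sum of `z`, of the addend, and of the carry bit in `z`. -/
def Added : CTree Q → Basis Q → Basis Q → Prop
  | leaf l r _ _ c, z, z' => outL l z' = (outL l z + (r + (z c).val)) % 2 ^ l.length
  | node a b _ _, z, z' => a.Added z z' ∧ b.Added z z'

theorem data_subset (t : CTree Q) : t.data.toFinset ⊆ t.qs := by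
  induction t with
  | leaf l r g p c => intro q; simp [data, qs]; tauto
  | node a b g p iha ihb =>
    intro q hq
    simp only [data, List.toFinset_append, Finset.mem_union] at hq
    simp only [qs, Finset.mem_union]
    rcases hq with h | h
    exacts [Or.inl (Or.inl (iha h)), Or.inl (Or.inr (ihb h))]

theorem mem_qs_of_mem_data {t : CTree Q} {q : Q} (h : q ∈ t.data) : q ∈ t.qs :=
  t.data_subset (List.mem_toFinset.2 h)

theorem gps_subset (t : CTree Q) : t.gps ⊆ t.qs := by
  induction t with
  | leaf l r g p c => intro q; simp [gps, qs]; tauto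
  | node a b g p iha ihb => exact Finset.union_subset_union (Finset.union_subset_union iha ihb) (Finset.Subset.refl _)

theorem gen_mem (t : CTree Q) : t.gen ∈ t.gps := by cases t <;> simp [gen, gps]

theorem prop_mem (t : CTree Q) : t.prop ∈ t.gps := by cases t <;> simp [prop, gps]

theorem first_mem (t : CTree Q) : t.first ∈ t.qs := by
  induction t with
  | leaf l r g p c => simp [first, qs]
  | node a b g p iha ihb => simp [first, qs, iha]

theorem carries_subset (t : CTree Q) : t.carries ⊆ t.qs := by
  induction t with
  | leaf l r g p c => simp [carries]
  | node a b g p iha ihb =>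
    intro q hq
    simp only [carries, Finset.mem_insert, Finset.mem_union] at hq
    simp only [qs, Finset.mem_union]
    rcases hq with rfl | h | h
    exacts [Or.inl (Or.inr b.first_mem), Or.inl (Or.inl (iha h)), Or.inl (Or.inr (ihb h))]

section

variable {m : ℕ} {a b : CTree Q} {g p : Q}

theorem WF.notMem_right (h : (node a b g p).WF m) {q : Q} (hq : q ∈ a.qs) : q ∉ b.qs :=
  Finset.disjoint_left.1 h.2.2.1 hq

theorem WF.notMem_left (h : (node a b g p).WF m) {q : Q} (hq : q ∈ b.qs) : q ∉ a.qs :=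
  Finset.disjoint_right.1 h.2.2.1 hq

theorem WF.ne_gen (h : (node a b g p).WF m) {q : Q} (hq : q ∈ a.qs ∨ q ∈ b.qs) : q ≠ g := by
  rintro rfl; rcases hq with hq | hq
  exacts [h.2.2.2.2.1 hq, h.2.2.2.2.2.1 hq]

theorem WF.ne_prop (h : (node a b g p).WF m) {q : Q} (hq : q ∈ a.qs ∨ q ∈ b.qs) : q ≠ p := by
  rintro rfl; rcases hq with hq | hq
  exacts [h.2.2.2.2.2.2.1 hq, h.2.2.2.2.2.2.2 hq]

end

/-- The four kinds of qubits are disjoint. -/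
theorem WF.kinds {m : ℕ} {t : CTree Q} (h : t.WF m) :
    t.data.Nodup ∧ (∀ q ∈ t.data, q ∉ t.gps ∧ q ∉ t.carries ∧ q ≠ t.first) ∧
    (∀ q ∈ t.gps, q ∉ t.carries ∧ q ≠ t.first) ∧ t.first ∉ t.carries := by
  induction t with
  | leaf l r g p c =>
    obtain ⟨h, _, _⟩ := h
    simp only [List.nodup_append, List.mem_cons, List.not_mem_nil, or_false, List.nodup_cons, not_or,
      List.nodup_nil, and_true, not_false_eq_true] at h
    refine ⟨h.1, fun q hq => ⟨?_, by simp [carries], ?_⟩, fun q hq => ⟨by simp [carries], ?_⟩,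
      by simp [carries]⟩
    · simp only [gps, Finset.mem_insert, Finset.mem_singleton, not_or]
      exact ⟨h.2.2 q hq g (by simp), h.2.2 q hq p (by simp)⟩
    · exact h.2.2 q hq c (by simp)
    · simp only [gps, Finset.mem_insert, Finset.mem_singleton] at hq
      simp only [first]
      rcases hq with rfl | rfl
      exacts [h.2.1.1.2, h.2.1.2]
  | node a b g p iha ihb =>
    have ha := iha h.1
    have hb := ihb h.2.1
    have hfa := a.first_mem
    have hfb := b.first_mem
    refine ⟨List.nodup_append.2 ⟨ha.1, hb.1, fun q hq q' hq' hqq => ?_⟩, ?_, ?_, ?_⟩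
    · subst hqq
      exact h.notMem_right (mem_qs_of_mem_data hq) (mem_qs_of_mem_data hq')
    · intro q hq
      simp only [data, List.mem_append] at hq
      simp only [gps, carries, first, Finset.mem_union, Finset.mem_insert, Finset.mem_singleton, not_or]
      rcases hq with hq | hq
      · have hqa := mem_qs_of_mem_data hq
        have hqb := h.notMem_right hqa
        exact ⟨⟨⟨(ha.2.1 q hq).1, fun h' => hqb (b.gps_subset h')⟩, h.ne_gen (Or.inl hqa),
          h.ne_prop (Or.inl hqa)⟩, ⟨fun h' => hqb (h' ▸ hfb), (ha.2.1 q hq).2.1,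
            fun h' => hqb (b.carries_subset h')⟩, (ha.2.1 q hq).2.2⟩
      · have hqb := mem_qs_of_mem_data hq
        have hqa := h.notMem_left hqb
        exact ⟨⟨⟨fun h' => hqa (a.gps_subset h'), (hb.2.1 q hq).1⟩, h.ne_gen (Or.inr hqb),
          h.ne_prop (Or.inr hqb)⟩, ⟨(hb.2.1 q hq).2.2, fun h' => hqa (a.carries_subset h'),
            (hb.2.1 q hq).2.1⟩, fun h' => hqa (h' ▸ hfa)⟩
    · intro q hq
      simp only [gps, Finset.mem_union, Finset.mem_insert, Finset.mem_singleton] at hq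
      simp only [carries, first, Finset.mem_union, Finset.mem_insert, not_or]
      rcases hq with (hq | hq) | hq
      · have hqa := a.gps_subset hq
        have hqb := h.notMem_right hqa
        exact ⟨⟨fun h' => hqb (h' ▸ hfb), (ha.2.2.1 q hq).1, fun h' => hqb (b.carries_subset h')⟩,
          (ha.2.2.1 q hq).2⟩
      · have hqb := b.gps_subset hq
        have hqa := h.notMem_left hqb
        exact ⟨⟨(hb.2.2.1 q hq).2, fun h' => hqa (a.carries_subset h'), (hb.2.2.1 q hq).1⟩,
          fun h' => hqa (h' ▸ hfa)⟩
      · have hqa : q ∉ a.qs := by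
          rcases hq with rfl | rfl
          exacts [h.2.2.2.2.1, h.2.2.2.2.2.2.1]
        have hqb : q ∉ b.qs := by
          rcases hq with rfl | rfl
          exacts [h.2.2.2.2.2.1, h.2.2.2.2.2.2.2]
        exact ⟨⟨fun h' => hqb (h' ▸ hfb), fun h' => hqa (a.carries_subset h'),
          fun h' => hqb (b.carries_subset h')⟩, fun h' => hqa (h' ▸ hfa)⟩
    · simp only [carries, first, Finset.mem_insert, Finset.mem_union, not_or]
      have hqb := h.notMem_right hfa
      exact ⟨fun h' => hqb (h' ▸ hfb), ha.2.2.2, fun h' => hqb (b.carries_subset h')⟩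

theorem carry_congr {t : CTree Q} {z z' : Basis Q} (h : ∀ q ∈ t.data, z q = z' q) (c : Fin 2) :
    t.carry z c = t.carry z' c := by
  induction t generalizing c with
  | leaf l r g p _ =>
    simp only [data] at h
    simp only [carry, outL_congr h]
  | node a b g p iha ihb =>
    simp only [data, List.mem_append] at h
    simp only [carry]
    rw [iha fun q hq => h q (Or.inl hq), ihb fun q hq => h q (Or.inr hq)]

/-- Every function of one bit is affine over the field with two elements. The generate and propagate
bits are its two coefficients, so they determine the carry out for either carry in. -/
theorem carry_eq (t : CTree Q) (z : Basis Q) (c : Fin 2) :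
    t.carry z c = t.carry z 0 + (t.carry z 0 + t.carry z 1) * c := by
  generalize t.carry z = f
  fin_cases c
  · simp
  · simp only [Fin.mk_one, mul_one]
    generalize f 0 = i
    generalize f 1 = j
    fin_cases i <;> fin_cases j <;> rfl

theorem GPok.gen_eq {t : CTree Q} {z : Basis Q} (h : t.GPok z) : z t.gen = t.carry z 0 := by
  cases t
  exacts [h.1, h.2.2.1]

theorem GPok.prop_eq {t : CTree Q} {z : Basis Q} (h : t.GPok z) :
    z t.prop = t.carry z 0 + t.carry z 1 := by
  cases t
  exacts [h.2, h.2.2.2]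

theorem GPok.congr {t : CTree Q} {z z' : Basis Q} (h : t.GPok z) (hd : ∀ q ∈ t.data, z q = z' q)
    (hg : ∀ q ∈ t.gps, z q = z' q) : t.GPok z' := by
  induction t with
  | leaf l r g p c =>
    refine ⟨?_, ?_⟩
    · rw [← hg g (by simp [gps]), h.1, carry_congr hd]
    · rw [← hg p (by simp [gps]), h.2, carry_congr hd, carry_congr hd]
  | node a b g p iha ihb =>
    refine ⟨iha h.1 (fun q hq => hd q (by simp [data, hq])) (fun q hq => hg q (by simp [gps, hq])),
      ihb h.2.1 (fun q hq => hd q (by simp [data, hq])) (fun q hq => hg q (by simp [gps, hq])), ?_, ?_⟩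
    · rw [← hg g (by simp [gps]), h.2.2.1, carry_congr hd]
    · rw [← hg p (by simp [gps]), h.2.2.2, carry_congr hd, carry_congr hd]

/-- Correct generate and propagate bits are determined by the data. Hence recomputing them from zero
reproduces the bits already present, and the inverse circuit erases them. -/
theorem GPok.eq_on {t : CTree Q} {z z' : Basis Q} (h : t.GPok z) (h' : t.GPok z')
    (hd : ∀ q ∈ t.data, z q = z' q) : ∀ q ∈ t.gps, z q = z' q := by
  induction t with
  | leaf l r g p c =>
    intro q hq
    simp only [gps, Finset.mem_insert, Finset.mem_singleton] at hq
    rcases hq with rfl | rfl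
    · rw [h.1, h'.1, carry_congr hd]
    · rw [h.2, h'.2, carry_congr hd, carry_congr hd]
  | node a b g p iha ihb =>
    intro q hq
    simp only [gps, Finset.mem_union, Finset.mem_insert, Finset.mem_singleton] at hq
    rcases hq with (hq | hq) | rfl | rfl
    · exact iha h.1 h'.1 (fun q hq => hd q (by simp [data, hq])) q hq
    · exact ihb h.2.1 h'.2.1 (fun q hq => hd q (by simp [data, hq])) q hq
    · rw [h.2.2.1, h'.2.2.1, carry_congr hd]
    · rw [h.2.2.2, h'.2.2.2, carry_congr hd, carry_congr hd]

theorem Cok.congr {t : CTree Q} {z z' : Basis Q} (h : t.Cok z) (hd : ∀ q ∈ t.data, z q = z' q)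
    (hc : ∀ q ∈ t.carries, z q = z' q) (hf : z t.first = z' t.first) : t.Cok z' := by
  induction t with
  | leaf l r g p c => trivial
  | node a b g p iha ihb =>
    have hbf : z b.first = z' b.first := hc _ (by simp [carries])
    refine ⟨iha h.1 (fun q hq => hd q (by simp [data, hq])) (fun q hq => hc q (by simp [carries, hq]))
      hf, ihb h.2.1 (fun q hq => hd q (by simp [data, hq]))
        (fun q hq => hc q (by simp [carries, hq])) hbf, ?_⟩
    rw [← hbf, h.2.2, carry_congr fun q hq => hd q (by simp [data, hq])]
    exact congrArg _ hf

/-- The analogue of `GPok.eq_on` for the carries, which are determined by the data and the carry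
into the first block. -/
theorem Cok.eq_on {t : CTree Q} {z z' : Basis Q} (h : t.Cok z) (h' : t.Cok z')
    (hd : ∀ q ∈ t.data, z q = z' q) (hf : z t.first = z' t.first) : ∀ q ∈ t.carries, z q = z' q := by
  induction t with
  | leaf l r g p c => simp [carries]
  | node a b g p iha ihb =>
    have hbf : z b.first = z' b.first := by
      rw [h.2.2, h'.2.2, carry_congr fun q hq => hd q (by simp [data, hq])]
      exact congrArg _ hf
    intro q hq
    simp only [carries, Finset.mem_union, Finset.mem_insert] at hq
    rcases hq with rfl | hq | hq
    · exact hbf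
    · exact iha h.1 h'.1 (fun q hq => hd q (by simp [data, hq])) hf q hq
    · exact ihb h.2.1 h'.2.1 (fun q hq => hd q (by simp [data, hq])) hbf q hq

theorem Added.congr {t : CTree Q} {z z' w w' : Basis Q} (h : t.Added z w) (hz : ∀ q ∈ t.qs, z q = z' q)
    (hw : ∀ q ∈ t.data, w q = w' q) : t.Added z' w' := by
  induction t with
  | leaf l r g p c =>
    simp only [data] at hw
    unfold Added at *
    rw [← outL_congr hw, h, outL_congr (l := l) fun q hq => hz q (mem_qs_of_mem_data hq),
      hz c (by simp [qs])]
  | node a b g p iha ihb =>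
    exact ⟨iha h.1 (fun q hq => hz q (by simp [qs, hq])) (fun q hq => hw q (by simp [data, hq])),
      ihb h.2 (fun q hq => hz q (by simp [qs, hq])) (fun q hq => hw q (by simp [data, hq]))⟩

/-- The sums on the blocks fit together. -/
theorem Added.outL_eq {t : CTree Q} {m : ℕ} (ht : t.WF m) {z z' : Basis Q} (h : t.Added z z')
    (hc : t.Cok z) : outL t.data z' + 2 ^ t.data.length * (t.carry z (z t.first)).val =
      outL t.data z + t.addend + (z t.first).val := by
  induction t with
  | leaf l r g p c =>
    simp only [Added] at h
    simp only [data, carry, addend, first]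
    rw [h]
    have hlt := outL_lt l z
    have hr := ht.2.1
    have hc2 := (z c).is_lt
    rcases Nat.lt_or_ge (outL l z + r + (z c).val) (2 ^ l.length) with h' | h'
    · rw [carryBit_of_lt h', Nat.mod_eq_of_lt (by omega)]; simp; omega
    · rw [carryBit_of_le h', Nat.mod_eq_sub_mod (by omega), Nat.mod_eq_of_lt (by omega)]
      simp only [Fin.val_one]
      omega
  | node a b g p iha ihb =>
    have ha := iha ht.1 h.1 hc.1
    have hb := ihb ht.2.1 h.2 hc.2.1
    simp only [data, carry, addend, first]
    rw [← hc.2.2, outL_append, outL_append, List.length_append, pow_add]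
    rw [← hc.2.2] at ha
    calc outL a.data z' + 2 ^ a.data.length * outL b.data z' +
          2 ^ a.data.length * 2 ^ b.data.length * (b.carry z (z b.first)).val
        = outL a.data z' + 2 ^ a.data.length * (outL b.data z' +
          2 ^ b.data.length * (b.carry z (z b.first)).val) := by ring
      _ = (outL a.data z' + 2 ^ a.data.length * (z b.first).val) +
          2 ^ a.data.length * (outL b.data z + b.addend) := by rw [hb]; ring
      _ = _ := by rw [ha]; ring

/-- The carries can be recovered from the complement of the sum. -/
theorem Added.carry_flip {t : CTree Q} {m : ℕ} (ht : t.WF m) {z z' f : Basis Q} (h : t.Added z z')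
    (hc : t.Cok z) (hf : ∀ q ∈ t.data, f q = z' q + 1) :
    t.carry f (z t.first) = t.carry z (z t.first) := by
  induction t with
  | leaf l r g p c =>
    simp only [Added] at h
    simp only [carry, first]
    have hlt := outL_lt l z
    have hr := ht.2.1
    have hc2 := (z c).is_lt
    have hfl := outL_flip_add l z' hf
    rw [h] at hfl
    -- With `N = 2 ^ l.length` and `v` the old value, complement plus addend plus carry is `2 * N -
    -- 1 - v ≥ N` if the addition overflowed and `N - 1 - v < N` if not. So the complement overflows
    -- exactly when the original did.
    by_cases h' : 2 ^ l.length ≤ outL l z + r + (z c).val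
    · rw [Nat.mod_eq_sub_mod (by omega), Nat.mod_eq_of_lt (by omega)] at hfl
      rw [carryBit_of_le h', carryBit_of_le (by omega)]
    · rw [Nat.mod_eq_of_lt (by omega)] at hfl
      rw [carryBit_of_lt (by omega), carryBit_of_lt (by omega)]
  | node a b g p iha ihb =>
    have ha := iha ht.1 h.1 hc.1 fun q hq => hf q (by simp [data, hq])
    have hb := ihb ht.2.1 h.2 hc.2.1 fun q hq => hf q (by simp [data, hq])
    simp only [carry, first]
    rw [ha, ← hc.2.2, hb]

/-- The carries computed from the old data remain correct once the data hold the complement of the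
sum. The inverse of the carry circuit can therefore erase them there. -/
theorem Added.cok_flip {t : CTree Q} {m : ℕ} (ht : t.WF m) {z z' f : Basis Q} (h : t.Added z z')
    (hc : t.Cok z) (hf : ∀ q ∈ t.data, f q = z' q + 1) (hf' : ∀ q ∈ t.carries, f q = z q)
    (hf'' : f t.first = z t.first) : t.Cok f := by
  induction t with
  | leaf l r g p c => trivial
  | node a b g p iha ihb =>
    have hbf : f b.first = z b.first := hf' _ (by simp [carries])
    refine ⟨iha ht.1 h.1 hc.1 (fun q hq => hf q (by simp [data, hq]))
      (fun q hq => hf' q (by simp [carries, hq])) hf'',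
      ihb ht.2.1 h.2 hc.2.1 (fun q hq => hf q (by simp [data, hq]))
      (fun q hq => hf' q (by simp [carries, hq])) hbf, ?_⟩
    have : f a.first = z a.first := hf''
    rw [hbf, this, hc.2.2, h.1.carry_flip ht.1 hc.1 fun q hq => hf q (by simp [data, hq])]

end CTree

end

/-! ### Circuits on a carry-lookahead tree. -/

section

variable {Q : Type} [Fintype Q] [DecidableEq Q]

namespace CTree

/-- The generate and propagate bits are computed in logarithmic depth. -/
theorem exists_up {m : ℕ} (t : CTree Q) (ht : t.WF m) :
    ∃ U : Op Q, Realizes t.qs (45 * (m + 1) + 67 * t.height)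
      (t.leaves * (4 * addCost m + 9) + 67 * t.nodes) U ∧
      ∀ z : Basis Q, (∀ q ∈ t.gps, z q = 0) →
        ∃ z', Maps U z z' ∧ (∀ q ∉ t.gps, z' q = z q) ∧ t.GPok z' := by
  induction t with
  | leaf l r g p c =>
    obtain ⟨hnd, hr, hl⟩ := ht
    have hnd' := hnd
    simp only [List.nodup_append, List.mem_cons, List.not_mem_nil, or_false, List.nodup_cons, not_or,
      List.nodup_nil, and_true, not_false_eq_true] at hnd'
    obtain ⟨h1, ⟨⟨hgp, hgc⟩, hpc⟩, h2⟩ := hnd'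
    have hgl : g ∉ l := fun h => h2 g h g (Or.inl rfl) rfl
    have hpl : p ∉ l := fun h => h2 p h p (Or.inr (Or.inl rfl)) rfl
    obtain ⟨A, hA, hAm⟩ := exists_carry (l := l) (g := g) (List.nodup_append.2
      ⟨h1, by simp, fun q hq q' hq' => by
        rw [List.mem_singleton] at hq'; subst hq'; exact fun h => hgl (h ▸ hq)⟩) hr.le hl
    -- The carry out for carry in `1` is the carry of adding `r + 1`, which may equal `2 ^
    -- l.length`; for this reason `exists_carry` allows equality.
    obtain ⟨B, hB, hBm⟩ := exists_carry (l := l) (g := p) (List.nodup_append.2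
      ⟨h1, by simp, fun q hq q' hq' => by
        rw [List.mem_singleton] at hq'; subst hq'; exact fun h => hpl (h ▸ hq)⟩) (r := r + 1) hr hl
    -- The CNOT turns the carry for carry in `1`, held in `p`, into the propagate bit by adding the
    -- carry for carry in `0`.
    obtain ⟨C, hC, hCm⟩ := exists_cnot hgp
    have hA' := hA.mono (T := (leaf l r g p c).qs) (by intro q; simp [qs]; tauto) le_rfl le_rfl
    have hB' := hB.mono (T := (leaf l r g p c).qs) (by intro q; simp [qs]; tauto) le_rfl le_rfl
    have hC' := hC.mono (T := (leaf l r g p c).qs) (by intro q; simp [qs]; tauto) le_rfl le_rfl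
    refine ⟨C * (B * A), (hC'.mul (hB'.mul hA')).mono (Finset.Subset.refl _) (by simp only [height]; omega)
      (by simp only [leaves, nodes]; omega), fun z hz => ?_⟩
    have hzg := hz g (by simp [gps])
    have hzp := hz p (by simp [gps])
    have e1 := hAm z hzg
    set z1 := Function.update z g (carryBit (2 ^ l.length) (outL l z + r)) with hz1
    have e2 := hBm z1 (by rw [hz1, Function.update_of_ne (Ne.symm hgp), hzp])
    have ho1 : outL l z1 = outL l z := outL_congr fun q hq => by
      rw [hz1, Function.update_of_ne]; rintro rfl; exact hgl hq
    rw [ho1] at e2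
    set z2 := Function.update z1 p (carryBit (2 ^ l.length) (outL l z + (r + 1))) with hz2
    have e3 := hCm z2
    set z3 := Function.update z2 p (z2 p + z2 g) with hz3
    have hoff : ∀ q, q ≠ g → q ≠ p → z3 q = z q := by
      intro q hq hq'
      rw [hz3, Function.update_of_ne hq', hz2, Function.update_of_ne hq', hz1, Function.update_of_ne hq]
    have hg3 : z3 g = carryBit (2 ^ l.length) (outL l z + r) := by
      rw [hz3, Function.update_of_ne hgp, hz2, Function.update_of_ne hgp, hz1, Function.update_self]
    have hp3 : z3 p = carryBit (2 ^ l.length) (outL l z + (r + 1)) +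
        carryBit (2 ^ l.length) (outL l z + r) := by
      rw [hz3, Function.update_self, hz2, Function.update_self, Function.update_of_ne hgp, hz1,
        Function.update_self]
    have ho3 : outL l z3 = outL l z := outL_congr fun q hq =>
      hoff q (fun h => hgl (h ▸ hq)) (fun h => hpl (h ▸ hq))
    refine ⟨z3, e3.mul (e2.mul e1), fun q hq => ?_, ?_, ?_⟩
    · simp only [gps, Finset.mem_insert, Finset.mem_singleton, not_or] at hq
      exact hoff q hq.1 hq.2
    · simp only [carry, ho3, hg3, Fin.val_zero, add_zero]
    · simp only [carry, ho3, hp3, Fin.val_zero, add_zero, Fin.val_one]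
      rw [add_comm, add_assoc]
  | node a b g p iha ihb =>
    obtain ⟨A, hA, hAm⟩ := iha ht.1
    obtain ⟨B, hB, hBm⟩ := ihb ht.2.1
    have hag := a.gps_subset a.gen_mem
    have hap := a.gps_subset a.prop_mem
    have hbg := b.gps_subset b.gen_mem
    have hbp := b.gps_subset b.prop_mem
    have hgp := ht.2.2.2.1
    -- Composition of affine maps: the generate bit of the node is `gen b + prop b * gen a` and its
    -- propagate bit is `prop a * prop b`. One CNOT and two Toffolis add at most `67 = 9 + 29 + 29`
    -- to the depth.
    obtain ⟨C, hC, hCm⟩ := exists_cnot (ht.ne_gen (Or.inr hbg))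
    obtain ⟨T, hT, hTm⟩ := exists_toffoli (a := b.prop) (b := a.gen) (t := g)
      (fun h => ht.notMem_right hag (h ▸ hbp)) (ht.ne_gen (Or.inr hbp)) (ht.ne_gen (Or.inl hag))
    obtain ⟨S, hS, hSm⟩ := exists_toffoli (a := a.prop) (b := b.prop) (t := p)
      (fun h => ht.notMem_right hap (h ▸ hbp)) (ht.ne_prop (Or.inl hap)) (ht.ne_prop (Or.inr hbp))
    have hC' := hC.mono (T := (node a b g p).qs) (by
      intro q; simp only [Finset.mem_insert, Finset.mem_singleton, qs, Finset.mem_union]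
      rintro (rfl | rfl) <;> tauto) le_rfl le_rfl
    have hT' := hT.mono (T := (node a b g p).qs) (by
      intro q; simp only [Finset.mem_insert, Finset.mem_singleton, qs, Finset.mem_union]
      rintro (rfl | rfl | rfl) <;> tauto) le_rfl le_rfl
    have hS' := hS.mono (T := (node a b g p).qs) (by
      intro q; simp only [Finset.mem_insert, Finset.mem_singleton, qs, Finset.mem_union]
      rintro (rfl | rfl | rfl) <;> tauto) le_rfl le_rfl
    have hAB := ((hA.mono (Finset.Subset.refl _) (d' := 45 * (m + 1) + 67 * max a.height b.height)
      (by have := le_max_left a.height b.height; omega) le_rfl).par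
      (hB.mono (Finset.Subset.refl _) (d' := 45 * (m + 1) + 67 * max a.height b.height)
      (by have := le_max_right a.height b.height; omega) le_rfl) ht.2.2.1).mono
      (T := (node a b g p).qs) Finset.subset_union_left le_rfl le_rfl
    refine ⟨S * (T * (C * (A * B))), (hS'.mul (hT'.mul (hC'.mul hAB))).mono (Finset.Subset.refl _)
      (by simp only [height]; omega) (by simp only [leaves, nodes]; ring_nf; omega), fun z hz => ?_⟩
    obtain ⟨z1, m1, o1, k1⟩ := hBm z fun q hq => hz q (by simp [gps, hq])
    obtain ⟨z2, m2, o2, k2⟩ := hAm z1 fun q hq => by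
      rw [o1 q fun h => ht.notMem_right (a.gps_subset hq) (b.gps_subset h)]
      exact hz q (by simp [gps, hq])
    have hb2 : ∀ q ∈ b.qs, z1 q = z2 q := fun q hq =>
      (o2 q fun h => ht.notMem_left hq (a.gps_subset h)).symm
    have k1' : b.GPok z2 := k1.congr (fun q hq => hb2 q (mem_qs_of_mem_data hq))
      fun q hq => hb2 q (b.gps_subset hq)
    have m3 := hCm z2
    set z3 := Function.update z2 g (z2 g + z2 b.gen) with hz3
    have m4 := hTm z3
    set z4 := Function.update z3 g (z3 g + z3 b.prop * z3 a.gen) with hz4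
    have m5 := hSm z4
    set z5 := Function.update z4 p (z4 p + z4 a.prop * z4 b.prop) with hz5
    have hoff : ∀ q, q ≠ g → q ≠ p → z5 q = z2 q := by
      intro q hq hq'
      rw [hz5, Function.update_of_ne hq', hz4, Function.update_of_ne hq, hz3, Function.update_of_ne hq]
    have hoffa : ∀ q ∈ a.qs, z2 q = z5 q := fun q hq =>
      (hoff q (ht.ne_gen (Or.inl hq)) (ht.ne_prop (Or.inl hq))).symm
    have hoffb : ∀ q ∈ b.qs, z2 q = z5 q := fun q hq =>
      (hoff q (ht.ne_gen (Or.inr hq)) (ht.ne_prop (Or.inr hq))).symm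
    have ka : a.GPok z5 := k2.congr (fun q hq => hoffa q (mem_qs_of_mem_data hq))
      fun q hq => hoffa q (a.gps_subset hq)
    have kb : b.GPok z5 := k1'.congr (fun q hq => hoffb q (mem_qs_of_mem_data hq))
      fun q hq => hoffb q (b.gps_subset hq)
    have z2gp : ∀ q, q = g ∨ q = p → z2 q = 0 := by
      intro q hq
      have hqa : q ∉ a.qs := by rcases hq with rfl | rfl; exacts [ht.2.2.2.2.1, ht.2.2.2.2.2.2.1]
      have hqb : q ∉ b.qs := by rcases hq with rfl | rfl; exacts [ht.2.2.2.2.2.1, ht.2.2.2.2.2.2.2]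
      rw [o2 q fun h => hqa (a.gps_subset h), o1 q fun h => hqb (b.gps_subset h)]
      exact hz q (by simp only [gps, Finset.mem_union, Finset.mem_insert, Finset.mem_singleton]; tauto)
    have hg5 : z5 g = z5 b.gen + z5 b.prop * z5 a.gen := by
      rw [← hoffb _ hbg, ← hoffb _ hbp, ← hoffa _ hag, hz5, Function.update_of_ne hgp, hz4,
        Function.update_self, hz3, Function.update_self, Function.update_of_ne (ht.ne_gen (Or.inr hbp)),
        Function.update_of_ne (ht.ne_gen (Or.inl hag)), z2gp g (Or.inl rfl), zero_add]
    have hp5 : z5 p = z5 a.prop * z5 b.prop := by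
      rw [← hoffb _ hbp, ← hoffa _ hap, hz5, Function.update_self, hz4,
        Function.update_of_ne (Ne.symm hgp), Function.update_of_ne (ht.ne_gen (Or.inr hbp)),
        Function.update_of_ne (ht.ne_gen (Or.inl hap)), hz3,
        Function.update_of_ne (Ne.symm hgp), Function.update_of_ne (ht.ne_gen (Or.inr hbp)),
        Function.update_of_ne (ht.ne_gen (Or.inl hap)), z2gp p (Or.inr rfl), zero_add]
    refine ⟨z5, m5.mul (m4.mul (m3.mul (m2.mul m1))), fun q hq => ?_, ka, kb, ?_, ?_⟩
    · simp only [gps, Finset.mem_union, Finset.mem_insert, Finset.mem_singleton, not_or] at hq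
      rw [hoff q hq.2.1 hq.2.2, o2 q hq.1.1, o1 q hq.1.2]
    · simp only [carry]
      rw [hg5, kb.gen_eq, kb.prop_eq, ka.gen_eq, b.carry_eq z5 (a.carry z5 0)]
    · simp only [carry]
      rw [hp5, kb.prop_eq, ka.prop_eq, b.carry_eq z5 (a.carry z5 0), b.carry_eq z5 (a.carry z5 1)]
      generalize a.carry z5 0 = i
      generalize a.carry z5 1 = j
      generalize b.carry z5 0 = k
      generalize b.carry z5 1 = l
      fin_cases i <;> fin_cases j <;> fin_cases k <;> fin_cases l <;> rfl

/-- From correct generate and propagate bits the carries are computed in logarithmic depth. -/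
theorem exists_down {m : ℕ} (t : CTree Q) (ht : t.WF m) :
    ∃ V : Op Q, Realizes t.qs (38 * t.height) (38 * t.nodes) V ∧
      ∀ z : Basis Q, t.GPok z → (∀ q ∈ t.carries, z q = 0) →
        ∃ z', Maps V z z' ∧ (∀ q ∉ t.carries, z' q = z q) ∧ t.Cok z' := by
  induction t with
  | leaf l r g p c =>
    exact ⟨1, (Realizes.one _).mono (Finset.Subset.refl _) (Nat.zero_le _) (Nat.zero_le _),
      fun z _ _ => ⟨z, Maps.one z, fun _ _ => rfl, trivial⟩⟩
  | node a b g p iha ihb =>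
    obtain ⟨A, hA, hAm⟩ := iha ht.1
    obtain ⟨B, hB, hBm⟩ := ihb ht.2.1
    have hag := a.gps_subset a.gen_mem
    have hap := a.gps_subset a.prop_mem
    have haf := a.first_mem
    have hbf := b.first_mem
    have ka := ht.1.kinds
    have kb := ht.2.1.kinds
    have hne : ∀ q ∈ a.qs, q ≠ b.first := fun q hq h => ht.notMem_right hq (h ▸ hbf)
    -- The carry into `b` is `gen a + prop a * c`, where `c` is the carry into `a`: a CNOT and a
    -- Toffoli, of joint cost `38`.
    obtain ⟨C, hC, hCm⟩ := exists_cnot (hne _ hag)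
    obtain ⟨T, hT, hTm⟩ := exists_toffoli (a := a.prop) (b := a.first) (t := b.first)
      (ka.2.2.1 _ a.prop_mem).2 (hne _ hap) (hne _ haf)
    have hC' := hC.mono (T := (node a b g p).qs) (by
      intro q; simp only [Finset.mem_insert, Finset.mem_singleton, qs, Finset.mem_union]
      rintro (rfl | rfl) <;> tauto) le_rfl le_rfl
    have hT' := hT.mono (T := (node a b g p).qs) (by
      intro q; simp only [Finset.mem_insert, Finset.mem_singleton, qs, Finset.mem_union]
      rintro (rfl | rfl | rfl) <;> tauto) le_rfl le_rfl
    have hAB := ((hA.mono (Finset.Subset.refl _) (d' := 38 * max a.height b.height)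
      (by have := le_max_left a.height b.height; omega) le_rfl).par
      (hB.mono (Finset.Subset.refl _) (d' := 38 * max a.height b.height)
      (by have := le_max_right a.height b.height; omega) le_rfl) ht.2.2.1).mono
      (T := (node a b g p).qs) Finset.subset_union_left le_rfl le_rfl
    refine ⟨A * B * (T * C), (hAB.mul (hT'.mul hC')).mono (Finset.Subset.refl _)
      (by simp only [height]; omega) (by simp only [nodes]; omega), fun z hz hz0 => ?_⟩
    have m1 := hCm z
    set z1 := Function.update z b.first (z b.first + z a.gen) with hz1
    have m2 := hTm z1
    set z2 := Function.update z1 b.first (z1 b.first + z1 a.prop * z1 a.first) with hz2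
    have hoff : ∀ q, q ≠ b.first → z2 q = z q := by
      intro q hq
      rw [hz2, Function.update_of_ne hq, hz1, Function.update_of_ne hq]
    have hoffa : ∀ q ∈ a.qs, z q = z2 q := fun q hq => (hoff q (hne q hq)).symm
    have hf2 : z2 b.first = a.carry z2 (z2 a.first) := by
      rw [a.carry_eq, ← carry_congr (z := z) (z' := z2) fun q hq => hoffa q (mem_qs_of_mem_data hq),
        ← carry_congr (z := z) (z' := z2) fun q hq => hoffa q (mem_qs_of_mem_data hq), ← hoffa _ haf,
        ← hz.1.prop_eq, ← hz.1.gen_eq, hz2, Function.update_self, hz1, Function.update_self,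
        Function.update_of_ne (hne _ hap), Function.update_of_ne (hne _ haf), hz0 b.first (by simp [carries]),
        zero_add]
    obtain ⟨z3, m3, o3, k3⟩ := hBm z2
      (hz.2.1.congr (fun q hq => (hoff q (kb.2.1 q hq).2.2).symm)
        fun q hq => (hoff q (kb.2.2.1 q hq).2).symm) fun q hq => by
          rw [hoff q (fun h => kb.2.2.2 (h ▸ hq))]
          exact hz0 q (by simp [carries, hq])
    have ha3 : ∀ q ∈ a.qs, z2 q = z3 q := fun q hq =>
      (o3 q fun h => ht.notMem_right hq (b.carries_subset h)).symm
    obtain ⟨z4, m4, o4, k4⟩ := hAm z3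
      (hz.1.congr (fun q hq => (hoffa q (mem_qs_of_mem_data hq)).trans (ha3 q (mem_qs_of_mem_data hq)))
        fun q hq => (hoffa q (a.gps_subset hq)).trans (ha3 q (a.gps_subset hq))) fun q hq => by
          rw [← ha3 q (a.carries_subset hq), ← hoffa q (a.carries_subset hq)]
          exact hz0 q (by simp [carries, hq])
    have hb4 : ∀ q ∈ b.qs, z3 q = z4 q := fun q hq =>
      (o4 q fun h => ht.notMem_left hq (a.carries_subset h)).symm
    refine ⟨z4, (m4.mul m3).mul (m2.mul m1), fun q hq => ?_, k4, ?_, ?_⟩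
    · simp only [carries, Finset.mem_insert, Finset.mem_union, not_or] at hq
      rw [o4 q hq.2.1, o3 q hq.2.2, hoff q hq.1]
    · exact k3.congr (fun q hq => hb4 q (mem_qs_of_mem_data hq)) (fun q hq => hb4 q (b.carries_subset hq))
        (hb4 _ hbf)
    · rw [← hb4 _ hbf, o3 _ kb.2.2.2, hf2, o4 _ ka.2.2.2, ← ha3 _ haf]
      refine carry_congr (fun q hq => ?_) _
      rw [o4 q (ka.2.1 q hq).2.1, ha3 q (mem_qs_of_mem_data hq)]

/-- The carries are computed in logarithmic depth, with all other ancillas returned to zero. -/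
theorem exists_carries {m : ℕ} (t : CTree Q) (ht : t.WF m) :
    ∃ W : Op Q, Realizes t.qs (90 * (m + 1) + 172 * t.height)
      (2 * (t.leaves * (4 * addCost m + 9)) + 172 * t.nodes) W ∧
      ∀ z : Basis Q, (∀ q ∈ t.gps, z q = 0) → (∀ q ∈ t.carries, z q = 0) →
        ∃ z', Maps W z z' ∧ (∀ q ∉ t.carries, z' q = z q) ∧ t.Cok z' := by
  obtain ⟨U, hU, hUm⟩ := t.exists_up ht
  obtain ⟨V, hV, hVm⟩ := t.exists_down ht
  have hk := ht.kinds
  refine ⟨Uᴴ * (V * U), (hU.conjTranspose.mul (hV.mul hU)).mono (Finset.Subset.refl _) (by omega)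
    (by omega), fun z hg hc => ?_⟩
  obtain ⟨z1, m1, o1, k1⟩ := hUm z hg
  obtain ⟨z2, m2, o2, k2⟩ := hVm z1 k1 fun q hq => by
    rw [o1 q fun h => (hk.2.2.1 q h).1 hq]; exact hc q hq
  -- `z3` is the intended result, with generate and propagate bits erased. Running `U` from `z3`
  -- recreates `z2`, so the inverse of `U` leads from `z2` to `z3`.
  set z3 : Basis Q := fun q => if q ∈ t.gps then 0 else z2 q with hz3
  have h3 : ∀ q ∉ t.gps, z3 q = z2 q := fun q hq => by rw [hz3]; exact if_neg hq
  have h3' : ∀ q ∈ t.gps, z3 q = 0 := fun q hq => by rw [hz3]; exact if_pos hq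
  obtain ⟨z4, m4, o4, k4⟩ := hUm z3 h3'
  have hg2 : t.GPok z2 := k1.congr (fun q hq => (o2 q (hk.2.1 q hq).2.1).symm)
    fun q hq => (o2 q (hk.2.2.1 q hq).1).symm
  have h42 : z4 = z2 := by
    have hd : ∀ q ∈ t.data, z4 q = z2 q := fun q hq => by
      rw [o4 q (hk.2.1 q hq).1, h3 q (hk.2.1 q hq).1]
    funext q
    by_cases hq : q ∈ t.gps
    · exact k4.eq_on hg2 hd q hq
    · rw [o4 q hq, h3 q hq]
  rw [h42] at m4
  refine ⟨z3, (m4.conjTranspose hU.conjTranspose_mul_self).mul (m2.mul m1), fun q hq => ?_, ?_⟩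
  · by_cases hq' : q ∈ t.gps
    · rw [h3' q hq', hg q hq']
    · rw [h3 q hq', o2 q hq, o1 q hq']
  · exact k2.congr (fun q hq => (h3 q (hk.2.1 q hq).1).symm)
      (fun q hq => (h3 q fun h => (hk.2.2.1 q h).1 hq).symm)
      (h3 _ fun h => (hk.2.2.1 _ h).2 rfl).symm

/-- All blocks are incremented in parallel, controlled by the carries into them. -/
theorem exists_block_add {m : ℕ} (t : CTree Q) (ht : t.WF m) :
    ∃ A : Op Q, Realizes t.qs (9 * (m + 1)) (t.leaves * addCost m) A ∧
      ∀ z : Basis Q, ∃ z', Maps A z z' ∧ (∀ q ∉ t.data, z' q = z q) ∧ t.Added z z' := by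
  induction t with
  | leaf l r g p c =>
    obtain ⟨hnd, hr, hl⟩ := ht
    have hnd' := hnd
    simp only [List.nodup_append, List.mem_cons, List.not_mem_nil, or_false, List.nodup_cons, not_or,
      List.nodup_nil, and_true, not_false_eq_true] at hnd'
    obtain ⟨A, hA, hAm⟩ := exists_add_ctrl_list hnd'.1 r (c := c)
      (fun h => hnd'.2.2 c h c (Or.inr (Or.inr rfl)) rfl) (m := m) (by omega)
    refine ⟨A, hA.mono (by intro q; simp [qs]; tauto) le_rfl (by simp [leaves]), fun z => ?_⟩
    obtain ⟨z', h, h'⟩ := exists_outL_eq hnd'.1 z (v := (outL l z + (r + (z c).val)) % 2 ^ l.length)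
      (Nat.mod_lt _ (by positivity))
    exact ⟨z', hAm z z' h (h' ▸ Nat.mod_modEq _ _), h, h'⟩
  | node a b g p iha ihb =>
    obtain ⟨A, hA, hAm⟩ := iha ht.1
    obtain ⟨B, hB, hBm⟩ := ihb ht.2.1
    refine ⟨A * B, (hA.par hB ht.2.2.1).mono Finset.subset_union_left le_rfl
      (by simp only [leaves]; rw [add_mul]), fun z => ?_⟩
    obtain ⟨z1, m1, o1, k1⟩ := hBm z
    obtain ⟨z2, m2, o2, k2⟩ := hAm z1
    refine ⟨z2, m2.mul m1, fun q hq => ?_, ?_, ?_⟩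
    · simp only [data, List.mem_append, not_or] at hq
      rw [o2 q hq.1, o1 q hq.2]
    · exact k2.congr (fun q hq => o1 q fun h => ht.notMem_right hq (mem_qs_of_mem_data h))
        fun _ _ => rfl
    · exact k1.congr (fun _ _ => rfl) fun q hq =>
        (o2 q fun h => ht.notMem_left (mem_qs_of_mem_data hq) (mem_qs_of_mem_data h)).symm

/-- The adder of a carry-lookahead tree. -/
theorem exists_adder {m : ℕ} (t : CTree Q) (ht : t.WF m) :
    ∃ A : Op Q, Realizes t.qs (207 * (m + 1) + 344 * t.height)
      (t.leaves * (17 * addCost m + 36) + 344 * t.nodes + 18 * t.data.length) A ∧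
      ∀ z z' : Basis Q, (∀ q ∈ t.gps, z q = 0) → (∀ q ∈ t.carries, z q = 0) → z t.first = 0 →
        (∀ q ∉ t.data, z' q = z q) →
        outL t.data z' ≡ outL t.data z + t.addend [MOD 2 ^ t.data.length] → Maps A z z' := by
  obtain ⟨W, hW, hWm⟩ := t.exists_carries ht
  obtain ⟨A, hA, hAm⟩ := t.exists_block_add ht
  have hk := ht.kinds
  obtain ⟨N, hN, hNm⟩ := exists_not_list hk.1
  have hN' := hN.mono t.data_subset le_rfl le_rfl
  -- Compute the carries, add on all blocks in parallel, complement the data, erase the carries by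
  -- the inverse of `W`, and complement back.
  refine ⟨N * (Wᴴ * (N * (A * W))), (hN'.mul (hW.conjTranspose.mul (hN'.mul (hA.mul hW)))).mono
    (Finset.Subset.refl _) (by omega) (by ring_nf; omega), fun z z' hg hc hf hz' hout => ?_⟩
  obtain ⟨z1, m1, o1, k1⟩ := hWm z hg hc
  obtain ⟨z2, m2, o2, k2⟩ := hAm z1
  have m3 := hNm z2
  set z3 : Basis Q := fun q => if q ∈ t.data then z2 q + 1 else z2 q with hz3
  -- `z4` is `z3` with the carries erased. `W` leads from `z4` back to `z3`: by `Added.cok_flip` the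
  -- carries in `z3` are correct for the complemented data, and correct carries are unique.
  set z4 : Basis Q := fun q => if q ∈ t.carries then 0 else z3 q with hz4
  have hdc : ∀ q ∈ t.data, q ∉ t.carries := fun q hq => (hk.2.1 q hq).2.1
  have hgc : ∀ q ∈ t.gps, q ∉ t.carries := fun q hq => (hk.2.2.1 q hq).1
  have hgd : ∀ q ∈ t.gps, q ∉ t.data := fun q hq h => (hk.2.1 q h).1 hq
  have hcd : ∀ q ∈ t.carries, q ∉ t.data := fun q hq h => hdc q h hq
  have hfd : t.first ∉ t.data := fun h => (hk.2.1 _ h).2.2 rfl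
  have z3d : ∀ q ∈ t.data, z3 q = z2 q + 1 := fun q hq => by rw [hz3]; exact if_pos hq
  have z3o : ∀ q ∉ t.data, z3 q = z2 q := fun q hq => by rw [hz3]; exact if_neg hq
  have z4c : ∀ q ∈ t.carries, z4 q = 0 := fun q hq => by rw [hz4]; exact if_pos hq
  have z4o : ∀ q ∉ t.carries, z4 q = z3 q := fun q hq => by rw [hz4]; exact if_neg hq
  obtain ⟨z5, m5, o5, k5⟩ := hWm z4 (fun q hq => by
    rw [z4o q (hgc q hq), z3o q (hgd q hq), o2 q (hgd q hq), o1 q (hgc q hq), hg q hq]) z4c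
  have k3 : t.Cok z3 := k2.cok_flip ht k1 z3d
    (fun q hq => by rw [z3o q (hcd q hq), o2 q (hcd q hq)]) (by rw [z3o _ hfd, o2 _ hfd])
  have h53 : z5 = z3 := by
    funext q
    by_cases hq : q ∈ t.carries
    · exact k5.eq_on k3 (fun q hq => by rw [o5 q (hdc q hq), z4o q (hdc q hq)])
        (by rw [o5 _ hk.2.2.2, z4o _ hk.2.2.2]) q hq
    · rw [o5 q hq, z4o q hq]
  rw [h53] at m5
  have m6 := hNm z4
  set z6 : Basis Q := fun q => if q ∈ t.data then z4 q + 1 else z4 q with hz6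
  have z6d : ∀ q ∈ t.data, z6 q = z2 q := fun q hq => by
    have : z6 q = z4 q + 1 := by rw [hz6]; exact if_pos hq
    rw [this, z4o q (hdc q hq), z3d q hq]
    generalize z2 q = i
    fin_cases i <;> rfl
  have z6o : ∀ q ∉ t.data, z6 q = z4 q := fun q hq => by rw [hz6]; exact if_neg hq
  have h6 : z6 = z' := by
    funext q
    by_cases hq : q ∈ t.data
    · refine eq_of_outL_eq (l := t.data) ?_ hq
      have h1 := k2.outL_eq ht k1
      have hfz : z1 t.first = 0 := by rw [o1 _ hk.2.2.2, hf]
      rw [outL_congr z6d]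
      have h2 : outL t.data z2 ≡ outL t.data z + t.addend [MOD 2 ^ t.data.length] := by
        rw [outL_congr (l := t.data) fun q hq => (o1 q (hdc q hq)).symm]
        rw [hfz] at h1
        simp only [Fin.val_zero, add_zero] at h1
        rw [← h1]
        unfold Nat.ModEq
        rw [Nat.add_mul_mod_self_left]
      have h3 := h2.trans hout.symm
      unfold Nat.ModEq at h3
      rwa [Nat.mod_eq_of_lt (outL_lt _ _), Nat.mod_eq_of_lt (outL_lt _ _)] at h3
    · rw [hz' q hq, z6o q hq]
      by_cases hq' : q ∈ t.carries
      · rw [z4c q hq', hc q hq']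
      · rw [z4o q hq', z3o q hq, o2 q hq, o1 q hq']
  rw [← h6]
  exact m6.mul ((m5.conjTranspose hW.conjTranspose_mul_self).mul (m3.mul (m2.mul m1)))

/-- A perfect tree over a given list of data qubits. -/
theorem exists_tree (m d : ℕ) : ∀ (l anc : List Q) (r : ℕ), l.length ≤ m * 2 ^ d →
    anc.length + 2 = 5 * 2 ^ d → (l ++ anc).Nodup → r < 2 ^ l.length →
    ∃ t : CTree Q, t.WF m ∧ t.data = l ∧ t.addend = r ∧ t.height = d ∧ t.leaves = 2 ^ d ∧
      t.nodes ≤ 2 ^ d ∧ t.qs = (l ++ anc).toFinset := by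
  -- The node count is made exact for the induction. A perfect tree has `3` ancillas for each of its
  -- `2 ^ d` leaves and `2` for each of its `2 ^ d - 1` nodes, in all `5 * 2 ^ d - 2`.
  have aux : ∀ (d : ℕ) (l anc : List Q) (r : ℕ), l.length ≤ m * 2 ^ d →
    anc.length + 2 = 5 * 2 ^ d → (l ++ anc).Nodup → r < 2 ^ l.length →
    ∃ t : CTree Q, t.WF m ∧ t.data = l ∧ t.addend = r ∧ t.height = d ∧ t.leaves = 2 ^ d ∧
      t.nodes + 1 = 2 ^ d ∧ t.qs = (l ++ anc).toFinset := by
    intro d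
    induction d with
    | zero =>
      intro l anc r hl ha hnd hr
      obtain ⟨g, p, c, rfl⟩ := List.length_eq_three.1 (by omega : anc.length = 3)
      exact ⟨leaf l r g p c, ⟨hnd, hr, by simpa using hl⟩, rfl, rfl, rfl, rfl, rfl, rfl⟩
    | succ d ih =>
      intro l anc r hl ha hnd hr
      have hN : ∃ N, N + 2 = 5 * 2 ^ d := ⟨5 * 2 ^ d - 2, by have := Nat.one_le_two_pow (n := d); omega⟩
      obtain ⟨N, hN⟩ := hN
      rw [pow_succ] at ha hl
      rw [← mul_assoc] at hl
      set l1 := l.take (m * 2 ^ d) with hl1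
      set l2 := l.drop (m * 2 ^ d) with hl2
      have hl12 : l1 ++ l2 = l := List.take_append_drop _ _
      set a1 := anc.take N with ha1
      set a2 := (anc.drop N).take N with ha2
      set a3 := (anc.drop N).drop N with ha3
      have ha123 : a1 ++ (a2 ++ a3) = anc := by
        rw [ha2, ha3, List.take_append_drop, ha1, List.take_append_drop]
      have hla1 : a1.length = N := by rw [ha1, List.length_take]; omega
      have hla2 : a2.length = N := by rw [ha2, List.length_take, List.length_drop]; omega
      obtain ⟨g, p, hgp⟩ := List.length_eq_two.1 (show a3.length = 2 by
        rw [ha3, List.length_drop, List.length_drop]; omega)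
      rw [← ha123, hgp, ← hl12] at hnd ⊢
      rw [← hl12, List.length_append, pow_add] at hr
      have hperm : ((l1 ++ l2) ++ (a1 ++ (a2 ++ [g, p]))).Perm ((l1 ++ a1) ++ ((l2 ++ a2) ++ [g, p])) := by
        rw [List.append_assoc, List.append_assoc, List.append_assoc]
        refine List.Perm.append_left _ ?_
        exact List.perm_append_comm_assoc _ _ _
      have hnd' := hperm.nodup_iff.1 hnd
      rw [List.nodup_append] at hnd'
      obtain ⟨n1, n2, n3⟩ := hnd'
      rw [List.nodup_append] at n2
      obtain ⟨n4, n5, n6⟩ := n2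
      have hpos : 0 < 2 ^ l1.length := by positivity
      -- The first subtree holds the low-order qubits, so it receives the low-order part of the
      -- addend; the quotient goes to the other one.
      obtain ⟨t1, w1, d1, r1, e1, f1, g1, q1⟩ := ih l1 a1 (r % 2 ^ l1.length)
        (by rw [hl1, List.length_take]; omega) (by omega) n1 (Nat.mod_lt _ hpos)
      obtain ⟨t2, w2, d2, r2, e2, f2, g2, q2⟩ := ih l2 a2 (r / 2 ^ l1.length)
        (by rw [hl2, List.length_drop]; omega) (by omega) n4 (Nat.div_lt_of_lt_mul hr)
      refine ⟨node t1 t2 g p, ⟨w1, w2, ?_, ?_, ?_, ?_, ?_, ?_⟩, ?_, ?_, ?_, ?_, ?_, ?_⟩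
      · rw [q1, q2, Finset.disjoint_left]
        intro q hq hq'
        rw [List.mem_toFinset] at hq hq'
        exact n3 q hq q (List.mem_append_left _ hq') rfl
      · simpa using n5
      · rw [q1, List.mem_toFinset]; intro h; exact n3 g h g (by simp) rfl
      · rw [q2, List.mem_toFinset]; intro h; exact n6 g h g (by simp) rfl
      · rw [q1, List.mem_toFinset]; intro h; exact n3 p h p (by simp) rfl
      · rw [q2, List.mem_toFinset]; intro h; exact n6 p h p (by simp) rfl
      · rw [data, d1, d2]
      · rw [addend, d1, r1, r2, Nat.mod_add_div]
      · rw [height, e1, e2, max_self]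
      · rw [leaves, f1, f2, pow_succ]; omega
      · rw [nodes, pow_succ]; omega
      · rw [qs, q1, q2]
        ext q
        simp only [Finset.mem_union, List.mem_toFinset, List.mem_append, List.mem_cons,
          List.not_mem_nil, or_false, Finset.mem_insert, Finset.mem_singleton]
        tauto
  intro l anc r h1 h2 h3 h4
  obtain ⟨t, p1, p2, p3, p4, p5, p6, p7⟩ := aux d l anc r h1 h2 h3 h4
  exact ⟨t, p1, p2, p3, p4, p5, by omega, p7⟩

theorem qs_subset {m : ℕ} {t : CTree Q} (ht : t.WF m) {q : Q} (hq : q ∈ t.gps ∨ q ∈ t.carries ∨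
    q = t.first) : q ∈ t.qs ∧ q ∉ t.data := by
  have hk := ht.kinds
  rcases hq with h | h | rfl
  · exact ⟨t.gps_subset h, fun h' => (hk.2.1 q h').1 h⟩
  · exact ⟨t.carries_subset h, fun h' => (hk.2.1 q h').2.1 h⟩
  · exact ⟨t.first_mem, fun h' => (hk.2.1 _ h').2.2 rfl⟩

end CTree

/-- Addition of a constant to the integer stored in a list of qubits: depth `O(m + d)` with about
`5 * 2 ^ d` ancillas, for a list of at most `m * 2 ^ d` qubits. -/
theorem exists_adder {m d : ℕ} {l anc : List Q} {r : ℕ} (hl : l.length ≤ m * 2 ^ d)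
    (ha : anc.length + 2 = 5 * 2 ^ d) (hnd : (l ++ anc).Nodup) (hr : r < 2 ^ l.length) :
    ∃ A : Op Q, Realizes Finset.univ (207 * (m + 1) + 344 * d)
      (2 ^ d * (17 * addCost m + 380) + 18 * l.length) A ∧
      ∀ z z' : Basis Q, (∀ q ∈ anc, z q = 0) → (∀ q ∉ l, z' q = z q) →
        outL l z' ≡ outL l z + r [MOD 2 ^ l.length] → Maps A z z' := by
  obtain ⟨t, w, rfl, rfl, rfl, hleaves, hnodes, hq⟩ := CTree.exists_tree m d l anc r hl ha hnd hr
  obtain ⟨A, hA, hAm⟩ := t.exists_adder w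
  have hanc : ∀ z : Basis Q, (∀ q ∈ anc, z q = 0) → ∀ q, (q ∈ t.gps ∨ q ∈ t.carries ∨ q = t.first) →
      z q = 0 := by
    intro z hz q h
    obtain ⟨h1, h2⟩ := CTree.qs_subset w h
    rw [hq, List.mem_toFinset, List.mem_append] at h1
    exact hz q (h1.resolve_left h2)
  refine ⟨A, hA.mono (Finset.subset_univ _) le_rfl ?_, fun z z' hz h h' => hAm z z'
    (fun q hq => hanc z hz q (Or.inl hq)) (fun q hq => hanc z hz q (Or.inr (Or.inl hq)))
    (hanc z hz _ (Or.inr (Or.inr rfl))) h h'⟩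
  rw [hleaves]
  have : 2 ^ t.height * (17 * addCost m + 380) = 2 ^ t.height * (17 * addCost m + 36) +
    344 * 2 ^ t.height := by ring
  omega

end

/-! ## Segments of consecutive qubits -/

/-- The qubits `a, …, b - 1`. -/
def seg {n : ℕ} (a b : ℕ) (h : b ≤ n) : Fin (b - a) → Fin n := fun j => ⟨a + j.val, by omega⟩

/-- The set of the qubits `a, …, b - 1`. -/
def segS (n a b : ℕ) : Finset (Fin n) := Finset.univ.filter fun k => a ≤ k.val ∧ k.val < b

theorem mem_segS {n a b : ℕ} {k : Fin n} : k ∈ segS n a b ↔ a ≤ k.val ∧ k.val < b := by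
  simp [segS]

theorem segS_subset {n a b c d : ℕ} (h : c ≤ a) (h' : b ≤ d) : segS n a b ⊆ segS n c d := by
  intro k; rw [mem_segS, mem_segS]; omega

theorem segS_disjoint {n a b c d : ℕ} (h : b ≤ c) : Disjoint (segS n a b) (segS n c d) := by
  rw [Finset.disjoint_left]
  intro k; rw [mem_segS, mem_segS]; omega

theorem seg_injective {n a b : ℕ} (h : b ≤ n) : Function.Injective (seg a b h) := by
  intro i j hij
  have := congrArg Fin.val hij
  simp only [seg] at this
  exact Fin.ext (by omega)

theorem exists_seg_eq {n a b : ℕ} (h : b ≤ n) {k : Fin n} :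
    (∃ j, k = seg a b h j) ↔ a ≤ k.val ∧ k.val < b := by
  constructor
  · rintro ⟨j, rfl⟩
    have := j.2
    simp only [seg]
    omega
  · rintro ⟨h1, h2⟩
    exact ⟨⟨k.val - a, by omega⟩, Fin.ext (by simp only [seg]; omega)⟩

theorem sum_seg {M : Type*} [AddCommMonoid M] {n a b : ℕ} (h : b ≤ n) (f : Fin n → M) :
    (∑ k : Fin n, if a ≤ k.val ∧ k.val < b then f k else 0) = ∑ j, f (seg a b h j) := by
  symm
  refine Finset.sum_of_injOn (seg a b h) ((seg_injective h).injOn) (by simp) ?_ ?_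
  · intro k _ hk
    rw [if_neg]
    intro h'
    obtain ⟨j, rfl⟩ := (exists_seg_eq h).2 h'
    exact hk ⟨j, by simp, rfl⟩
  · intro j _
    rw [if_pos ((exists_seg_eq h).1 ⟨j, rfl⟩)]

theorem inE_seg {n a b : ℕ} (h : b ≤ n) (x : Basis (Fin n)) : inE (seg a b h) x = inVal a b x := by
  rw [inVal, sum_seg h fun k => (x k).val * 2 ^ (b - 1 - k.val)]
  refine Finset.sum_congr rfl fun j _ => ?_
  simp only [seg]
  rw [show b - a - 1 - j.val = b - 1 - (a + j.val) by omega]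

theorem outE_seg {n a b : ℕ} (h : b ≤ n) (x : Basis (Fin n)) :
    outE (seg a b h) x = outVal a b x := by
  rw [outVal, sum_seg h fun k => (x k).val * 2 ^ (k.val - a)]
  refine Finset.sum_congr rfl fun j _ => ?_
  simp only [seg]
  rw [show a + j.val - a = j.val by omega]

theorem qftOn_apply (n a b : ℕ) (y x : Basis (Fin n)) : qftOn n a b y x =
    if ∀ k ∉ segS n a b, y k = x k then
      ee ((inVal a b x : ℝ) * outVal a b y / 2 ^ (b - a)) / (Real.sqrt (2 ^ (b - a)) : ℂ)
    else 0 := by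
  have h1 : (∀ k : Fin n, (k.val < a ∨ b ≤ k.val) → y k = x k) ↔ ∀ k ∉ segS n a b, y k = x k := by
    refine forall_congr' fun k => ?_
    rw [mem_segS]
    have : (k.val < a ∨ b ≤ k.val) ↔ ¬(a ≤ k.val ∧ k.val < b) := by omega
    rw [this]
  simp only [qftOn, Matrix.of_apply, h1]
  by_cases h : ∀ k ∉ segS n a b, y k = x k
  · rw [if_pos h, if_pos h, ee]
    congr 2
    push_cast
    ring
  · rw [if_neg h, if_neg h]

theorem qftOn_eq_qftE {n a b : ℕ} (h : b ≤ n) : qftOn n a b = qftE (seg a b h) := by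
  ext y x
  have h1 : (∀ k : Fin n, (∀ j, k ≠ seg a b h j) → y k = x k) ↔ ∀ k ∉ segS n a b, y k = x k := by
    refine forall_congr' fun k => ?_
    rw [mem_segS, ← exists_seg_eq h]
    simp
  rw [qftOn_apply]
  simp only [qftE, Matrix.of_apply, h1, inE_seg, outE_seg]

theorem realizes_qftOn {n a b : ℕ} (h : b ≤ n) :
    Realizes (segS n a b) (4 * (b - a)) (2 * (b - a) * (b - a + 1)) (qftOn n a b) := by
  rw [qftOn_eq_qftE h]
  refine (realizes_qftE (seg_injective h)).mono ?_ le_rfl le_rfl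
  intro k hk
  exact mem_segS.2 ((exists_seg_eq h).1 (Finset.mem_filter.1 hk).2)

theorem phaseOn_eq_pdiag (n a b c : ℕ) : phaseOn n a b c =
    pdiag fun x => (inVal b c x : ℝ) * outVal a b x / 2 ^ (c - a) := by
  rw [phaseOn, pdiag]
  congr 1
  funext x
  rw [ee]
  congr 1
  push_cast
  ring

/-- In the input order the earlier segment is the high-order part, in `outVal_split` it is the
low-order part. The opposite orders give the QFT its recursion over consecutive segments. -/
theorem inVal_split {n a b c : ℕ} (hab : a ≤ b) (hbc : b ≤ c) (x : Basis (Fin n)) :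
    inVal a c x = inVal a b x * 2 ^ (c - b) + inVal b c x := by
  rw [inVal, inVal, inVal, Finset.sum_mul, ← Finset.sum_add_distrib]
  refine Finset.sum_congr rfl fun k _ => ?_
  by_cases h1 : a ≤ k.val ∧ k.val < b
  · rw [if_pos (by omega), if_pos h1, if_neg (by omega), add_zero, mul_assoc, ← pow_add]
    congr 2; omega
  · by_cases h2 : b ≤ k.val ∧ k.val < c
    · rw [if_pos (by omega), if_neg h1, if_pos h2, zero_mul, zero_add]
    · rw [if_neg (by omega), if_neg h1, if_neg h2, zero_mul, zero_add]

theorem outVal_split {n a b c : ℕ} (hab : a ≤ b) (hbc : b ≤ c) (x : Basis (Fin n)) :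
    outVal a c x = outVal a b x + 2 ^ (b - a) * outVal b c x := by
  rw [outVal, outVal, outVal, Finset.mul_sum, ← Finset.sum_add_distrib]
  refine Finset.sum_congr rfl fun k _ => ?_
  by_cases h1 : a ≤ k.val ∧ k.val < b
  · rw [if_pos (by omega), if_pos h1, if_neg (by omega), mul_zero, add_zero]
  · by_cases h2 : b ≤ k.val ∧ k.val < c
    · rw [if_pos (by omega), if_neg h1, if_pos h2, zero_add, mul_left_comm, ← pow_add]
      congr 2; omega
    · rw [if_neg (by omega), if_neg h1, if_neg h2, mul_zero, add_zero]

theorem inVal_congr {n a b : ℕ} {x y : Basis (Fin n)} (h : ∀ k ∈ segS n a b, x k = y k) :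
    inVal a b x = inVal a b y := by
  refine Finset.sum_congr rfl fun k _ => ?_
  split_ifs with h'
  · rw [h k (mem_segS.2 h')]
  · rfl

theorem outVal_congr {n a b : ℕ} {x y : Basis (Fin n)} (h : ∀ k ∈ segS n a b, x k = y k) :
    outVal a b x = outVal a b y := by
  refine Finset.sum_congr rfl fun k _ => ?_
  split_ifs with h'
  · rw [h k (mem_segS.2 h')]
  · rfl

theorem outVal_lt {n a b : ℕ} (h : b ≤ n) (x : Basis (Fin n)) : outVal a b x < 2 ^ (b - a) := by
  rw [← outE_seg h]; exact outE_lt _ _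

theorem outE_comp_rev {Q : Type} {k : ℕ} (e : Fin k → Q) (x : Basis Q) :
    outE (fun j => e (Fin.rev j)) x = inE e x := by
  unfold outE inE
  rw [← Equiv.sum_comp Fin.revPerm]
  refine Finset.sum_congr rfl fun j _ => ?_
  simp only [Fin.revPerm_apply, Fin.rev_rev, Fin.val_rev]
  congr 2; omega

theorem inVal_lt {n a b : ℕ} (h : b ≤ n) (x : Basis (Fin n)) : inVal a b x < 2 ^ (b - a) := by
  rw [← inE_seg h, ← outE_comp_rev]; exact outE_lt _ _

/-- The Fourier transform on two adjacent segments. -/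
theorem qftOn_split {n a b c : ℕ} (hab : a ≤ b) (hbc : b ≤ c) :
    qftOn n a c = qftOn n b c * (phaseOn n a b c * qftOn n a b) := by
  ext y x
  -- After the transform of the first segment, only the second one still holds input bits; this
  -- fixes the intermediate label.
  rw [Matrix.mul_apply, Finset.sum_eq_single ((segS n b c).piecewise x y)]
  · set z := (segS n b c).piecewise x y with hz
    have z1 : ∀ k ∈ segS n b c, z k = x k := fun k hk => Finset.piecewise_eq_of_mem _ _ _ hk
    have z2 : ∀ k ∉ segS n b c, z k = y k := fun k hk => Finset.piecewise_eq_of_notMem _ _ _ hk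
    have z3 : ∀ k ∈ segS n a b, z k = y k := fun k hk => z2 k (by rw [mem_segS] at *; omega)
    rw [phaseOn_eq_pdiag, pdiag, Matrix.diagonal_mul, qftOn_apply, qftOn_apply, qftOn_apply,
      if_pos fun k hk => (z2 k hk).symm]
    by_cases h : ∀ k ∉ segS n a c, y k = x k
    · have h' : ∀ k ∉ segS n a b, z k = x k := fun k hk => by
        by_cases hk' : k ∈ segS n b c
        · exact z1 k hk'
        · rw [z2 k hk', h k]; rw [mem_segS] at *; omega
      rw [if_pos h, if_pos h', outVal_congr z3, inVal_congr z1]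
      have hs : (Real.sqrt (2 ^ (c - a)) : ℂ) =
          (Real.sqrt (2 ^ (c - b)) : ℂ) * (Real.sqrt (2 ^ (b - a)) : ℂ) := by
        rw [← Complex.ofReal_mul, ← Real.sqrt_mul (by positivity), ← pow_add]
        congr 4; omega
      rw [hs, ← mul_div_assoc, ← ee_add, div_mul_div_comm, ← ee_add]
      congr 1
      rw [inVal_split hab hbc, outVal_split hab hbc]
      have hp : (2 : ℝ) ^ (c - a) = 2 ^ (c - b) * 2 ^ (b - a) := by
        rw [← pow_add]; congr 1; omega
      -- Of the four products of segment values, the high input part times the high output part is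
      -- an integer number of turns. The other three are the three factors on the right-hand side.
      have : ((inVal a b x * 2 ^ (c - b) + inVal b c x : ℕ) : ℝ) *
          ((outVal a b y + 2 ^ (b - a) * outVal b c y : ℕ) : ℝ) / 2 ^ (c - a) =
          (inVal b c x : ℝ) * outVal b c y / 2 ^ (c - b) +
          ((inVal b c x : ℝ) * outVal a b y / 2 ^ (c - a) +
            (inVal a b x : ℝ) * outVal a b y / 2 ^ (b - a)) + (inVal a b x * outVal b c y : ℕ) := by
        rw [hp]
        push_cast
        field_simp
        ring
      rw [this, ee_add_natCast]
    · rw [if_neg h, if_neg, mul_zero, mul_zero]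
      intro h'
      refine h fun k hk => ?_
      rw [← z2 k, h' k] <;> rw [mem_segS] at * <;> omega
  · intro z _ hz
    rw [phaseOn_eq_pdiag, pdiag, Matrix.diagonal_mul, qftOn_apply, qftOn_apply]
    by_cases h1 : ∀ k ∉ segS n b c, y k = z k
    · by_cases h2 : ∀ k ∉ segS n a b, z k = x k
      · refine absurd (funext fun k => ?_) hz
        by_cases hk : k ∈ segS n b c
        · rw [Finset.piecewise_eq_of_mem _ _ _ hk]
          refine h2 k ?_
          rw [mem_segS] at *; omega
        · rw [Finset.piecewise_eq_of_notMem _ _ _ hk]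
          exact (h1 k hk).symm
      · rw [if_neg h2, mul_zero, mul_zero]
    · rw [if_neg h1, zero_mul]
  · simp

/-- By `qftOn_split` the phase is a product of one QFT and two inverse QFTs, so its circuit is
inherited from theirs in linear depth. -/
theorem realizes_phaseOn {n a b c : ℕ} (hab : a ≤ b) (hbc : b ≤ c) (hcn : c ≤ n) :
    Realizes (segS n a c) (4 * (c - b) + (4 * (c - a) + 4 * (b - a)))
      (2 * (c - b) * (c - b + 1) + (2 * (c - a) * (c - a + 1) + 2 * (b - a) * (b - a + 1)))
      (phaseOn n a b c) := by
  have h1 := (realizes_qftOn (a := b) hcn).mono (segS_subset hab le_rfl) le_rfl le_rfl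
  have h2 := (realizes_qftOn (n := n) (a := a) (hbc.trans hcn)).mono
    (segS_subset le_rfl hbc) le_rfl le_rfl
  refine (h1.conjTranspose.mul ((realizes_qftOn (a := a) hcn).mul h2.conjTranspose)).congr_op ?_
  rw [qftOn_split hab hbc, mul_assoc, mul_assoc, h2.mul_conjTranspose_self, mul_one, ← mul_assoc,
    h1.conjTranspose_mul_self, one_mul]

/-! ## Circuits for the optimistic QFT -/

theorem blockStart_mono (n m : ℕ) {i j : ℕ} (h : i ≤ j) : blockStart n m i ≤ blockStart n m j :=
  min_le_min_left _ (Nat.mul_le_mul_left m h)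

theorem blockStart_le (n m i : ℕ) : blockStart n m i ≤ n := min_le_left _ _

theorem blockStart_add_sub_le (n m i j : ℕ) : blockStart n m (i + j) - blockStart n m i ≤ m * j := by
  unfold blockStart
  rw [mul_add]
  omega

/-- A gap of two makes disjoint not only the blocks but also the pairs of blocks `i`, `i + 1` on
which phases act. Hence each of the five stages runs in parallel over the blocks. -/
theorem blocksOfParity_pairwise (n m p : ℕ) :
    (blocksOfParity n m p).Pairwise fun i j => i + 2 ≤ j := by
  unfold blocksOfParity
  rw [List.pairwise_filter]
  refine List.pairwise_lt_range.imp fun {i j} hij hi hj => ?_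
  simp only [decide_eq_true_eq] at hi hj
  omega

theorem length_blocksOfParity_le (n m p : ℕ) :
    (blocksOfParity n m p).length ≤ (n + m - 1) / m :=
  (List.length_filter_le _ _).trans (by rw [List.length_range])

theorem two_mul_mul_le {k m : ℕ} (h : k ≤ m) : 2 * k * (k + 1) ≤ 2 * m * (m + 1) :=
  Nat.mul_le_mul (Nat.mul_le_mul_left 2 h) (by omega)

theorem realizes_qftBlocks (n m p : ℕ) : Realizes Finset.univ (4 * m)
    ((n + m - 1) / m * (2 * m * (m + 1))) (qftBlocks n m p) := by
  have := Realizes.list_par (blocksOfParity n m p)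
    (fun i => segS n (blockStart n m i) (blockStart n m (i + 1)))
    (fun i => qftOn n (blockStart n m i) (blockStart n m (i + 1))) (4 * m) (2 * m * (m + 1))
    (fun i _ => ?_) ?_
  · exact this.mono (Finset.subset_univ _) le_rfl
      (Nat.mul_le_mul_right _ (length_blocksOfParity_le n m p))
  · have h := blockStart_add_sub_le n m i 1
    rw [mul_one] at h
    exact (realizes_qftOn (blockStart_le n m _)).mono (Finset.Subset.refl _)
      (by omega) (two_mul_mul_le h)
  · exact (blocksOfParity_pairwise n m p).imp fun {i j} h =>
      segS_disjoint (blockStart_mono n m (by omega))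

theorem realizes_phaseBlocks (n m p : ℕ) : Realizes Finset.univ (16 * m)
    ((n + m - 1) / m * (20 * m * (m + 1))) (phaseBlocks n m p) := by
  have := Realizes.list_par (blocksOfParity n m p)
    (fun i => segS n (blockStart n m i) (blockStart n m (i + 2)))
    (fun i => phaseOn n (blockStart n m i) (blockStart n m (i + 1)) (blockStart n m (i + 2)))
    (16 * m) (20 * m * (m + 1)) (fun i _ => ?_) ?_
  · exact this.mono (Finset.subset_univ _) le_rfl
      (Nat.mul_le_mul_right _ (length_blocksOfParity_le n m p))
  · have h1 := blockStart_add_sub_le n m i 1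
    have h2 := blockStart_add_sub_le n m (i + 1) 1
    have h3 := blockStart_add_sub_le n m i 2
    rw [mul_one] at h1 h2
    refine (realizes_phaseOn (blockStart_mono n m (by omega)) (blockStart_mono n m (by omega))
      (blockStart_le n m _)).mono (Finset.Subset.refl _) ?_ ?_
    · rw [show i + 1 + 1 = i + 2 from rfl] at h2; omega
    · have e1 := two_mul_mul_le h1
      have e2 := two_mul_mul_le h2
      have e3 := two_mul_mul_le h3
      rw [show i + 1 + 1 = i + 2 from rfl] at e2
      nlinarith
  · exact (blocksOfParity_pairwise n m p).imp fun {i j} h =>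
      segS_disjoint (blockStart_mono n m (by omega))

theorem realizes_optimisticQFT (n m : ℕ) : Realizes Finset.univ (48 * m)
    ((n + m - 1) / m * (48 * m * (m + 1))) (optimisticQFT n m) := by
  have h0 := realizes_qftBlocks n m 0
  have h1 := realizes_qftBlocks n m 1
  have p0 := realizes_phaseBlocks n m 0
  have p1 := realizes_phaseBlocks n m 1
  exact ((((h0.mul p1).mul (h1.mul h0.conjTranspose)).mul p0).mul h0).mono (Finset.Subset.refl _)
    (by omega) (by apply le_of_eq; ring)

/-! ## Adding ancillas -/

/-- The basis state with all ancillas equal to zero. -/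
def withZeros {n : ℕ} (a : ℕ) (x : Basis (Fin n)) : Basis (Fin n ⊕ Fin a) := Sum.elim x fun _ => 0

/-- `A'` acts as `A` on the data qubits when all ancillas are zero, and keeps them zero. -/
def Lifts {n a : ℕ} (A' : Op (Fin n ⊕ Fin a)) (A : Op (Fin n)) : Prop :=
  ∀ z x, A' z (withZeros a x) =
    if ∀ j : Fin a, z (Sum.inr j) = 0 then A (fun i => z (Sum.inl i)) x else 0

theorem withZeros_iff {n a : ℕ} {z : Basis (Fin n ⊕ Fin a)} {x : Basis (Fin n)} :
    z = withZeros a x ↔ (∀ j : Fin a, z (Sum.inr j) = 0) ∧ (fun i => z (Sum.inl i)) = x := by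
  constructor
  · rintro rfl; exact ⟨fun _ => rfl, rfl⟩
  · rintro ⟨h, rfl⟩
    funext q
    rcases q with i | j
    exacts [rfl, h j]

theorem sum_if_zeros {M : Type*} [AddCommMonoid M] {n a : ℕ} (f : Basis (Fin n ⊕ Fin a) → M) :
    (∑ z, if ∀ j : Fin a, z (Sum.inr j) = 0 then f z else 0) = ∑ x, f (withZeros a x) := by
  symm
  refine Finset.sum_of_injOn (withZeros a) ?_ (by simp) ?_ ?_
  · intro x _ x' _ h
    exact (withZeros_iff.1 h).2
  · intro z _ hz
    rw [if_neg]
    intro h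
    exact hz ⟨fun i => z (Sum.inl i), by simp, (withZeros_iff.2 ⟨h, rfl⟩).symm⟩
  · intro x _
    rw [if_pos]
    intro j; rfl

theorem Lifts.mul {n a : ℕ} {A' B' : Op (Fin n ⊕ Fin a)} {A B : Op (Fin n)} (hA : Lifts A' A)
    (hB : Lifts B' B) : Lifts (A' * B') (A * B) := by
  intro z x
  rw [Matrix.mul_apply]
  simp only [hB _ x, mul_ite, mul_zero]
  rw [sum_if_zeros fun w => A' z w * B (fun i => w (Sum.inl i)) x]
  simp only [hA z]
  split_ifs with h
  · rw [Matrix.mul_apply]; rfl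
  · simp

theorem Lifts.one {n a : ℕ} : Lifts (1 : Op (Fin n ⊕ Fin a)) 1 := by
  intro z x
  simp only [Matrix.one_apply, withZeros_iff]
  by_cases h : ∀ j : Fin a, z (Sum.inr j) = 0 <;> simp [h]

theorem Lifts.app {n a : ℕ} {A' : Op (Fin n ⊕ Fin a)} {A : Op (Fin n)} (h : Lifts A' A)
    (ψ : QState (Fin n)) : A'.app (withAncilla a ψ) = withAncilla a (A.app ψ) := by
  ext z
  have h1 : A'.app (withAncilla a ψ) z = ∑ w, A' z w * withAncilla a ψ w := rfl
  have h2 : ∀ z, withAncilla a (A.app ψ) z =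
    if ∀ j : Fin a, z (Sum.inr j) = 0 then ∑ x, A (fun i => z (Sum.inl i)) x * ψ x else 0 :=
    fun z => rfl
  have h3 : ∀ w, withAncilla a ψ w =
    if ∀ j : Fin a, w (Sum.inr j) = 0 then ψ (fun i => w (Sum.inl i)) else 0 := fun w => rfl
  rw [h1, h2]
  simp only [h3, mul_ite, mul_zero]
  rw [sum_if_zeros fun w => A' z w * ψ (fun i => w (Sum.inl i))]
  simp only [h z]
  split_ifs
  · rfl
  · simp

/-- An adder is understood only on states with zero ancillas. Its action on these basis states
determines all the columns that `Lifts` concerns. -/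
theorem lifts_of_maps {n a : ℕ} {A' : Op (Fin n ⊕ Fin a)} {A : Op (Fin n)}
    (h : ∀ x, ∃ x', Maps A x x' ∧ Maps A' (withZeros a x) (withZeros a x')) : Lifts A' A := by
  intro z x
  obtain ⟨x', h1, h2⟩ := h x
  rw [maps_iff.1 h2, maps_iff.1 h1]
  simp only [withZeros_iff]
  by_cases h : ∀ j : Fin a, z (Sum.inr j) = 0 <;> simp [h]

/-- The gate on the register extended by ancillas. -/
def Gate.inl {n : ℕ} (a : ℕ) : Gate (Fin n) → Gate (Fin n ⊕ Fin a)
  | .one p u => .one (Sum.inl p) u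
  | .two p q h u => .two (Sum.inl p) (Sum.inl q) (fun h' => h (Sum.inl_injective h')) u

theorem Gate.support_inl {n a : ℕ} (g : Gate (Fin n)) :
    (g.inl a).support = g.support.image Sum.inl := by
  cases g <;> simp [Gate.inl, Gate.support]

theorem Gate.lifts_inl {n a : ℕ} (g : Gate (Fin n)) : Lifts (g.inl a).op g.op := by
  intro z x
  cases g with
  | one p u =>
    simp only [Gate.inl, Gate.op, Matrix.of_apply]
    rw [← ite_and]
    congr 1
    apply propext
    constructor
    · intro h
      exact ⟨fun j => h (Sum.inr j) (by simp), fun k hk => h (Sum.inl k) (by simpa using hk)⟩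
    · rintro ⟨h, h'⟩ (k | j) hk
      · exact h' k (by simpa using hk)
      · exact h j
  | two p q hpq u =>
    simp only [Gate.inl, Gate.op, Matrix.of_apply]
    rw [← ite_and]
    congr 1
    apply propext
    constructor
    · intro h
      exact ⟨fun j => h (Sum.inr j) (by simp) (by simp),
        fun k hk hk' => h (Sum.inl k) (by simpa using hk) (by simpa using hk')⟩
    · rintro ⟨h, h'⟩ (k | j) hk hk'
      · exact h' k (by simpa using hk) (by simpa using hk')
      · exact h j

theorem lifts_layersOp {n a : ℕ} (L : List (List (Gate (Fin n)))) :
    Lifts (layersOp (L.map (List.map (Gate.inl a)))) (layersOp L) := by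
  induction L with
  | nil => exact Lifts.one
  | cons l L ih =>
    rw [List.map_cons, layersOp, layersOp]
    refine ih.mul ?_
    clear ih
    induction l with
    | nil => exact Lifts.one
    | cons g l ih =>
      simp only [List.map_cons, List.prod_cons]
      exact g.lifts_inl.mul ih

theorem Realizes.exists_lift {n d g : ℕ} (a : ℕ) {S : Finset (Fin n)} {A : Op (Fin n)}
    (h : Realizes S d g A) : ∃ A' : Op (Fin n ⊕ Fin a), Realizes Finset.univ d g A' ∧ Lifts A' A := by
  obtain ⟨c, _, h2, h3, rfl⟩ := h
  refine ⟨_, ⟨⟨c.layers.map (List.map (Gate.inl a)), ?_⟩, fun _ _ _ _ => Finset.subset_univ _, ?_, ?_,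
    rfl⟩, lifts_layersOp c.layers⟩
  · intro L hL
    obtain ⟨l, hl, rfl⟩ := List.mem_map.1 hL
    rw [List.pairwise_map]
    refine (c.disjoint l hl).imp fun {g h} hgh => ?_
    rw [Gate.support_inl, Gate.support_inl, Finset.disjoint_image Sum.inl_injective]
    exact hgh
  · simpa [Circuit.depth] using h2
  · simpa [Circuit.gateCount, Function.comp_def] using h3

/-! ## Weyl–Heisenberg operators -/

theorem inVal_eq_outE_rev {n : ℕ} (x : Basis (Fin n)) :
    inVal 0 n x = outE (fun j : Fin n => Fin.rev j) x := by
  rw [outE_comp_rev (fun j : Fin n => j)]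
  simp [inVal, inE]

theorem outVal_eq_outE {n : ℕ} (x : Basis (Fin n)) : outVal 0 n x = outE (fun j : Fin n => j) x := by
  simp [outVal, outE]

theorem eq_of_inVal_eq {n : ℕ} {x y : Basis (Fin n)} (h : inVal 0 n x = inVal 0 n y) : x = y := by
  rw [inVal_eq_outE_rev, inVal_eq_outE_rev] at h
  funext k
  simpa using eq_of_outE_eq h (Fin.rev k)

theorem exists_inVal_eq {n v : ℕ} (h : v < 2 ^ n) : ∃ x : Basis (Fin n), inVal 0 n x = v := by
  obtain ⟨x, _, hx⟩ := exists_outE_eq (e := fun j : Fin n => Fin.rev j) Fin.rev_injective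
    (fun _ => 0) h
  exact ⟨x, by rw [inVal_eq_outE_rev, hx]⟩

theorem exists_outVal_eq {n v : ℕ} (h : v < 2 ^ n) : ∃ x : Basis (Fin n), outVal 0 n x = v := by
  obtain ⟨x, _, hx⟩ := exists_outE_eq (e := fun j : Fin n => j) (fun _ _ h => h)
    (fun _ => 0) h
  exact ⟨x, by rw [outVal_eq_outE, hx]⟩

theorem maps_shiftX_pow {n : ℕ} (r : ℕ) {x x' : Basis (Fin n)}
    (h : inVal 0 n x' ≡ inVal 0 n x + r [MOD 2 ^ n]) : Maps (shiftX n ^ r) x x' := by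
  induction r generalizing x' with
  | zero =>
    have h' : inVal 0 n x' = inVal 0 n x := by
      have := inVal_lt (a := 0) (le_refl n) x
      have := inVal_lt (a := 0) (le_refl n) x'
      unfold Nat.ModEq at h
      rwa [add_zero, Nat.mod_eq_of_lt (by simpa), Nat.mod_eq_of_lt (by simpa)] at h
    rw [eq_of_inVal_eq h', pow_zero]
    exact Maps.one x
  | succ r ih =>
    obtain ⟨w, hw⟩ := exists_inVal_eq (n := n) (v := (inVal 0 n x + r) % 2 ^ n)
      (Nat.mod_lt _ (by positivity))
    have h1 : Maps (shiftX n ^ r) x w := ih (hw ▸ Nat.mod_modEq _ _)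
    rw [pow_succ']
    refine Maps.mul (z' := w) (maps_iff.2 fun y => ?_) h1
    simp only [shiftX, Matrix.of_apply]
    have hw' : (inVal 0 n w + 1) % 2 ^ n = inVal 0 n x' := by
      have hlt : inVal 0 n x' < 2 ^ n := by simpa using inVal_lt (a := 0) (le_refl n) x'
      rw [hw, Nat.mod_add_mod, add_assoc, ← h, Nat.mod_eq_of_lt hlt]
    rw [hw']
    congr 1
    apply propext
    exact ⟨eq_of_inVal_eq, fun h => h ▸ rfl⟩

theorem exists_maps_shiftX_pow {n : ℕ} (r : ℕ) (x : Basis (Fin n)) : ∃ x',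
    inVal 0 n x' ≡ inVal 0 n x + r [MOD 2 ^ n] ∧ Maps (shiftX n ^ r) x x' := by
  obtain ⟨w, hw⟩ := exists_inVal_eq (n := n) (v := (inVal 0 n x + r) % 2 ^ n)
      (Nat.mod_lt _ (by positivity))
  have := hw ▸ Nat.mod_modEq (inVal 0 n x + r) (2 ^ n)
  exact ⟨w, this, maps_shiftX_pow r this⟩

theorem clockZ_pow (n r : ℕ) : clockZ n ^ r = pdiag fun x => (r : ℝ) * inVal 0 n x / 2 ^ n := by
  have h1 : clockZ n = pdiag fun x => (inVal 0 n x : ℝ) / 2 ^ n := by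
    rw [clockZ, pdiag]
    congr 1
    funext x
    rw [ee]
    congr 1
    push_cast
    ring
  induction r with
  | zero => simp [pdiag_zero]
  | succ r ih =>
    rw [pow_succ, ih, h1, pdiag_mul]
    congr 1
    funext x
    push_cast
    ring

theorem qft_apply (n : ℕ) (y x : Basis (Fin n)) :
    qft n y x = ee ((inVal 0 n x : ℝ) * outVal 0 n y / 2 ^ n) / (Real.sqrt (2 ^ n) : ℂ) := by
  rw [qft, qftOn_apply, if_pos, Nat.sub_zero]
  intro k hk
  exact absurd (mem_segS.2 ⟨Nat.zero_le _, k.2⟩) hk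

theorem realizes_qft (n : ℕ) : Realizes Finset.univ (4 * n) (2 * n * (n + 1)) (qft n) :=
  (realizes_qftOn (n := n) (a := 0) (le_refl n)).mono (Finset.subset_univ _) (by omega) (by simp)

/-- The shift theorem: a translation of the input is a linear phase on the output. -/
theorem qft_mul_shiftX_pow (n r : ℕ) :
    qft n * shiftX n ^ r = pdiag (fun y => (r : ℝ) * outVal 0 n y / 2 ^ n) * qft n := by
  ext y x
  obtain ⟨x', h, hx'⟩ := exists_maps_shiftX_pow r x
  rw [Matrix.mul_apply, Finset.sum_eq_single x', maps_iff.1 hx', if_pos rfl, mul_one, pdiag,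
    Matrix.diagonal_mul, qft_apply, qft_apply, ← mul_div_assoc, ← ee_add]
  · congr 1
    obtain ⟨N, hN⟩ := Nat.modEq_iff_dvd.1 h
    have hN' : (inVal 0 n x : ℝ) + r - inVal 0 n x' = 2 ^ n * N := by exact_mod_cast hN
    rw [← ee_add_intCast _ (N * outVal 0 n y)]
    congr 1
    push_cast
    field_simp
    linear_combination -(outVal 0 n y : ℝ) * hN'
  · intro w _ hw
    rw [maps_iff.1 hx', if_neg hw, mul_zero]
  · simp

/-- Under the QFT the shift becomes a phase in the output integer and the clock becomes a
translation of it. So this adjoint costs one layer of phases followed by the addition of `r₂` in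
output order. -/
theorem weylHat_conjTranspose (n r₁ r₂ : ℕ) : (weylHat n r₁ r₂)ᴴ =
    (qft n * (pdiag (fun x => -((r₂ : ℝ) * inVal 0 n x / 2 ^ n)) * (qft n)ᴴ)) *
      pdiag fun y => -((r₁ : ℝ) * outVal 0 n y / 2 ^ n) := by
  have hF := (realizes_qft n).conjTranspose_mul_self
  have hF' := (realizes_qft n).mul_conjTranspose_self
  have h1 : weylHat n r₁ r₂ = pdiag (fun y => (r₁ : ℝ) * outVal 0 n y / 2 ^ n) *
      (qft n * (clockZ n ^ r₂ * (qft n)ᴴ)) := by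
    rw [weylHat, weyl, ← mul_assoc, qft_mul_shiftX_pow]
    simp only [mul_assoc]
  rw [h1, clockZ_pow]
  simp only [Matrix.conjTranspose_mul, Matrix.conjTranspose_conjTranspose, pdiag_conjTranspose,
    mul_assoc]

theorem inVal_eq_inE {n : ℕ} (x : Basis (Fin n)) : inVal 0 n x = inE (fun j : Fin n => j) x := by
  simp [inVal, inE]

theorem qft_eq_qftE (n : ℕ) : qft n = qftE fun j : Fin n => j := by
  ext y x
  rw [qft_apply, inVal_eq_inE, outVal_eq_outE]
  simp [qftE]

theorem maps_qft_conj {n : ℕ} (r : ℕ) {z z' : Basis (Fin n)}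
    (h : outVal 0 n z' ≡ outVal 0 n z + r [MOD 2 ^ n]) :
    Maps (qft n * (pdiag (fun x => -((r : ℝ) * inVal 0 n x / 2 ^ n)) * (qft n)ᴴ)) z z' := by
  simp only [qft_eq_qftE, inVal_eq_inE]
  rw [outVal_eq_outE, outVal_eq_outE] at h
  refine maps_qftE_conj (fun _ _ h => h) (w := fun _ => r) (fun _ _ => rfl) ?_ h
  intro q hq
  exact absurd (mem_qubitsOf.2 ⟨q, rfl⟩) hq

theorem realizes_pdiag_sum {n : ℕ} (θ : Fin n → Fin 2 → ℝ) :
    Realizes Finset.univ 1 n (pdiag fun z : Basis (Fin n) => ∑ k, θ k (z k)) := by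
  have := Realizes.list_par (List.finRange n) (fun k => {k})
    (fun k => pdiag fun z : Basis (Fin n) => θ k (z k)) 1 1
    (fun k _ => realizes_pdiag_one k (θ k))
    ((List.nodup_finRange n).imp fun {i j} h => by simpa using h)
  rw [pdiag_list_prod, List.length_finRange, mul_one] at this
  refine (this.mono (Finset.subset_univ _) le_rfl le_rfl).congr_op ?_
  simp only [← List.ofFn_eq_map, List.sum_ofFn]

theorem realizes_pdiag_inVal (n : ℕ) (c : ℝ) :
    Realizes Finset.univ 1 n (pdiag fun x : Basis (Fin n) => c * inVal 0 n x / 2 ^ n) := by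
  refine (realizes_pdiag_sum fun (k : Fin n) (b : Fin 2) =>
    c * (b.val * 2 ^ (n - 1 - k.val)) / 2 ^ n).congr_op ?_
  congr 1
  funext x
  rw [inVal_eq_inE, inE, ← Finset.sum_div, ← Finset.mul_sum]
  push_cast
  rfl

theorem realizes_pdiag_outVal (n : ℕ) (c : ℝ) :
    Realizes Finset.univ 1 n (pdiag fun x : Basis (Fin n) => c * outVal 0 n x / 2 ^ n) := by
  refine (realizes_pdiag_sum fun (k : Fin n) (b : Fin 2) =>
    c * (b.val * 2 ^ k.val) / 2 ^ n).congr_op ?_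
  congr 1
  funext x
  rw [outVal_eq_outE, outE, ← Finset.sum_div, ← Finset.mul_sum]
  push_cast
  rfl

/-! ## Circuits for the conjugated optimistic QFT -/

theorem outL_ofFn {Q : Type} [Fintype Q] [DecidableEq Q] {k : ℕ} (e : Fin k → Q) (z : Basis Q) :
    outL (List.ofFn e) z = outE e z := by
  induction k with
  | zero => rw [List.ofFn_zero, outL_nil, outE, Fin.sum_univ_zero]
  | succ k ih =>
    rw [List.ofFn_succ, outL_cons, ih, outE, outE, Fin.sum_univ_succ, Finset.mul_sum]
    simp only [Fin.val_zero, pow_zero, mul_one, Fin.val_succ]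
    congr 1
    refine Finset.sum_congr rfl fun j _ => ?_
    ring

/-- Adders for the numbers stored in all data qubits, in an arbitrary order `e`. -/
theorem exists_data_adder {n m d a r : ℕ} (hn : n ≤ m * 2 ^ d) (ha : a + 2 = 5 * 2 ^ d)
    (hr : r < 2 ^ n) {e : Fin n → Fin n} (he : Function.Bijective e) :
    ∃ A' : Op (Fin n ⊕ Fin a), Realizes Finset.univ (207 * (m + 1) + 344 * d)
      (2 ^ d * (17 * addCost m + 380) + 18 * n) A' ∧
      ∀ x x' : Basis (Fin n), outE e x' ≡ outE e x + r [MOD 2 ^ n] →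
        Maps A' (withZeros a x) (withZeros a x') := by
  have hE : Function.Injective fun j => (Sum.inl (e j) : Fin n ⊕ Fin a) :=
    Sum.inl_injective.comp he.1
  obtain ⟨A, hA, hAm⟩ := exists_adder (m := m) (d := d) (r := r)
    (l := List.ofFn fun j => (Sum.inl (e j) : Fin n ⊕ Fin a))
    (anc := List.ofFn fun j => (Sum.inr j : Fin n ⊕ Fin a)) (by simpa using hn) (by simpa using ha)
    (by
      rw [List.nodup_append, List.nodup_ofFn, List.nodup_ofFn]
      refine ⟨hE, Sum.inr_injective, ?_⟩
      intro q hq q' hq'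
      rw [List.mem_ofFn] at hq hq'
      obtain ⟨i, rfl⟩ := hq
      obtain ⟨j, rfl⟩ := hq'
      simp) (by simpa using hr)
  rw [List.length_ofFn] at hA
  refine ⟨A, hA, fun x x' h => hAm _ _ ?_ ?_ ?_⟩
  · intro q hq
    rw [List.mem_ofFn] at hq
    obtain ⟨j, rfl⟩ := hq
    rfl
  · rintro (i | j) hq
    · refine absurd ?_ hq
      rw [List.mem_ofFn]
      obtain ⟨j, rfl⟩ := he.2 i
      exact ⟨j, rfl⟩
    · rfl
  · rw [outL_ofFn, outL_ofFn, List.length_ofFn]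
    exact h

/-- Phases and an adder for `V`, the optimistic QFT, phases and an adder for the adjoint of `V̂`.
The adder for `V` uses `Fin.rev` because adders read the least significant bit first, while inputs
have it last. -/
theorem exists_circuit_conjugatedOQFT {n m d a r₁ r₂ : ℕ} (hn : n ≤ m * 2 ^ d)
    (ha : a + 2 = 5 * 2 ^ d) (hr₁ : r₁ < 2 ^ n) (hr₂ : r₂ < 2 ^ n) :
    ∃ c : Circuit (Fin n ⊕ Fin a), c.depth ≤ 414 * (m + 1) + 688 * d + 48 * m + 2 ∧
      c.gateCount ≤ 2 * (2 ^ d * (17 * addCost m + 380)) + 38 * n +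
        (n + m - 1) / m * (48 * m * (m + 1)) ∧
      Implements c (conjugatedOQFT n m r₁ r₂) := by
  obtain ⟨A, hA, hAm⟩ := exists_data_adder (m := m) (d := d) (a := a) hn ha hr₁
    (e := fun j => Fin.rev j) Fin.rev_bijective
  obtain ⟨B, hB, hBm⟩ := exists_data_adder (m := m) (d := d) (a := a) hn ha hr₂
    (e := fun j => j) Function.bijective_id
  have lA : Lifts A (shiftX n ^ r₁) := lifts_of_maps fun x => by
    obtain ⟨x', h, h'⟩ := exists_maps_shiftX_pow r₁ x
    refine ⟨x', h', hAm x x' ?_⟩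
    rwa [inVal_eq_outE_rev, inVal_eq_outE_rev] at h
  have lB : Lifts B (qft n * (pdiag (fun x => -((r₂ : ℝ) * inVal 0 n x / 2 ^ n)) * (qft n)ᴴ)) :=
    lifts_of_maps fun x => by
      obtain ⟨x', hx'⟩ := exists_outVal_eq (n := n) (v := (outVal 0 n x + r₂) % 2 ^ n)
        (Nat.mod_lt _ (by positivity))
      have h := hx' ▸ Nat.mod_modEq (outVal 0 n x + r₂) (2 ^ n)
      refine ⟨x', maps_qft_conj r₂ h, hBm x x' ?_⟩
      rwa [outVal_eq_outE, outVal_eq_outE] at h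
  obtain ⟨Z, hZ, lZ⟩ := (realizes_pdiag_inVal n r₂).exists_lift a
  obtain ⟨Y, hY, lY⟩ := (realizes_pdiag_outVal n r₁).conjTranspose.exists_lift a
  obtain ⟨O, hO, lO⟩ := (realizes_optimisticQFT n m).exists_lift a
  obtain ⟨c, _, hd, hg, hc⟩ := ((hB.mul hY).mul hO).mul (hA.mul hZ)
  refine ⟨c, by omega, by omega, fun ψ => ?_⟩
  rw [hc]
  have := (((lB.mul lY).mul lO).mul (lA.mul lZ)).app ψ
  rw [this, conjugatedOQFT, weylHat_conjTranspose, weyl, clockZ_pow, pdiag_conjTranspose]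

theorem conjugatedOQFT_eq_qft {n m r₁ r₂ : ℕ} (h : optimisticQFT n m = qft n) :
    conjugatedOQFT n m r₁ r₂ = qft n * ((weyl n r₁ r₂)ᴴ * weyl n r₁ r₂) := by
  rw [conjugatedOQFT, h, weylHat]
  simp only [Matrix.conjTranspose_mul, Matrix.conjTranspose_conjTranspose, mul_assoc]
  rw [← mul_assoc (qft n)ᴴ (qft n), (realizes_qft n).conjTranspose_mul_self, one_mul]

/-! ## The Frobenius norm -/

section Frobenius

variable {Q : Type} [Fintype Q] [DecidableEq Q]

/-- The Frobenius norm of an operator. -/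
def fnorm (A : Op Q) : ℝ :=
  ‖(WithLp.toLp 2 fun p : Basis Q × Basis Q => A p.1 p.2 : EuclideanSpace ℂ (Basis Q × Basis Q))‖

theorem fnorm_nonneg (A : Op Q) : 0 ≤ fnorm A := norm_nonneg _

theorem fnorm_zero : fnorm (0 : Op Q) = 0 := norm_zero (E := EuclideanSpace ℂ (Basis Q × Basis Q))

theorem fnorm_sq (A : Op Q) : fnorm A ^ 2 = ∑ y, ∑ x, ‖A y x‖ ^ 2 := by
  rw [fnorm, EuclideanSpace.norm_sq_eq, Fintype.sum_prod_type]

theorem fnorm_sub_le (A B C : Op Q) : fnorm (A - C) ≤ fnorm (A - B) + fnorm (B - C) := by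
  have h := norm_add_le
    (WithLp.toLp 2 fun p : Basis Q × Basis Q => (A - B) p.1 p.2 : EuclideanSpace ℂ (Basis Q × Basis Q))
    (WithLp.toLp 2 fun p : Basis Q × Basis Q => (B - C) p.1 p.2)
  refine le_trans (le_of_eq ?_) h
  rw [fnorm, ← WithLp.toLp_add]
  congr 2
  funext p
  simp

theorem fnorm_sq_eq_trace (A : Op Q) : fnorm A ^ 2 = (Aᴴ * A).trace.re := by
  rw [fnorm_sq, Matrix.trace, Complex.re_sum, Finset.sum_comm]
  refine Finset.sum_congr rfl fun x _ => ?_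
  rw [Matrix.diag_apply, Matrix.mul_apply, Complex.re_sum]
  refine Finset.sum_congr rfl fun y _ => ?_
  rw [Matrix.conjTranspose_apply, Complex.star_def, ← Complex.normSq_eq_conj_mul_self,
    Complex.ofReal_re, Complex.normSq_eq_norm_sq]

theorem fnorm_unitary_mul {U : Op Q} (hU : Uᴴ * U = 1) (A : Op Q) : fnorm (U * A) = fnorm A := by
  rw [← pow_left_inj₀ (fnorm_nonneg _) (fnorm_nonneg _) two_ne_zero, fnorm_sq_eq_trace,
    fnorm_sq_eq_trace, Matrix.conjTranspose_mul, mul_assoc, ← mul_assoc Uᴴ, hU, one_mul]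

theorem fnorm_conjTranspose (A : Op Q) : fnorm Aᴴ = fnorm A := by
  rw [← pow_left_inj₀ (fnorm_nonneg _) (fnorm_nonneg _) two_ne_zero, fnorm_sq, fnorm_sq,
    Finset.sum_comm]
  simp only [Matrix.conjTranspose_apply, norm_star]

theorem fnorm_mul_unitary {U : Op Q} (hU : U * Uᴴ = 1) (A : Op Q) : fnorm (A * U) = fnorm A := by
  rw [← fnorm_conjTranspose, Matrix.conjTranspose_mul, fnorm_unitary_mul, fnorm_conjTranspose]
  rwa [Matrix.conjTranspose_conjTranspose]

theorem norm_app_sq (A : Op Q) (ψ : QState Q) : ‖A.app ψ‖ ^ 2 = ∑ y, ‖∑ x, A y x * ψ x‖ ^ 2 := by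
  rw [EuclideanSpace.norm_sq_eq]
  rfl

theorem app_mul (A B : Op Q) (ψ : QState Q) : Op.app (A * B) ψ = A.app (B.app ψ) := by
  unfold Op.app
  rw [Matrix.toEuclideanLin_eq_toLin_orthonormal, Matrix.toLin_mul _
    (EuclideanSpace.basisFun (Basis Q) ℂ).toBasis _]
  rfl

theorem norm_unitary_app {U : Op Q} (hU : Uᴴ * U = 1) (ψ : QState Q) : ‖U.app ψ‖ = ‖ψ‖ := by
  have h : inner ℂ (U.app ψ) (U.app ψ) = inner ℂ ψ ψ := by
    unfold Op.app
    rw [← LinearMap.adjoint_inner_left, ← Matrix.toEuclideanLin_conjTranspose_eq_adjoint]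
    have := app_mul Uᴴ U ψ
    unfold Op.app at this
    rw [← this, hU]
    simp [Matrix.toEuclideanLin]
  rw [← pow_left_inj₀ (norm_nonneg _) (norm_nonneg _) two_ne_zero]
  rw [inner_self_eq_norm_sq_to_K, inner_self_eq_norm_sq_to_K] at h
  exact_mod_cast h

end Frobenius

theorem norm_withAncilla {n : ℕ} (a : ℕ) (ψ : QState (Fin n)) : ‖withAncilla a ψ‖ = ‖ψ‖ := by
  rw [← pow_left_inj₀ (norm_nonneg _) (norm_nonneg _) two_ne_zero, EuclideanSpace.norm_sq_eq,
    EuclideanSpace.norm_sq_eq]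
  have h : ∀ z, ‖withAncilla a ψ z‖ ^ 2 =
      if ∀ j : Fin a, z (Sum.inr j) = 0 then ‖ψ fun i => z (Sum.inl i)‖ ^ 2 else 0 := by
    intro z
    have h3 : withAncilla a ψ z =
      if ∀ j : Fin a, z (Sum.inr j) = 0 then ψ (fun i => z (Sum.inl i)) else 0 := rfl
    rw [h3]
    split_ifs <;> simp
  simp only [h]
  exact sum_if_zeros fun z => ‖ψ fun i => z (Sum.inl i)‖ ^ 2

theorem withAncilla_sub {n : ℕ} (a : ℕ) (ψ φ : QState (Fin n)) :
    withAncilla a ψ - withAncilla a φ = withAncilla a (ψ - φ) := by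
  ext z
  simp only [withAncilla, PiLp.sub_apply]
  split_ifs <;> simp

/-! ## Averaging over the Weyl–Heisenberg group -/

theorem sum_fin_eq_sum_outVal {M : Type*} [AddCommMonoid M] {n : ℕ} (f : ℕ → M) :
    ∑ r : Fin (2 ^ n), f r.val = ∑ w : Basis (Fin n), f (outVal 0 n w) := by
  rw [← Equiv.sum_comp (finFunctionFinEquiv (m := 2) (n := n))]
  refine Finset.sum_congr rfl fun w _ => ?_
  rw [outVal_eq_outE, outE_eq_finFunctionFinEquiv]

/-- Parseval's identity for the QFT. -/
theorem sum_norm_sq_phases {n : ℕ} (v : Basis (Fin n) → ℂ) :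
    ∑ r : Fin (2 ^ n), ‖∑ x, v x * ee ((r.val : ℝ) * inVal 0 n x / 2 ^ n)‖ ^ 2 =
      2 ^ n * ∑ x, ‖v x‖ ^ 2 := by
  have hU := norm_unitary_app (realizes_qft n).conjTranspose_mul_self (WithLp.toLp 2 v)
  have h2 : ‖(qft n).app (WithLp.toLp 2 v)‖ ^ 2 = ∑ x, ‖v x‖ ^ 2 := by
    rw [hU, EuclideanSpace.norm_sq_eq]
  rw [sum_fin_eq_sum_outVal fun r => ‖∑ x, v x * ee ((r : ℝ) * inVal 0 n x / 2 ^ n)‖ ^ 2, ← h2,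
    norm_app_sq, Finset.mul_sum]
  refine Finset.sum_congr rfl fun w _ => ?_
  have hs : (∑ x, qft n w x * v x) =
      (∑ x, v x * ee ((outVal 0 n w : ℝ) * inVal 0 n x / 2 ^ n)) / (Real.sqrt (2 ^ n) : ℂ) := by
    rw [Finset.sum_div]
    refine Finset.sum_congr rfl fun x _ => ?_
    rw [qft_apply, mul_comm (inVal 0 n x : ℝ)]
    ring
  have hs' : ∑ x, qft n w x * (WithLp.toLp 2 v : QState (Fin n)) x = ∑ x, qft n w x * v x := rfl
  rw [hs', hs, norm_div, div_pow, Complex.norm_real, Real.norm_eq_abs, sq_abs,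
    Real.sq_sqrt (by positivity)]
  field_simp

/-- As `r` varies, the shifts carry `x` to every basis label exactly once, so the entry runs through
the whole row `y` of `E`. -/
theorem sum_norm_sq_shifts {n : ℕ} (E : Op (Fin n)) (y x : Basis (Fin n)) :
    ∑ r : Fin (2 ^ n), ‖(E * shiftX n ^ r.val) y x‖ ^ 2 = ∑ w, ‖E y w‖ ^ 2 := by
  choose f hf hm using fun r : Fin (2 ^ n) => exists_maps_shiftX_pow r.val x
  have hcol : ∀ r, (E * shiftX n ^ r.val) y x = E y (f r) := by
    intro r
    rw [Matrix.mul_apply, Finset.sum_eq_single (f r), maps_iff.1 (hm r), if_pos rfl, mul_one]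
    · intro w _ hw
      rw [maps_iff.1 (hm r), if_neg hw, mul_zero]
    · simp
  have hinj : Function.Injective f := by
    intro r s h
    have := (hf r).symm.trans (h ▸ hf s)
    have := Nat.ModEq.add_left_cancel' _ this
    unfold Nat.ModEq at this
    rw [Nat.mod_eq_of_lt r.2, Nat.mod_eq_of_lt s.2] at this
    exact Fin.ext this
  have hbij : Function.Bijective f :=
    (Fintype.bijective_iff_injective_and_card f).2 ⟨hinj, by simp⟩
  simp only [hcol]
  exact hbij.sum_comp fun w => ‖E y w‖ ^ 2

/-- The one-design property. For fixed `r₁` and row `y`, Parseval over `r₂` leaves only the weights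
`‖ψ x‖ ^ 2`. Summation over `r₁` then makes the factor of each weight independent of `x`. -/
theorem sum_norm_weyl_sq {n : ℕ} (E : Op (Fin n)) (ψ : QState (Fin n)) :
    ∑ r₁ : Fin (2 ^ n), ∑ r₂ : Fin (2 ^ n), ‖Op.app (E * weyl n r₁.val r₂.val) ψ‖ ^ 2 =
      2 ^ n * (fnorm E ^ 2 * ‖ψ‖ ^ 2) := by
  have h1 : ∀ r₁ : Fin (2 ^ n), ∑ r₂ : Fin (2 ^ n), ‖Op.app (E * weyl n r₁.val r₂.val) ψ‖ ^ 2 =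
      2 ^ n * ∑ y, ∑ x, ‖(E * shiftX n ^ r₁.val) y x‖ ^ 2 * ‖ψ x‖ ^ 2 := by
    intro r₁
    simp only [norm_app_sq]
    rw [Finset.sum_comm, Finset.mul_sum]
    refine Finset.sum_congr rfl fun y _ => ?_
    have hp : ∑ x, ‖(E * shiftX n ^ r₁.val) y x‖ ^ 2 * ‖ψ x‖ ^ 2 =
        ∑ x, ‖(E * shiftX n ^ r₁.val) y x * ψ x‖ ^ 2 :=
      Finset.sum_congr rfl fun x _ => by rw [norm_mul, mul_pow]
    rw [hp, ← sum_norm_sq_phases fun x => (E * shiftX n ^ r₁.val) y x * ψ x]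
    refine Finset.sum_congr rfl fun r₂ _ => ?_
    congr 2
    refine Finset.sum_congr rfl fun x _ => ?_
    rw [weyl, clockZ_pow, ← mul_assoc, pdiag, Matrix.mul_diagonal]
    ring
  simp only [h1]
  rw [← Finset.mul_sum, Finset.sum_comm, fnorm_sq, Finset.sum_mul]
  congr 1
  refine Finset.sum_congr rfl fun y _ => ?_
  rw [Finset.sum_comm, EuclideanSpace.norm_sq_eq, Finset.mul_sum]
  refine Finset.sum_congr rfl fun x _ => ?_
  rw [← Finset.sum_mul, sum_norm_sq_shifts]

theorem weyl_mem_unitary (n r₁ r₂ : ℕ) : (weyl n r₁ r₂)ᴴ * weyl n r₁ r₂ = 1 := by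
  have hX : (shiftX n ^ r₁)ᴴ * shiftX n ^ r₁ = 1 := by
    have h : shiftX n ^ r₁ = (qft n)ᴴ * (pdiag (fun y => (r₁ : ℝ) * outVal 0 n y / 2 ^ n) * qft n) := by
      rw [← qft_mul_shiftX_pow, ← mul_assoc, (realizes_qft n).conjTranspose_mul_self, one_mul]
    rw [h]
    exact ((realizes_qft n).conjTranspose.mul
      ((realizes_pdiag_outVal n r₁).mul (realizes_qft n))).conjTranspose_mul_self
  rw [weyl, Matrix.conjTranspose_mul, mul_assoc, ← mul_assoc (shiftX n ^ r₁)ᴴ, hX, one_mul, clockZ_pow]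
  exact (realizes_pdiag_inVal n r₂).conjTranspose_mul_self

/-- The conjugation fixes the exact QFT by the definition of `weylHat`, so the error operator is
just conjugated. -/
theorem conjugatedOQFT_sub_qft (n m r₁ r₂ : ℕ) : conjugatedOQFT n m r₁ r₂ - qft n =
    (weylHat n r₁ r₂)ᴴ * ((optimisticQFT n m - qft n) * weyl n r₁ r₂) := by
  have h : (weylHat n r₁ r₂)ᴴ * (qft n * weyl n r₁ r₂) = qft n := by
    rw [weylHat]
    simp only [Matrix.conjTranspose_mul, Matrix.conjTranspose_conjTranspose, mul_assoc]
    rw [← mul_assoc (qft n)ᴴ, (realizes_qft n).conjTranspose_mul_self, one_mul, weyl_mem_unitary,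
      mul_one]
  rw [sub_mul, mul_sub, h, conjugatedOQFT, mul_assoc]

theorem weylHat_unitary (n r₁ r₂ : ℕ) : ((weylHat n r₁ r₂)ᴴ)ᴴ * (weylHat n r₁ r₂)ᴴ = 1 := by
  have hW := mul_eq_one_comm.1 (weyl_mem_unitary n r₁ r₂)
  rw [Matrix.conjTranspose_conjTranspose, weylHat]
  simp only [Matrix.conjTranspose_mul, Matrix.conjTranspose_conjTranspose, mul_assoc]
  rw [← mul_assoc (qft n)ᴴ (qft n), (realizes_qft n).conjTranspose_mul_self, one_mul,
    ← mul_assoc (weyl n r₁ r₂), hW, one_mul, (realizes_qft n).mul_conjTranspose_self]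

/-- The expected error of the randomized optimistic QFT is the normalized Frobenius distance
between the optimistic and the exact QFT. -/
theorem expected_error_eq {n m a : ℕ} (c : Fin (2 ^ n) → Fin (2 ^ n) → Circuit (Fin n ⊕ Fin a))
    (hc : ∀ r₁ r₂, Implements (c r₁ r₂) (conjugatedOQFT n m r₁.val r₂.val)) (ψ : QState (Fin n)) :
    (∑ r₁ : Fin (2 ^ n), ∑ r₂ : Fin (2 ^ n), ‖(c r₁ r₂).op.app (withAncilla a ψ)
      - withAncilla a ((qft n).app ψ)‖ ^ 2) / ((2 : ℝ) ^ n) ^ 2 =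
      fnorm (optimisticQFT n m - qft n) ^ 2 * ‖ψ‖ ^ 2 / 2 ^ n := by
  have h : ∀ r₁ r₂ : Fin (2 ^ n), ‖(c r₁ r₂).op.app (withAncilla a ψ)
      - withAncilla a ((qft n).app ψ)‖ ^ 2 =
      ‖Op.app ((optimisticQFT n m - qft n) * weyl n r₁.val r₂.val) ψ‖ ^ 2 := by
    intro r₁ r₂
    have hs : (conjugatedOQFT n m r₁.val r₂.val).app ψ - (qft n).app ψ =
        Op.app (conjugatedOQFT n m r₁.val r₂.val - qft n) ψ := by
      unfold Op.app
      rw [map_sub, LinearMap.sub_apply]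
    rw [hc r₁ r₂ ψ, withAncilla_sub, norm_withAncilla, hs, conjugatedOQFT_sub_qft, app_mul,
      norm_unitary_app (weylHat_unitary n r₁.val r₂.val)]
  simp only [h]
  rw [sum_norm_weyl_sq]
  field_simp

/-! ## Estimates for phases -/

theorem norm_ee_sub_ee (s t : ℝ) : ‖ee s - ee t‖ = ‖ee (s - t) - 1‖ := by
  have : ee s - ee t = (ee (s - t) - 1) * ee t := by
    rw [sub_mul, ← ee_add, sub_add_cancel, one_mul]
  rw [this, norm_mul, norm_ee, mul_one]

theorem norm_ee_sub_one (t : ℝ) : ‖ee t - 1‖ = 2 * |Real.sin (Real.pi * t)| := by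
  have h := Complex.norm_exp_I_mul_ofReal_sub_one (2 * Real.pi * t)
  have h2 : ee t = Complex.exp (Complex.I * ((2 * Real.pi * t : ℝ) : ℂ)) := by
    rw [ee]; congr 1; push_cast; ring
  rw [h2, h, norm_mul, Real.norm_eq_abs, Real.norm_eq_abs, abs_two]
  congr 3; ring

theorem norm_ee_sub_one_le (t : ℝ) : ‖ee t - 1‖ ≤ 2 * Real.pi * |t| := by
  rw [norm_ee_sub_one]
  have h := Real.abs_sin_le_abs (x := Real.pi * t)
  rw [abs_mul, abs_of_pos Real.pi_pos] at h
  linarith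

theorem norm_ee_sub_ee_le (s t : ℝ) : ‖ee s - ee t‖ ≤ 2 * Real.pi * |s - t| := by
  rw [norm_ee_sub_ee]; exact norm_ee_sub_one_le _

theorem norm_ee_sub_ee_le_two (s t : ℝ) : ‖ee s - ee t‖ ≤ 2 := by
  refine (norm_sub_le _ _).trans ?_
  rw [norm_ee, norm_ee]; norm_num

theorem le_norm_ee_sub_one_of_le_half {t : ℝ} (h0 : 0 ≤ t) (h : t ≤ 1 / 2) :
    4 * t ≤ ‖ee t - 1‖ := by
  rw [norm_ee_sub_one]
  have h1 := Real.mul_le_sin (x := Real.pi * t) (by positivity)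
    (by nlinarith [Real.pi_pos])
  have h2 : 2 / Real.pi * (Real.pi * t) = 2 * t := by field_simp
  rw [h2] at h1
  have := le_abs_self (Real.sin (Real.pi * t))
  linarith

theorem norm_ee_neg_sub_one (t : ℝ) : ‖ee (-t) - 1‖ = ‖ee t - 1‖ := by
  rw [norm_ee_sub_one, norm_ee_sub_one, mul_neg, Real.sin_neg, abs_neg]

theorem norm_ee_one_sub_sub_one (t : ℝ) : ‖ee (1 - t) - 1‖ = ‖ee t - 1‖ := by
  have h := ee_add_intCast (-t) 1
  rw [Int.cast_one] at h
  rw [show 1 - t = -t + 1 by ring, h, norm_ee_neg_sub_one]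

/-- Away from the ends of the interval `[0, M)`, a phase that varies slowly on this interval is
controlled by the periodic phase. -/
theorem norm_phase_sub_sq_le {M J X X' : ℕ} (hM : 0 < M) (hJ : 0 < J) {α : ℝ} (hα : 0 ≤ α)
    (hα' : α ≤ 1 / M) (hX : X < M) (hX' : X' < M) :
    ‖ee (X' * α) - ee (X * α)‖ ^ 2 ≤ 4 * (if X < J ∨ M - J ≤ X then 1 else 0) +
      ((M : ℝ) ^ 2 / (4 * J ^ 2) + Real.pi ^ 2 / 4) * ‖ee (((X' : ℝ) - X) / M) - 1‖ ^ 2 := by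
  have hM' : (0 : ℝ) < M := by exact_mod_cast hM
  have hJ' : (0 : ℝ) < J := by exact_mod_cast hJ
  -- `D` is the distance on the line. The last alternative records on which side of `X` there is
  -- room for it, since `X'` lies in the same interval.
  obtain ⟨D, hD, hsym⟩ : ∃ D : ℕ, |(X' : ℝ) - X| = D ∧
      ‖ee (((X' : ℝ) - X) / M) - 1‖ = ‖ee ((D : ℝ) / M) - 1‖ ∧ D < M ∧
      (D ≤ X ∨ X + D < M) := by
    rcases le_total X X' with h | h
    · refine ⟨X' - X, ?_, ?_, by omega, by omega⟩
      · rw [Nat.cast_sub h, abs_of_nonneg]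
        have : (X : ℝ) ≤ X' := by exact_mod_cast h
        linarith
      · rw [Nat.cast_sub h]
    · refine ⟨X - X', ?_, ?_, by omega, by omega⟩
      · rw [Nat.cast_sub h, abs_sub_comm, abs_of_nonneg]
        have : (X' : ℝ) ≤ X := by exact_mod_cast h
        linarith
      · rw [Nat.cast_sub h, ← norm_ee_neg_sub_one]
        congr 3; ring
  obtain ⟨hsym, hDM, hDX⟩ := hsym
  rw [hsym]
  set E := ‖ee ((D : ℝ) / M) - 1‖ with hE
  have hE0 : 0 ≤ E := norm_nonneg _
  have hDM' : (D : ℝ) < M := by exact_mod_cast hDM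
  have hD0 : (0 : ℝ) ≤ D := Nat.cast_nonneg _
  have hpi := Real.pi_pos
  have hκ1 : 0 ≤ (M : ℝ) ^ 2 / (4 * J ^ 2) * E ^ 2 := by positivity
  have hκ2 : 0 ≤ Real.pi ^ 2 / 4 * E ^ 2 := by positivity
  have hb : (0 : ℝ) ≤ 4 * (if X < J ∨ M - J ≤ X then 1 else 0) := by split_ifs <;> norm_num
  rcases le_or_gt (2 * D) M with h2 | h2
  · have h2' : (2 : ℝ) * D ≤ M := by exact_mod_cast h2
    have h3 : ‖ee (X' * α) - ee (X * α)‖ ≤ Real.pi / 2 * E := by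
      refine (norm_ee_sub_ee_le _ _).trans ?_
      rw [← sub_mul, abs_mul, hD, abs_of_nonneg hα]
      have h4 : 4 * ((D : ℝ) / M) ≤ E := le_norm_ee_sub_one_of_le_half (by positivity)
        (by rw [div_le_div_iff₀ hM' two_pos]; linarith)
      have h5 : (D : ℝ) * α ≤ D / M := by
        rw [div_eq_mul_one_div]; exact mul_le_mul_of_nonneg_left hα' hD0
      nlinarith
    have h4 : ‖ee (X' * α) - ee (X * α)‖ ^ 2 ≤ (Real.pi / 2 * E) ^ 2 :=
      pow_le_pow_left₀ (norm_nonneg _) h3 2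
    nlinarith
  · have h4 : ‖ee (X' * α) - ee (X * α)‖ ^ 2 ≤ 2 ^ 2 :=
      pow_le_pow_left₀ (norm_nonneg _) (norm_ee_sub_ee_le_two _ _) 2
    by_cases hbad : X < J ∨ M - J ≤ X
    · rw [if_pos hbad]
      linarith
    -- Here `X` is at distance at least `J` from both ends, so `M - D ≥ J`. Even the cyclic distance
    -- is then at least `J`, and the periodic phase difference absorbs the trivial bound `4`.
    · rw [not_or, not_lt, not_le] at hbad
      have h2' : (M : ℝ) < 2 * D := by exact_mod_cast h2
      have hJD : (J : ℝ) + D ≤ M := by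
        have : J + D ≤ M := by omega
        exact_mod_cast this
      have h5 : 4 * (J / M) ≤ E := by
        rw [hE, ← norm_ee_one_sub_sub_one]
        have h6 : 1 - (D : ℝ) / M = (M - D) / M := by field_simp
        rw [h6]
        refine le_trans ?_ (le_norm_ee_sub_one_of_le_half (by apply div_nonneg <;> linarith)
          (by rw [div_le_div_iff₀ hM' two_pos]; linarith))
        gcongr
        linarith
      have h6 : 4 ≤ (M : ℝ) ^ 2 / (4 * J ^ 2) * E ^ 2 := by
        calc (4 : ℝ) = (M : ℝ) ^ 2 / (4 * J ^ 2) * (4 * (J / M)) ^ 2 := by field_simp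
          _ ≤ _ := by gcongr
      nlinarith

/-! ## Counting basis states -/

theorem card_filter_const {n : ℕ} (T : Finset (Fin n)) (b : Fin 2) :
    (Finset.univ.filter fun x : Basis (Fin n) => ∀ k ∈ T, x k = b).card * 2 ^ T.card = 2 ^ n := by
  have h : (Finset.univ.filter fun x : Basis (Fin n) => ∀ k ∈ T, x k = b) =
      Fintype.piFinset fun k => if k ∈ T then {b} else Finset.univ := by
    ext x
    simp only [Finset.mem_filter, Finset.mem_univ, true_and, Fintype.mem_piFinset]
    refine forall_congr' fun k => ?_
    by_cases hk : k ∈ T <;> simp [hk]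
  rw [h, Fintype.card_piFinset]
  have h2 : (2 : ℕ) ^ T.card = ∏ k : Fin n, if k ∈ T then 2 else 1 := by
    rw [Finset.prod_ite_mem, Finset.univ_inter, Finset.prod_const]
  rw [h2, ← Finset.prod_mul_distrib]
  have h3 : ∀ k : Fin n, (if k ∈ T then {b} else Finset.univ : Finset (Fin 2)).card *
      (if k ∈ T then 2 else 1) = 2 := by
    intro k
    by_cases hk : k ∈ T <;> simp [hk]
  simp only [h3, Finset.prod_const, Finset.card_univ, Fintype.card_fin]

theorem card_segS {n a b : ℕ} (h : b ≤ n) : (segS n a b).card = b - a := by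
  have : segS n a b = Finset.univ.map ⟨seg a b h, seg_injective h⟩ := by
    ext k
    rw [mem_segS, ← exists_seg_eq h]
    simp [eq_comm]
  rw [this, Finset.card_map, Finset.card_univ, Fintype.card_fin]

theorem eq_zero_of_outE_eq_zero {Q : Type} [Fintype Q] [DecidableEq Q] {k : ℕ} {e : Fin k → Q}
    {z : Basis Q} (h : outE e z = 0) (j : Fin k) : z (e j) = 0 :=
  eq_of_outE_eq (z' := fun _ => 0) (h.trans (by simp [outE])) j

theorem eq_one_of_outE_add_one {Q : Type} [Fintype Q] [DecidableEq Q] {k : ℕ} {e : Fin k → Q}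
    {z : Basis Q} (h : outE e z + 1 = 2 ^ k) (j : Fin k) : z (e j) = 1 := by
  have h1 := outL_flip_add (List.ofFn e) z (f := fun q => z q + 1) fun _ _ => rfl
  rw [outL_ofFn, outL_ofFn, List.length_ofFn] at h1
  have h2 := eq_zero_of_outE_eq_zero (show outE e (fun q => z q + 1) = 0 by omega) j
  generalize z (e j) = b at h2
  fin_cases b
  · simp at h2
  · rfl

theorem inVal_zero_iff {n a b : ℕ} (h : b ≤ n) {x : Basis (Fin n)} (hx : inVal a b x = 0) :
    ∀ k ∈ segS n a b, x k = 0 := by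
  intro k hk
  rw [← inE_seg h, ← outE_comp_rev] at hx
  obtain ⟨j, rfl⟩ := (exists_seg_eq h).2 (mem_segS.1 hk)
  simpa using eq_zero_of_outE_eq_zero hx (Fin.rev j)

theorem inVal_max {n a b : ℕ} (h : b ≤ n) {x : Basis (Fin n)} (hx : inVal a b x + 1 = 2 ^ (b - a)) :
    ∀ k ∈ segS n a b, x k = 1 := by
  intro k hk
  rw [← inE_seg h, ← outE_comp_rev] at hx
  obtain ⟨j, rfl⟩ := (exists_seg_eq h).2 (mem_segS.1 hk)
  simpa using eq_one_of_outE_add_one hx (Fin.rev j)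

theorem outVal_max {n a b : ℕ} (h : b ≤ n) {x : Basis (Fin n)} (hx : outVal a b x + 1 = 2 ^ (b - a)) :
    ∀ k ∈ segS n a b, x k = 1 := by
  intro k hk
  rw [← outE_seg h] at hx
  obtain ⟨j, rfl⟩ := (exists_seg_eq h).2 (mem_segS.1 hk)
  exact eq_one_of_outE_add_one hx j

theorem sum_indicator_le {n : ℕ} (T : Finset (Fin n)) (b : Fin 2) (p : Basis (Fin n) → Prop)
    [DecidablePred p] (hp : ∀ x, p x → ∀ k ∈ T, x k = b) :
    (∑ x : Basis (Fin n), if p x then (1 : ℝ) else 0) ≤ 2 ^ n / 2 ^ T.card := by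
  rw [Finset.sum_boole, le_div_iff₀ (by positivity)]
  have h1 := card_filter_const T b
  have h2 : (Finset.univ.filter p).card ≤
      (Finset.univ.filter fun x : Basis (Fin n) => ∀ k ∈ T, x k = b).card :=
    Finset.card_le_card fun x hx => by
      rw [Finset.mem_filter] at *
      exact ⟨hx.1, hp x hx.2⟩
  have h3 := (Nat.mul_le_mul_right (2 ^ T.card) h2).trans_eq h1
  exact_mod_cast h3

/-- A number of `3 * j` bits is this close to an end only if its top `j` bits are all `0` or all
`1`; each of these cases has frequency `2 ^ (-j)`. -/
theorem sum_near_ends_le {n a j : ℕ} (h : a + 3 * j ≤ n) :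
    (∑ x : Basis (Fin n), if inVal a (a + 3 * j) x < 2 ^ (2 * j) ∨
      2 ^ (3 * j) - 2 ^ (2 * j) ≤ inVal a (a + 3 * j) x then (1 : ℝ) else 0) ≤
      2 * (2 ^ n / 2 ^ j) := by
  have hcard : (segS n a (a + j)).card = j := by rw [card_segS (by omega)]; omega
  have hsplit : ∀ x : Basis (Fin n), inVal a (a + 3 * j) x =
      inVal a (a + j) x * 2 ^ (2 * j) + inVal (a + j) (a + 3 * j) x := by
    intro x
    rw [inVal_split (b := a + j) (by omega) (by omega)]
    congr 3; omega
  have hlt : ∀ x : Basis (Fin n), inVal (a + j) (a + 3 * j) x < 2 ^ (2 * j) := by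
    intro x
    have := inVal_lt h (a := a + j) x
    rwa [show a + 3 * j - (a + j) = 2 * j by omega] at this
  have hlt' : ∀ x : Basis (Fin n), inVal a (a + j) x < 2 ^ j := by
    intro x
    have := inVal_lt (show a + j ≤ n by omega) (a := a) x
    rwa [show a + j - a = j by omega] at this
  have h1 := sum_indicator_le (segS n a (a + j)) 0
    (fun x : Basis (Fin n) => inVal a (a + 3 * j) x < 2 ^ (2 * j)) fun x hx => by
      refine inVal_zero_iff (by omega) ?_
      rw [hsplit] at hx
      by_contra hne
      have : 1 * 2 ^ (2 * j) ≤ inVal a (a + j) x * 2 ^ (2 * j) :=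
        Nat.mul_le_mul_right _ (Nat.one_le_iff_ne_zero.2 hne)
      omega
  have h2 := sum_indicator_le (segS n a (a + j)) 1
    (fun x : Basis (Fin n) => 2 ^ (3 * j) - 2 ^ (2 * j) ≤ inVal a (a + 3 * j) x) fun x hx => by
      refine inVal_max (by omega) ?_
      rw [show a + j - a = j by omega]
      rw [hsplit] at hx
      by_contra hne
      have h3 : inVal a (a + j) x + 2 ≤ 2 ^ j := by have := hlt' x; omega
      have h4 : (inVal a (a + j) x + 2) * 2 ^ (2 * j) ≤ 2 ^ j * 2 ^ (2 * j) :=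
        Nat.mul_le_mul_right _ h3
      rw [← pow_add, show j + 2 * j = 3 * j by ring, add_mul] at h4
      have := hlt x
      omega
  rw [hcard] at h1 h2
  refine le_trans ?_ ((add_le_add h1 h2).trans_eq (two_mul _).symm)
  rw [← Finset.sum_add_distrib]
  refine Finset.sum_le_sum fun x _ => ?_
  split_ifs <;> first | (exfalso; tauto) | norm_num

/-! ## The commutator of two phase rotations on overlapping blocks -/

theorem sum_col_norm_sq {Q : Type} [Fintype Q] [DecidableEq Q] {U : Op Q} (hU : Uᴴ * U = 1)
    (x : Basis Q) : ∑ y, ‖U y x‖ ^ 2 = 1 := by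
  have h := congrFun (congrFun hU x) x
  rw [Matrix.mul_apply, Matrix.one_apply_eq] at h
  have : ((∑ y, ‖U y x‖ ^ 2 : ℝ) : ℂ) = 1 := by
    rw [← h]
    push_cast
    refine Finset.sum_congr rfl fun y _ => ?_
    rw [Matrix.conjTranspose_apply, Complex.star_def, ← Complex.normSq_eq_conj_mul_self,
      Complex.normSq_eq_norm_sq]
    push_cast; rfl
  exact_mod_cast this

theorem pdiag_commutator_apply {Q : Type} [Fintype Q] [DecidableEq Q] (φ : Basis Q → ℝ) (S : Op Q)
    (y x : Basis Q) : (pdiag φ * S - S * pdiag φ) y x = (ee (φ y) - ee (φ x)) * S y x := by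
  rw [Matrix.sub_apply, pdiag, Matrix.diagonal_mul, Matrix.mul_diagonal]
  ring

/-- The commutator of a cyclic shift of a block with a slowly varying phase on this block. -/
theorem fnorm_shift_commutator_sq_le {n a b c : ℕ} (hab : a ≤ b) (hbc : b ≤ c) (hcn : c ≤ n)
    {T : Op (Fin n)} (hT : ∀ z z' : Basis (Fin n), (∀ q ∉ segS n a b, z' q = z q) →
      outVal a b z' ≡ outVal a b z + 1 [MOD 2 ^ (b - a)] → Maps T z z') :
    fnorm (phaseOn n a b c * T - T * phaseOn n a b c) ^ 2 ≤
      2 ^ n * (4 * Real.pi ^ 2 / (2 ^ (b - a)) ^ 2 + 4 / 2 ^ (b - a)) := by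
  set M : ℕ := 2 ^ (b - a) with hM
  have hMpos : 0 < M := by positivity
  have hMpos' : (0 : ℝ) < 2 ^ (b - a) := by positivity
  -- `T` has one nonzero entry per column. Along it the phase moves by at most `1 / M` turns, except
  -- in the fraction `1 / M` of columns where the block wraps around and only the bound `2` is
  -- available.
  have key : ∀ x : Basis (Fin n), ∑ y, ‖(phaseOn n a b c * T - T * phaseOn n a b c) y x‖ ^ 2 ≤
      4 * Real.pi ^ 2 / (2 ^ (b - a)) ^ 2 + 4 * (if outVal a b x + 1 = M then 1 else 0) := by
    intro x
    have hlt := outVal_lt (hbc.trans hcn) (a := a) x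
    obtain ⟨x', hx', ho⟩ := exists_outE_eq (seg_injective (hbc.trans hcn)) x
      (v := (outVal a b x + 1) % M) (Nat.mod_lt _ hMpos)
    rw [outE_seg] at ho
    have hoff : ∀ q ∉ segS n a b, x' q = x q := fun q hq => hx' q (by
      rw [notMem_qubitsOf]
      intro j hj
      exact hq (mem_segS.2 ((exists_seg_eq (hbc.trans hcn)).1 ⟨j, hj⟩)))
    have hmap := hT x x' hoff (ho ▸ Nat.mod_modEq _ _)
    rw [Finset.sum_eq_single x']
    · rw [phaseOn_eq_pdiag, pdiag_commutator_apply, maps_iff.1 hmap, if_pos rfl, mul_one]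
      have hin : inVal b c x' = inVal b c x := inVal_congr fun k hk => hoff k (by
        rw [mem_segS] at *; omega)
      rw [hin]
      have hβ : (inVal b c x : ℝ) / 2 ^ (c - a) ≤ 1 / 2 ^ (b - a) := by
        rw [div_le_div_iff₀ (by positivity) (by positivity), one_mul]
        have : (2 : ℝ) ^ (c - a) = 2 ^ (c - b) * 2 ^ (b - a) := by
          rw [← pow_add]; congr 1; omega
        rw [this]
        gcongr
        exact_mod_cast (inVal_lt hcn x).le
      split_ifs with h
      · have h1 := norm_ee_sub_ee_le_two ((inVal b c x : ℝ) * outVal a b x' / 2 ^ (c - a))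
          ((inVal b c x : ℝ) * outVal a b x / 2 ^ (c - a))
        have h2 := pow_le_pow_left₀ (norm_nonneg _) h1 2
        have h3 : 0 ≤ 4 * Real.pi ^ 2 / (2 ^ (b - a)) ^ 2 := by positivity
        linarith
      · have h1 := norm_ee_sub_ee_le ((inVal b c x : ℝ) * outVal a b x' / 2 ^ (c - a))
          ((inVal b c x : ℝ) * outVal a b x / 2 ^ (c - a))
        rw [ho, Nat.mod_eq_of_lt (by omega)] at h1 ⊢
        have h2 : (inVal b c x : ℝ) * ((outVal a b x + 1 : ℕ) : ℝ) / 2 ^ (c - a) -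
            (inVal b c x : ℝ) * outVal a b x / 2 ^ (c - a) = inVal b c x / 2 ^ (c - a) := by
          push_cast; ring
        rw [h2, abs_of_nonneg (by positivity)] at h1
        have h3 := h1.trans (mul_le_mul_of_nonneg_left hβ (by positivity))
        have h4 := pow_le_pow_left₀ (norm_nonneg _) h3 2
        refine h4.trans (le_of_eq ?_)
        rw [mul_zero, add_zero]
        field_simp
        norm_num
    · intro y _ hy
      rw [phaseOn_eq_pdiag, pdiag_commutator_apply, maps_iff.1 hmap, if_neg hy, mul_zero, norm_zero]
      norm_num
    · simp
  rw [fnorm_sq, Finset.sum_comm]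
  refine (Finset.sum_le_sum fun x _ => key x).trans ?_
  rw [Finset.sum_add_distrib, ← Finset.mul_sum, Finset.sum_const, Finset.card_univ]
  have hcard : Fintype.card (Basis (Fin n)) = 2 ^ n := by simp
  rw [hcard, nsmul_eq_mul]
  have h1 := sum_indicator_le (segS n a b) 1 (fun x : Basis (Fin n) => outVal a b x + 1 = M)
    fun x hx => outVal_max (hbc.trans hcn) hx
  rw [card_segS (hbc.trans hcn)] at h1
  push_cast
  calc _ ≤ (2 : ℝ) ^ n * (4 * Real.pi ^ 2 / (2 ^ (b - a)) ^ 2) + 4 * (2 ^ n / 2 ^ (b - a)) := by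
        gcongr
    _ = _ := by ring

/-- A phase rotation, seen in the Fourier basis of its first block, almost commutes with the phase
rotation on the preceding block. -/
theorem fnorm_phase_commutator_sq_le {n a' a c j : ℕ} (ha : a' ≤ a) (hbc : a + 3 * j ≤ c)
    (hcn : c ≤ n) :
    fnorm (phaseOn n a' a (a + 3 * j) * ((qftOn n a (a + 3 * j))ᴴ * (phaseOn n a (a + 3 * j) c *
      qftOn n a (a + 3 * j))) - ((qftOn n a (a + 3 * j))ᴴ * (phaseOn n a (a + 3 * j) c *
      qftOn n a (a + 3 * j))) * phaseOn n a' a (a + 3 * j)) ^ 2 ≤ 2 ^ n * (140 / 2 ^ j) := by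
  set b := a + 3 * j with hb
  have hba : b - a = 3 * j := by omega
  have hbn : b ≤ n := hbc.trans hcn
  set F := qftOn n a b with hF
  set P := phaseOn n a b c with hP
  set S := Fᴴ * (P * F) with hS
  have rF := realizes_qftOn (n := n) (a := a) hbn
  have rP := realizes_phaseOn (n := n) (show a ≤ b by omega) hbc hcn
  have rF' := rF.mono (segS_subset le_rfl hbc) le_rfl le_rfl
  have hU : Sᴴ * S = 1 := (rF'.conjTranspose.mul (rP.mul rF')).conjTranspose_mul_self
  have hSoff : ∀ y x : Basis (Fin n), S y x ≠ 0 → ∀ k ∉ segS n a b, y k = x k := by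
    intro y x h
    rw [hS, Matrix.mul_apply] at h
    obtain ⟨z, _, hz⟩ := Finset.exists_ne_zero_of_sum_ne_zero h
    have h1 := left_ne_zero_of_mul hz
    have h2 := right_ne_zero_of_mul hz
    rw [hP, phaseOn_eq_pdiag, pdiag, Matrix.diagonal_mul] at h2
    have h3 := right_ne_zero_of_mul h2
    rw [Matrix.conjTranspose_apply, star_ne_zero] at h1
    rw [hF, qftOn_apply] at h1 h3
    have h4 := (ite_ne_right_iff.1 h1).1
    have h5 := (ite_ne_right_iff.1 h3).1
    intro k hk
    rw [← h4 k hk, h5 k hk]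
  -- the periodic phase and its commutator with `S`
  set D : Op (Fin n) := pdiag fun x => -((1 : ℝ) * inVal a b x / 2 ^ (b - a)) with hD
  set T : Op (Fin n) := F * (D * Fᴴ) with hT
  have hTmaps : ∀ z z' : Basis (Fin n), (∀ q ∉ segS n a b, z' q = z q) →
      outVal a b z' ≡ outVal a b z + 1 [MOD 2 ^ (b - a)] → Maps T z z' := by
    intro z z' h h'
    rw [← outE_seg hbn, ← outE_seg hbn] at h'
    have := maps_qftE_conj (seg_injective hbn) (w := fun _ => 1) (fun _ _ => rfl) (z := z) (z' := z')
      (fun q hq => h q fun hq' => notMem_qubitsOf.1 hq _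
        ((exists_seg_eq hbn).2 (mem_segS.1 hq')).choose_spec) h'
    rw [hT, hF, hD, qftOn_eq_qftE hbn]
    simpa only [inE_seg, Nat.cast_one] using this
  -- Conjugation by `F` turns `D` into the shift `T` and `S` back into the diagonal `P`, without
  -- changing the norm.
  have hcomm : fnorm (D * S - S * D) = fnorm (P * T - T * P) := by
    have h1 : D * S - S * D = Fᴴ * ((T * P - P * T) * F) := by
      rw [hS, hT]
      simp only [sub_mul, mul_sub, mul_assoc]
      rw [← mul_assoc Fᴴ F, rF.conjTranspose_mul_self, one_mul]
      rw [mul_one]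
    have h2 : (Fᴴ)ᴴ * Fᴴ = 1 := by
      rw [Matrix.conjTranspose_conjTranspose, rF.mul_conjTranspose_self]
    rw [h1, fnorm_unitary_mul h2, fnorm_mul_unitary rF.mul_conjTranspose_self]
    rw [← pow_left_inj₀ (fnorm_nonneg _) (fnorm_nonneg _) two_ne_zero, fnorm_sq, fnorm_sq]
    refine Finset.sum_congr rfl fun y _ => Finset.sum_congr rfl fun x _ => ?_
    rw [Matrix.sub_apply, Matrix.sub_apply, norm_sub_rev]
  have hbound : fnorm (D * S - S * D) ^ 2 ≤ 2 ^ n * (44 / 2 ^ (3 * j)) := by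
    rw [hcomm]
    refine (fnorm_shift_commutator_sq_le (show a ≤ b by omega) hbc hcn hTmaps).trans ?_
    rw [hba]
    gcongr
    have h1 : (1 : ℝ) ≤ 2 ^ (3 * j) := one_le_pow₀ (by norm_num)
    have h2 : Real.pi ^ 2 ≤ 10 := by nlinarith [Real.pi_lt_d2, Real.pi_pos]
    rw [div_add_div _ _ (by positivity) (by positivity), div_le_div_iff₀ (by positivity) (by positivity)]
    nlinarith [mul_nonneg (sub_nonneg.2 h2) (show (0 : ℝ) ≤ 2 ^ (3 * j) * 2 ^ (3 * j) by positivity),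
      mul_nonneg (sub_nonneg.2 h1) (show (0 : ℝ) ≤ 2 ^ (3 * j) * 2 ^ (3 * j) by positivity),
      mul_nonneg (sub_nonneg.2 h2) (show (0 : ℝ) ≤ 2 ^ (3 * j) by positivity)]
  -- comparison of the slowly varying phase with the periodic phase
  set κ : ℝ := (2 ^ (3 * j)) ^ 2 / (4 * (2 ^ (2 * j)) ^ 2) + Real.pi ^ 2 / 4 with hκ
  have hκ0 : 0 ≤ κ := by positivity
  have hpt : ∀ y x : Basis (Fin n), ‖(phaseOn n a' a b * S - S * phaseOn n a' a b) y x‖ ^ 2 ≤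
      4 * (if inVal a b x < 2 ^ (2 * j) ∨ 2 ^ (3 * j) - 2 ^ (2 * j) ≤ inVal a b x then 1 else 0) *
        ‖S y x‖ ^ 2 + κ * ‖(D * S - S * D) y x‖ ^ 2 := by
    intro y x
    rw [phaseOn_eq_pdiag, pdiag_commutator_apply, hD, pdiag_commutator_apply]
    by_cases h0 : S y x = 0
    · simp [h0]
    have hoff := hSoff y x h0
    have hout : outVal a' a y = outVal a' a x := outVal_congr fun k hk => hoff k (by
      rw [mem_segS] at *; omega)
    rw [hout, norm_mul, norm_mul, mul_pow, mul_pow, ← mul_assoc, ← add_mul]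
    refine mul_le_mul_of_nonneg_right ?_ (by positivity)
    have hXy := inVal_lt hbn (a := a) y
    have hXx := inVal_lt hbn (a := a) x
    rw [hba] at hXy hXx
    set α : ℝ := (outVal a' a x : ℝ) / 2 ^ (b - a') with hα
    have hα' : α ≤ 1 / ((2 ^ (3 * j) : ℕ) : ℝ) := by
      push_cast
      rw [hα, div_le_div_iff₀ (by positivity) (by positivity), one_mul]
      have : (2 : ℝ) ^ (b - a') = 2 ^ (a - a') * 2 ^ (3 * j) := by
        rw [← pow_add]; congr 1; omega
      rw [this]
      gcongr
      exact_mod_cast (outVal_lt (show a ≤ n by omega) x).le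
    have key := norm_phase_sub_sq_le (M := 2 ^ (3 * j)) (J := 2 ^ (2 * j)) (X := inVal a b x)
      (X' := inVal a b y) (by positivity) (by positivity) (α := α) (by positivity) hα' hXx hXy
    have e1 : (inVal a b y : ℝ) * outVal a' a x / 2 ^ (b - a') = inVal a b y * α := by
      rw [hα]; ring
    have e2 : (inVal a b x : ℝ) * outVal a' a x / 2 ^ (b - a') = inVal a b x * α := by
      rw [hα]; ring
    have e3 : ‖ee (((inVal a b y : ℝ) - inVal a b x) / ((2 ^ (3 * j) : ℕ) : ℝ)) - 1‖ =
        ‖ee (-((1 : ℝ) * inVal a b y / 2 ^ (b - a))) - ee (-((1 : ℝ) * inVal a b x / 2 ^ (b - a)))‖ := by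
      rw [norm_ee_sub_ee, ← norm_ee_neg_sub_one, hba]
      congr 3
      push_cast
      ring
    rw [e1, e2, ← e3, hκ]
    push_cast at key ⊢
    exact key
  have hκ3 : κ ≤ 3 * 2 ^ (2 * j) := by
    have h1 : ((2 : ℝ) ^ (3 * j)) ^ 2 / (4 * (2 ^ (2 * j)) ^ 2) = 2 ^ (2 * j) / 4 := by
      rw [div_eq_div_iff (by positivity) (by norm_num)]
      ring
    have h2 : Real.pi ^ 2 ≤ 10 := by nlinarith [Real.pi_lt_d2, Real.pi_pos]
    have h3 : (1 : ℝ) ≤ 2 ^ (2 * j) := one_le_pow₀ (by norm_num)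
    rw [hκ, h1]
    linarith
  have hsum : fnorm (phaseOn n a' a b * S - S * phaseOn n a' a b) ^ 2 ≤
      4 * (2 * (2 ^ n / 2 ^ j)) + κ * fnorm (D * S - S * D) ^ 2 := by
    rw [fnorm_sq]
    refine (Finset.sum_le_sum fun y _ => Finset.sum_le_sum fun x _ => hpt y x).trans ?_
    simp only [Finset.sum_add_distrib, ← Finset.mul_sum]
    rw [← fnorm_sq]
    refine add_le_add_left ?_ _
    rw [Finset.sum_comm]
    simp only [← Finset.mul_sum, sum_col_norm_sq hU, mul_one]
    exact mul_le_mul_of_nonneg_left (sum_near_ends_le hbn) (by norm_num)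
  refine hsum.trans ?_
  generalize fnorm (D * S - S * D) ^ 2 = G at hbound
  have h0 : κ * G ≤ (3 * 2 ^ (2 * j)) * (2 ^ n * (44 / 2 ^ (3 * j))) :=
    (mul_le_mul_of_nonneg_left hbound hκ0).trans
      (mul_le_mul_of_nonneg_right hκ3 (by positivity))
  have h1 : 4 * (2 * ((2 : ℝ) ^ n / 2 ^ j)) + (3 * 2 ^ (2 * j)) * (2 ^ n * (44 / 2 ^ (3 * j))) =
      2 ^ n * (140 / 2 ^ j) := by
    have : (2 : ℝ) ^ (3 * j) = 2 ^ (2 * j) * 2 ^ j := by rw [← pow_add]; congr 1; ring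
    rw [this]
    field_simp
    ring
  linarith

/-! ## Telescoping over the blocks -/

theorem commute_conjTranspose_right {Q : Type} [Fintype Q] [DecidableEq Q] {A U : Op Q}
    (h : Commute A U) (hU : U ∈ unitaryGroup (Basis Q) ℂ) : Commute A Uᴴ := by
  have h1 : Uᴴ * U = 1 := mem_unitaryGroup_iff'.1 hU
  have h2 : U * Uᴴ = 1 := mem_unitaryGroup_iff.1 hU
  calc A * Uᴴ = Uᴴ * (U * A) * Uᴴ := by rw [← mul_assoc Uᴴ, h1, one_mul]
    _ = Uᴴ * A := by rw [← h.eq, mul_assoc, mul_assoc, h2, mul_one]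

/-- The Fourier transform on block `i`. -/
def blockQFT (n m i : ℕ) : Op (Fin n) := qftOn n (blockStart n m i) (blockStart n m (i + 1))

/-- The phase rotation between the blocks `i` and `i + 1`. -/
def blockPhase (n m i : ℕ) : Op (Fin n) :=
  phaseOn n (blockStart n m i) (blockStart n m (i + 1)) (blockStart n m (i + 2))

theorem exists_realizes_blockQFT (n m i : ℕ) : ∃ d g,
    Realizes (segS n (blockStart n m i) (blockStart n m (i + 1))) d g (blockQFT n m i) :=
  ⟨_, _, realizes_qftOn (blockStart_le n m _)⟩

theorem exists_realizes_blockPhase (n m i : ℕ) : ∃ d g,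
    Realizes (segS n (blockStart n m i) (blockStart n m (i + 2))) d g (blockPhase n m i) :=
  ⟨_, _, realizes_phaseOn (blockStart_mono n m (by omega)) (blockStart_mono n m (by omega))
    (blockStart_le n m _)⟩

theorem commute_blockQFT (n m : ℕ) {i k : ℕ} (h : k < i) :
    Commute (blockQFT n m i) (blockQFT n m k) :=
  have ⟨_, _, h₁⟩ := exists_realizes_blockQFT n m k
  have ⟨_, _, h₂⟩ := exists_realizes_blockQFT n m i
  (h₁.commute h₂ (segS_disjoint (blockStart_mono n m h))).symm

theorem commute_blockPhase_blockQFT (n m : ℕ) {i k : ℕ} (h : k < i) :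
    Commute (blockPhase n m i) (blockQFT n m k) :=
  have ⟨_, _, h₁⟩ := exists_realizes_blockQFT n m k
  have ⟨_, _, h₂⟩ := exists_realizes_blockPhase n m i
  (h₁.commute h₂ (segS_disjoint (blockStart_mono n m h))).symm

theorem commute_blockQFT_blockPhase (n m : ℕ) {i k : ℕ} (h : k + 1 < i) :
    Commute (blockQFT n m i) (blockPhase n m k) :=
  have ⟨_, _, h₁⟩ := exists_realizes_blockPhase n m k
  have ⟨_, _, h₂⟩ := exists_realizes_blockQFT n m i
  (h₁.commute h₂ (segS_disjoint (blockStart_mono n m h))).symm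

theorem commute_blockPhase (n m i k : ℕ) : Commute (blockPhase n m i) (blockPhase n m k) := by
  rw [blockPhase, blockPhase, phaseOn_eq_pdiag, phaseOn_eq_pdiag]
  exact pdiag_commute _ _

/-- The product of the operators of parity `p` among the first `k` members of a family. -/
def parityProd {n : ℕ} (A : ℕ → Op (Fin n)) (k p : ℕ) : Op (Fin n) :=
  (((List.range k).filter fun i => i % 2 = p).map A).prod

theorem parityProd_zero {n : ℕ} (A : ℕ → Op (Fin n)) (p : ℕ) : parityProd A 0 p = 1 := rfl

theorem parityProd_succ {n : ℕ} (A : ℕ → Op (Fin n)) (k p : ℕ) :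
    parityProd A (k + 1) p = parityProd A k p * if k % 2 = p then A k else 1 := by
  unfold parityProd
  rw [List.range_succ, List.filter_append, List.map_append, List.prod_append]
  by_cases h : k % 2 = p <;> simp [h]

theorem commute_parityProd {n : ℕ} {A : ℕ → Op (Fin n)} {B : Op (Fin n)} {k : ℕ} (p : ℕ)
    (h : ∀ i < k, Commute B (A i)) : Commute B (parityProd A k p) := by
  refine Commute.list_prod_right _ _ fun x hx => ?_
  obtain ⟨i, hi, rfl⟩ := List.mem_map.1 hx
  exact h i (List.mem_range.1 (List.mem_filter.1 hi).1)

theorem parityProd_mem_unitaryGroup {n : ℕ} {A : ℕ → Op (Fin n)}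
    (h : ∀ i, A i ∈ unitaryGroup (Basis (Fin n)) ℂ) (k p : ℕ) :
    parityProd A k p ∈ unitaryGroup (Basis (Fin n)) ℂ := by
  refine list_prod_mem fun x hx => ?_
  obtain ⟨i, -, rfl⟩ := List.mem_map.1 hx
  exact h i

/-- The optimistic QFT on the blocks `0, …, t`. -/
def partialOQFT (n m t : ℕ) : Op (Fin n) :=
  parityProd (blockQFT n m) (t + 1) 0 * parityProd (blockPhase n m) t 1 *
    (parityProd (blockQFT n m) (t + 1) 1 * (parityProd (blockQFT n m) (t + 1) 0)ᴴ) *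
    parityProd (blockPhase n m) t 0 * parityProd (blockQFT n m) (t + 1) 0

theorem blockQFT_mem_unitaryGroup (n m i : ℕ) :
    blockQFT n m i ∈ unitaryGroup (Basis (Fin n)) ℂ :=
  have ⟨_, _, h⟩ := exists_realizes_blockQFT n m i
  h.mem_unitaryGroup

theorem blockPhase_mem_unitaryGroup (n m i : ℕ) :
    blockPhase n m i ∈ unitaryGroup (Basis (Fin n)) ℂ :=
  have ⟨_, _, h⟩ := exists_realizes_blockPhase n m i
  h.mem_unitaryGroup

theorem partialOQFT_zero (n m : ℕ) : partialOQFT n m 0 = qftOn n 0 (blockStart n m 1) := by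
  have h := mem_unitaryGroup_iff'.1 (blockQFT_mem_unitaryGroup n m 0)
  rw [Matrix.star_eq_conjTranspose] at h
  simp only [partialOQFT, parityProd_succ, parityProd_zero]
  simp only [Nat.zero_mod, zero_ne_one, if_true, if_false, one_mul, mul_one, mul_assoc, h]
  simp [blockQFT, blockStart]

/-- Appending a block of even index is exact. -/
theorem partialOQFT_succ_of_odd {n m t : ℕ} (ht : t % 2 = 1) :
    partialOQFT n m (t + 1) = blockQFT n m (t + 1) * (blockPhase n m t * partialOQFT n m t) := by
  have e1 : (t + 1) % 2 = 0 := by omega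
  unfold partialOQFT
  rw [parityProd_succ _ (t + 1), parityProd_succ _ (t + 1), parityProd_succ (blockPhase n m) t,
    parityProd_succ (blockPhase n m) t, if_pos e1, if_neg (by omega : ¬(t + 1) % 2 = 1), if_pos ht,
    if_neg (by omega : ¬t % 2 = 0),
    mul_one, mul_one, parityProd_succ _ t 0, if_neg (by omega), mul_one]
  have c1 : Commute (blockQFT n m (t + 1)) (parityProd (blockQFT n m) t 0) :=
    commute_parityProd _ fun i hi => commute_blockQFT n m (by omega)
  have c2 : Commute (blockQFT n m (t + 1)) (parityProd (blockQFT n m) (t + 1) 1) :=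
    commute_parityProd _ fun i hi => commute_blockQFT n m (by omega)
  have c3 : Commute (blockQFT n m (t + 1)) (parityProd (blockPhase n m) t 0) :=
    commute_parityProd _ fun i hi => commute_blockQFT_blockPhase n m (by omega)
  have d1 : Commute (blockPhase n m t) (parityProd (blockQFT n m) t 0) :=
    commute_parityProd _ fun i hi => commute_blockPhase_blockQFT n m hi
  have d2 : Commute (blockPhase n m t) (parityProd (blockPhase n m) t 1) :=
    commute_parityProd _ fun i hi => commute_blockPhase n m _ _
  have hF := blockQFT_mem_unitaryGroup n m (t + 1)
  have hU : (blockQFT n m (t + 1))ᴴ * blockQFT n m (t + 1) = 1 := mem_unitaryGroup_iff'.1 hF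
  have c4 := commute_conjTranspose_right c1 (parityProd_mem_unitaryGroup
    (blockQFT_mem_unitaryGroup n m) t 0)
  rw [Matrix.conjTranspose_mul]
  simp only [mul_assoc]
  rw [← c1.eq, ← c3.left_comm, ← c4.left_comm, ← mul_assoc (blockQFT n m (t + 1))ᴴ, hU, one_mul,
    ← c1.left_comm, d1.left_comm, d2.left_comm]

/-- Appending a block of odd index produces a commutator. -/
theorem partialOQFT_succ_of_even {n m t : ℕ} (ht : t % 2 = 0) :
    ∃ U W : Op (Fin n), U ∈ unitaryGroup (Basis (Fin n)) ℂ ∧ W ∈ unitaryGroup (Basis (Fin n)) ℂ ∧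
      partialOQFT n m (t + 1) - blockQFT n m (t + 1) * (blockPhase n m t * partialOQFT n m t) =
      U * (parityProd (blockPhase n m) t 1 *
          ((blockQFT n m t)ᴴ * (blockPhase n m t * blockQFT n m t)) -
        ((blockQFT n m t)ᴴ * (blockPhase n m t * blockQFT n m t)) *
          parityProd (blockPhase n m) t 1) * W := by
  have e1 : (t + 1) % 2 = 1 := by omega
  have hg := parityProd_mem_unitaryGroup (blockQFT_mem_unitaryGroup n m) t 0
  have ho := parityProd_mem_unitaryGroup (blockQFT_mem_unitaryGroup n m) t 1
  have hf := blockQFT_mem_unitaryGroup n m t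
  have hF := blockQFT_mem_unitaryGroup n m (t + 1)
  have hp := parityProd_mem_unitaryGroup (blockPhase_mem_unitaryGroup n m) t 0
  have cg : Commute (blockQFT n m (t + 1)) (parityProd (blockQFT n m) t 0) :=
    commute_parityProd _ fun i hi => commute_blockQFT n m (by omega)
  have cf : Commute (blockQFT n m (t + 1)) (blockQFT n m t) := commute_blockQFT n m (by omega)
  have co : Commute (blockQFT n m (t + 1)) (parityProd (blockQFT n m) t 1) :=
    commute_parityProd _ fun i hi => commute_blockQFT n m (by omega)
  have cp : Commute (blockQFT n m (t + 1)) (parityProd (blockPhase n m) t 1) :=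
    commute_parityProd _ fun i hi => commute_blockQFT_blockPhase n m (by omega)
  have dg : Commute (blockPhase n m t) (parityProd (blockQFT n m) t 0) :=
    commute_parityProd _ fun i hi => commute_blockPhase_blockQFT n m hi
  have do' : Commute (blockPhase n m t) (parityProd (blockQFT n m) t 1) :=
    commute_parityProd _ fun i hi => commute_blockPhase_blockQFT n m hi
  have dp : Commute (blockPhase n m t) (parityProd (blockPhase n m) t 0) :=
    commute_parityProd _ fun i hi => commute_blockPhase n m _ _
  have eo : Commute (blockQFT n m t) (parityProd (blockQFT n m) t 1) :=
    commute_parityProd _ fun i hi => commute_blockQFT n m hi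
  unfold partialOQFT
  rw [parityProd_succ _ (t + 1), parityProd_succ _ (t + 1), parityProd_succ (blockPhase n m) t,
    parityProd_succ (blockPhase n m) t, if_neg (by omega : ¬(t + 1) % 2 = 0), if_pos e1,
    if_neg (by omega : ¬t % 2 = 1), if_pos ht,
    mul_one, mul_one, parityProd_succ _ t 0, if_pos ht, parityProd_succ _ t 1, if_neg (by omega),
    mul_one, Matrix.conjTranspose_mul]
  generalize blockQFT n m (t + 1) = F at *
  generalize blockPhase n m t = P at *
  generalize blockQFT n m t = f at *
  generalize parityProd (blockQFT n m) t 0 = g at *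
  generalize parityProd (blockQFT n m) t 1 = o at *
  generalize parityProd (blockPhase n m) t 1 = p at *
  generalize parityProd (blockPhase n m) t 0 = q at *
  have hf1 : fᴴ * f = 1 := mem_unitaryGroup_iff'.1 hf
  have hf2 : f * fᴴ = 1 := mem_unitaryGroup_iff.1 hf
  have hf' : fᴴ ∈ unitaryGroup (Basis (Fin n)) ℂ := Unitary.star_mem hf
  have hg' : gᴴ ∈ unitaryGroup (Basis (Fin n)) ℂ := Unitary.star_mem hg
  have dg' := commute_conjTranspose_right dg hg
  have eo' : Commute o fᴴ := commute_conjTranspose_right eo.symm hf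
  refine ⟨F * (g * f), fᴴ * (o * (gᴴ * (q * (g * f)))), mul_mem hF (mul_mem hg hf),
    mul_mem hf' (mul_mem ho (mul_mem hg' (mul_mem hp (mul_mem hg hf)))), ?_⟩
  -- After commuting everything else out of the way, the two operators differ only in the order of
  -- `p`, the odd phases, and `fᴴ * (P * f)`, the new phase seen through the QFT of block `t`.
  have a1 : g * f * p * (o * F * (fᴴ * gᴴ)) * (q * P) * (g * f) =
      F * (g * f) * (p * (fᴴ * (P * f))) * (fᴴ * (o * (gᴴ * (q * (g * f))))) := by
    simp only [mul_assoc]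
    rw [← co.left_comm, ← cp.left_comm, ← cf.left_comm, ← cg.left_comm, ← dp.left_comm,
      ← dg'.left_comm, ← mul_assoc f fᴴ, hf2, one_mul, do'.left_comm, eo'.left_comm]
  have a2 : F * (P * (g * f * p * (o * (fᴴ * gᴴ)) * q * (g * f))) =
      F * (g * f) * ((fᴴ * (P * f)) * p) * (fᴴ * (o * (gᴴ * (q * (g * f))))) := by
    simp only [mul_assoc]
    rw [← mul_assoc f fᴴ, hf2, one_mul, dg.left_comm, eo'.left_comm]
  rw [a1, a2, mul_sub, sub_mul]

/-- Of the odd phases only the last one, between the blocks `t - 1` and `t`, touches block `t`; the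
earlier ones commute with everything here and factor out. The hypothesis `hn` makes block `t` a full
block of `3 * j` qubits. -/
theorem fnorm_parityProd_commutator_sq_le {n j t : ℕ} (ht : t % 2 = 0) (hn : 3 * j * (t + 1) ≤ n) :
    fnorm (parityProd (blockPhase n (3 * j)) t 1 *
          ((blockQFT n (3 * j) t)ᴴ * (blockPhase n (3 * j) t * blockQFT n (3 * j) t)) -
        ((blockQFT n (3 * j) t)ᴴ * (blockPhase n (3 * j) t * blockQFT n (3 * j) t)) *
          parityProd (blockPhase n (3 * j)) t 1) ^ 2 ≤ 2 ^ n * (140 / 2 ^ j) := by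
  obtain _ | u := t
  · rw [parityProd_zero, one_mul, mul_one, sub_self, fnorm_zero, zero_pow two_ne_zero]
    positivity
  · rw [parityProd_succ, if_pos (by omega)]
    have hq := parityProd_mem_unitaryGroup (blockPhase_mem_unitaryGroup n (3 * j)) u 1
    have c1 : Commute (blockQFT n (3 * j) (u + 1)) (parityProd (blockPhase n (3 * j)) u 1) :=
      commute_parityProd _ fun i hi => commute_blockQFT_blockPhase n _ (by omega)
    have c2 : Commute (blockPhase n (3 * j) (u + 1)) (parityProd (blockPhase n (3 * j)) u 1) :=
      commute_parityProd _ fun i hi => commute_blockPhase n _ _ _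
    have c3 := (commute_conjTranspose_right c1.symm (blockQFT_mem_unitaryGroup n (3 * j) (u + 1)))
    have c4 := (c2.symm.mul_right c1.symm)
    have c5 := c3.mul_right c4
    have h0 : blockStart n (3 * j) (u + 1) = 3 * j * (u + 1) :=
      min_eq_right ((Nat.mul_le_mul_left _ (by omega)).trans hn)
    have h1 : blockStart n (3 * j) (u + 1 + 1) = blockStart n (3 * j) (u + 1) + 3 * j := by
      rw [h0, blockStart, min_eq_right hn]; ring
    have key := fnorm_phase_commutator_sq_le (n := n) (a' := blockStart n (3 * j) u)
      (a := blockStart n (3 * j) (u + 1)) (c := blockStart n (3 * j) (u + 3)) (j := j)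
      (blockStart_mono _ _ (by omega)) (by rw [← h1]; exact blockStart_mono _ _ (by omega))
      (blockStart_le _ _ _)
    rw [← h1] at key
    have e : ∀ A S : Op (Fin n), Commute (parityProd (blockPhase n (3 * j)) u 1) S →
        parityProd (blockPhase n (3 * j)) u 1 * A * S -
          S * (parityProd (blockPhase n (3 * j)) u 1 * A) =
        parityProd (blockPhase n (3 * j)) u 1 * (A * S - S * A) := by
      intro A S h
      rw [← h.left_comm, mul_sub, mul_assoc]
    rw [e _ _ c5, fnorm_unitary_mul (mem_unitaryGroup_iff'.1 hq)]
    exact key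

/-- The exact recursion couples the new block to all earlier output bits. Those of block `t` are the
most significant ones, and dropping the others changes the angle by at most `2 ^ (-3 * j)` turns, on
every basis state. -/
theorem fnorm_blockPhase_sub_sq_le {n j t : ℕ} (hn : 3 * j * (t + 1) ≤ n) :
    fnorm (blockPhase n (3 * j) t - phaseOn n 0 (blockStart n (3 * j) (t + 1))
      (blockStart n (3 * j) (t + 2))) ^ 2 ≤ 2 ^ n * (40 / 2 ^ j) := by
  have h0 : blockStart n (3 * j) (t + 1) = blockStart n (3 * j) t + 3 * j := by
    rw [blockStart, blockStart, min_eq_right hn,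
      min_eq_right ((Nat.mul_le_mul_left _ (by omega)).trans hn)]
    ring
  have h1 := blockStart_mono n (3 * j) (show t + 1 ≤ t + 2 by omega)
  have h2 := blockStart_le n (3 * j) (t + 2)
  unfold blockPhase
  generalize blockStart n (3 * j) t = a at *
  generalize blockStart n (3 * j) (t + 1) = b at *
  generalize blockStart n (3 * j) (t + 2) = c at *
  have hcol : ∀ y x : Basis (Fin n), ‖(phaseOn n a b c - phaseOn n 0 b c) y x‖ ^ 2 ≤
      if y = x then 40 / 2 ^ j else 0 := by
    intro y x
    rw [phaseOn_eq_pdiag, phaseOn_eq_pdiag, Matrix.sub_apply, pdiag, pdiag]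
    split_ifs with h
    · subst h
      rw [Matrix.diagonal_apply_eq, Matrix.diagonal_apply_eq]
      have h3 := norm_ee_sub_ee_le ((inVal b c y : ℝ) * outVal a b y / 2 ^ (c - a))
        ((inVal b c y : ℝ) * outVal 0 b y / 2 ^ (c - 0))
      have h4 : (inVal b c y : ℝ) * outVal a b y / 2 ^ (c - a) -
          (inVal b c y : ℝ) * outVal 0 b y / 2 ^ (c - 0) =
          -((inVal b c y : ℝ) * outVal 0 a y / 2 ^ c) := by
        rw [outVal_split (Nat.zero_le a) (show a ≤ b by omega), Nat.sub_zero, Nat.sub_zero]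
        have : (2 : ℝ) ^ c = 2 ^ (c - a) * 2 ^ a := by rw [← pow_add]; congr 1; omega
        rw [this]
        push_cast
        field_simp
        ring
      have h5 : (inVal b c y : ℝ) * outVal 0 a y / 2 ^ c ≤ 1 / 2 ^ (3 * j) := by
        rw [div_le_div_iff₀ (by positivity) (by positivity), one_mul]
        have : (2 : ℝ) ^ c = 2 ^ (c - b) * 2 ^ (a - 0) * 2 ^ (3 * j) := by
          rw [← pow_add, ← pow_add]; congr 1; omega
        rw [this]
        gcongr
        · exact_mod_cast (inVal_lt h2 y).le
        · exact_mod_cast (outVal_lt (show a ≤ n by omega) y).le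
      rw [h4, abs_neg, abs_of_nonneg (by positivity)] at h3
      have h6 := pow_le_pow_left₀ (norm_nonneg _)
        (h3.trans (mul_le_mul_of_nonneg_left h5 (by positivity))) 2
      refine h6.trans ?_
      have h7 : Real.pi ^ 2 ≤ 10 := by nlinarith [Real.pi_lt_d2, Real.pi_pos]
      have h8 : (2 : ℝ) ^ j ≤ (2 ^ (3 * j)) ^ 2 := by
        rw [← pow_mul]; exact pow_le_pow_right₀ (by norm_num) (by omega)
      calc (2 * Real.pi * (1 / 2 ^ (3 * j))) ^ 2 = 4 * Real.pi ^ 2 / (2 ^ (3 * j)) ^ 2 := by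
            field_simp; norm_num
        _ ≤ 40 / 2 ^ j := by gcongr; linarith
    · rw [Matrix.diagonal_apply_ne _ h, Matrix.diagonal_apply_ne _ h]
      norm_num
  rw [fnorm_sq]
  refine (Finset.sum_le_sum fun y _ => Finset.sum_le_sum fun x _ => hcol y x).trans (le_of_eq ?_)
  simp

/-- Telescoping along `qftOn_split`: each appended block adds a commutator error and a truncation
error, and the unitaries around the old error do not enlarge it. -/
theorem fnorm_partialOQFT_sub_le {n j t : ℕ} (hn : 3 * j * t ≤ n) :
    fnorm (partialOQFT n (3 * j) t - qftOn n 0 (blockStart n (3 * j) (t + 1))) ≤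
      t * Real.sqrt (2 ^ n * (360 / 2 ^ j)) := by
  induction t with
  | zero => rw [partialOQFT_zero, sub_self, fnorm_zero]; simp
  | succ t ih =>
    have ih := ih ((Nat.mul_le_mul_left _ (by omega)).trans hn)
    have hF := mem_unitaryGroup_iff'.1 (blockQFT_mem_unitaryGroup n (3 * j) (t + 1))
    have hP := mem_unitaryGroup_iff'.1 (blockPhase_mem_unitaryGroup n (3 * j) t)
    have hQ := (realizes_qftOn (a := 0) (blockStart_le n (3 * j) (t + 1))).mul_conjTranspose_self
    have hsplit := qftOn_split (n := n) (Nat.zero_le (blockStart n (3 * j) (t + 1)))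
      (blockStart_mono n (3 * j) (show t + 1 ≤ t + 2 by omega))
    have h1 : fnorm (partialOQFT n (3 * j) (t + 1) -
        blockQFT n (3 * j) (t + 1) * (blockPhase n (3 * j) t * partialOQFT n (3 * j) t)) ^ 2 ≤
        2 ^ n * (140 / 2 ^ j) := by
      rcases Nat.mod_two_eq_zero_or_one t with ht | ht
      · obtain ⟨U, W, hU, hW, h⟩ := partialOQFT_succ_of_even (n := n) (m := 3 * j) ht
        rw [h, fnorm_mul_unitary (mem_unitaryGroup_iff.1 hW),
          fnorm_unitary_mul (mem_unitaryGroup_iff'.1 hU)]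
        exact fnorm_parityProd_commutator_sq_le ht hn
      · rw [partialOQFT_succ_of_odd ht, sub_self, fnorm_zero, zero_pow two_ne_zero]
        positivity
    have h2 : fnorm (blockQFT n (3 * j) (t + 1) * (blockPhase n (3 * j) t * partialOQFT n (3 * j) t) -
        blockQFT n (3 * j) (t + 1) * (blockPhase n (3 * j) t *
          qftOn n 0 (blockStart n (3 * j) (t + 1)))) ≤ t * Real.sqrt (2 ^ n * (360 / 2 ^ j)) := by
      rw [← mul_sub, ← mul_sub, fnorm_unitary_mul hF, fnorm_unitary_mul hP]
      exact ih
    have h3 : fnorm (blockQFT n (3 * j) (t + 1) * (blockPhase n (3 * j) t *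
          qftOn n 0 (blockStart n (3 * j) (t + 1))) -
        qftOn n 0 (blockStart n (3 * j) (t + 2))) ^ 2 ≤ 2 ^ n * (40 / 2 ^ j) := by
      rw [hsplit]
      change fnorm (blockQFT n (3 * j) (t + 1) * _ - blockQFT n (3 * j) (t + 1) * _) ^ 2 ≤ _
      rw [← mul_sub, ← sub_mul, fnorm_unitary_mul hF, fnorm_mul_unitary hQ]
      exact fnorm_blockPhase_sub_sq_le hn
    have h4 := fnorm_sub_le (partialOQFT n (3 * j) (t + 1))
      (blockQFT n (3 * j) (t + 1) * (blockPhase n (3 * j) t * partialOQFT n (3 * j) t))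
      (qftOn n 0 (blockStart n (3 * j) (t + 2)))
    have h5 := fnorm_sub_le
      (blockQFT n (3 * j) (t + 1) * (blockPhase n (3 * j) t * partialOQFT n (3 * j) t))
      (blockQFT n (3 * j) (t + 1) * (blockPhase n (3 * j) t *
          qftOn n 0 (blockStart n (3 * j) (t + 1))))
      (qftOn n 0 (blockStart n (3 * j) (t + 2)))
    -- By `(u + v) ^ 2 ≤ 2 * u ^ 2 + 2 * v ^ 2`, whence `360 = 2 * 140 + 2 * 40`.
    have h6 : ∀ u v : ℝ, u ^ 2 ≤ 2 ^ n * (140 / 2 ^ j) → v ^ 2 ≤ 2 ^ n * (40 / 2 ^ j) →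
        u + v ≤ Real.sqrt (2 ^ n * (360 / 2 ^ j)) := by
      intro u v hu hv
      refine Real.le_sqrt_of_sq_le ?_
      have : (2 : ℝ) ^ n * (360 / 2 ^ j) =
          2 * (2 ^ n * (140 / 2 ^ j)) + 2 * (2 ^ n * (40 / 2 ^ j)) := by ring
      nlinarith [sq_nonneg (u - v)]
    have h7 := h6 _ _ h1 h3
    push_cast
    linarith

/-- The two products differ only in the phase of the last block, which is trivial because the
segment after it is empty. -/
theorem optimisticQFT_eq_partialOQFT {n m t : ℕ} (ht : (n + m - 1) / m = t + 1)
    (hn : n ≤ m * (t + 1)) : optimisticQFT n m = partialOQFT n m t := by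
  have h1 : blockStart n m (t + 1) = n := min_eq_left hn
  have h2 : blockStart n m (t + 2) = n := min_eq_left (hn.trans (Nat.mul_le_mul_left _ (by omega)))
  have hlast : blockPhase n m t = 1 := by
    rw [blockPhase, h1, h2, phaseOn_eq_pdiag, ← pdiag_zero]
    congr 1
    funext x
    have : inVal n n x = 0 := by
      have := inVal_lt (le_refl n) (a := n) x
      rw [Nat.sub_self] at this
      omega
    simp [this]
  have hp : ∀ p, phaseBlocks n m p = parityProd (blockPhase n m) t p := by
    intro p
    have : phaseBlocks n m p = parityProd (blockPhase n m) (t + 1) p := by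
      rw [phaseBlocks, blocksOfParity, ht]; rfl
    rw [this, parityProd_succ, hlast, ite_self, mul_one]
  have hq : ∀ p, qftBlocks n m p = parityProd (blockQFT n m) (t + 1) p := by
    intro p
    rw [qftBlocks, blocksOfParity, ht]; rfl
  rw [optimisticQFT, hp, hp, hq, hq, partialOQFT]

/-- The optimistic QFT is close to the QFT on average over the inputs. -/
theorem fnorm_optimisticQFT_sub_sq_le {n j : ℕ} (hn : 1 ≤ n) (hj : 1 ≤ j) :
    fnorm (optimisticQFT n (3 * j) - qft n) ^ 2 / 2 ^ n ≤ (n : ℝ) ^ 2 * (2 ^ 9 / 2 ^ j) := by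
  obtain ⟨t, ht⟩ : ∃ t, (n + 3 * j - 1) / (3 * j) = t + 1 :=
    Nat.exists_eq_succ_of_ne_zero (Nat.div_pos (by omega) (by omega)).ne'
  have hmod := Nat.div_add_mod (n + 3 * j - 1) (3 * j)
  have hlt := Nat.mod_lt (n + 3 * j - 1) (show 0 < 3 * j by omega)
  rw [ht] at hmod
  have e : 3 * j * (t + 1) = 3 * j * t + 3 * j := by ring
  have h1 : n ≤ 3 * j * (t + 1) := by omega
  have h2 : 3 * j * t ≤ n := by omega
  have key := fnorm_partialOQFT_sub_le h2
  rw [← optimisticQFT_eq_partialOQFT ht h1, show blockStart n (3 * j) (t + 1) = n from min_eq_left h1]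
    at key
  have h3 : t ≤ n := (Nat.le_mul_of_pos_left t (by omega)).trans h2
  have h4 : (t : ℝ) ≤ n := by exact_mod_cast h3
  have h5 := pow_le_pow_left₀ (fnorm_nonneg _) key 2
  rw [mul_pow, Real.sq_sqrt (by positivity)] at h5
  rw [div_le_iff₀ (by positivity)]
  calc _ ≤ (t : ℝ) ^ 2 * (2 ^ n * (360 / 2 ^ j)) := h5
    _ ≤ (n : ℝ) ^ 2 * (2 ^ n * (2 ^ 9 / 2 ^ j)) := by gcongr; norm_num
    _ = _ := by ring

/-! ## Cost bounds -/

/-- With a single block, the conjugated optimistic QFT is the QFT and needs no ancillas. -/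
theorem exists_circuit_of_le {n m r₁ r₂ : ℕ} (hn : 1 ≤ n) (hm : n ≤ m) :
    ∃ c : Circuit (Fin n ⊕ Fin 0), c.depth ≤ 4 * m ∧ c.gateCount ≤ 4 * (n * m) ∧
      Implements c (conjugatedOQFT n m r₁ r₂) := by
  have h1 : (n + m - 1) / m = 0 + 1 := by
    rw [Nat.div_eq_iff (by omega)]; omega
  have h2 := optimisticQFT_eq_partialOQFT h1 (by omega)
  rw [partialOQFT_zero, show blockStart n m 1 = n from min_eq_left (by omega)] at h2
  have h3 : conjugatedOQFT n m r₁ r₂ = qft n := by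
    rw [conjugatedOQFT_eq_qft h2, weyl_mem_unitary, mul_one]
  obtain ⟨A', ⟨c, -, hd, hg, rfl⟩, hl⟩ := (realizes_qft n).exists_lift 0
  refine ⟨c, hd.trans (by omega), hg.trans ?_, fun ψ => ?_⟩
  · nlinarith
  · rw [h3]; exact hl.app ψ

/-- The least sufficient power of two is `2 ^ (d + 1)`. Its minimality keeps the tree, and with it
the number of ancillas, of order `n / m`. -/
theorem exists_pow_two_cover {n m : ℕ} (hm : 1 ≤ m) (hmn : m < n) :
    ∃ d, n ≤ m * 2 ^ (d + 1) ∧ m * 2 ^ d < n := by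
  have hex : ∃ d, n ≤ m * 2 ^ d :=
    ⟨n, Nat.lt_two_pow_self.le.trans (Nat.le_mul_of_pos_left _ hm)⟩
  classical
  have h0 : Nat.find hex ≠ 0 := fun h => by
    have := Nat.find_spec hex
    rw [h] at this
    omega
  obtain ⟨d, hd⟩ := Nat.exists_eq_succ_of_ne_zero h0
  refine ⟨d, ?_, ?_⟩
  · have := Nat.find_spec hex
    rwa [hd] at this
  · exact not_le.1 (Nat.find_min hex (by omega))

/-- There are `O(n / m)` leaves and blocks, and each of them costs `O(m ^ 2)` gates. -/
theorem gate_bound {n m d : ℕ} (hm : 1 ≤ m) (hmn : m < n) (hd : m * 2 ^ d < n) :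
    2 * (2 ^ (d + 1) * (17 * addCost m + 380)) + 38 * n + (n + m - 1) / m * (48 * m * (m + 1)) ≤
      3518 * (n * m) := by
  have h1 : (n + m - 1) / m * m ≤ 2 * n := (Nat.div_mul_le_self _ _).trans (by omega)
  have h2 : addCost m ≤ 26 * (m * m) := by unfold addCost; nlinarith
  have h3 : 17 * addCost m + 380 ≤ 822 * (m * m) := by nlinarith
  have h4 : 2 * (2 ^ (d + 1) * (17 * addCost m + 380)) ≤ 3288 * (n * m) := by
    calc _ ≤ 2 * (2 ^ (d + 1) * (822 * (m * m))) := by gcongr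
      _ = 3288 * ((m * 2 ^ d) * m) := by ring
      _ ≤ _ := by gcongr
  have h5 : (n + m - 1) / m * (48 * m * (m + 1)) ≤ 192 * (n * m) := by
    calc _ = ((n + m - 1) / m * m) * (48 * (m + 1)) := by ring
      _ ≤ (2 * n) * (48 * (2 * m)) := by gcongr; omega
      _ = _ := by ring
  have h6 : n ≤ n * m := Nat.le_mul_of_pos_right n hm
  omega

theorem exists_block_size {R : ℝ} (hR : 2 ≤ R) : ∃ j : ℕ, 1 ≤ j ∧ Real.log R ≤ j ∧
    (j : ℝ) ≤ 18 * Real.log R ∧ 2 ^ 9 * R ^ 2 ≤ 2 ^ j := by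
  have hlog2 := Real.log_two_gt_d9
  have hlog2' := Real.log_two_lt_d9
  have hL : Real.log 2 ≤ Real.log R := Real.log_le_log two_pos hR
  -- The choice gives `2 ^ j ≥ R ^ 11`, and `2 ^ 9 ≤ R ^ 9` because `R ≥ 2`. Rounding up costs at
  -- most `log R / log 2`, and `12 / log 2 < 18`.
  have hj := Nat.le_ceil (11 * Real.log R / Real.log 2)
  have hj' := Nat.ceil_lt_add_one (a := 11 * Real.log R / Real.log 2) (div_nonneg (by linarith) (by linarith))
  generalize ⌈11 * Real.log R / Real.log 2⌉₊ = j at hj hj'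
  rw [div_le_iff₀ (by positivity)] at hj
  have hj1 : Real.log R ≤ j := by nlinarith
  refine ⟨j, ?_, hj1, ?_, ?_⟩
  · by_contra h
    have : j = 0 := by omega
    rw [this, Nat.cast_zero] at hj1
    linarith
  · have h1 : (j : ℝ) * Real.log 2 < 11 * Real.log R + Real.log 2 := by
      have := mul_lt_mul_of_pos_right hj' (show 0 < Real.log 2 by linarith)
      rwa [add_mul, div_mul_cancel₀ _ (by linarith), one_mul] at this
    nlinarith
  · have h1 : R ^ 11 ≤ 2 ^ j := by
      rw [← Real.log_le_log_iff (by positivity) (by positivity), Real.log_pow, Real.log_pow]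
      exact_mod_cast hj
    calc 2 ^ 9 * R ^ 2 ≤ R ^ 9 * R ^ 2 := by gcongr
      _ = R ^ 11 := by ring
      _ ≤ _ := h1

/-- The error bound, for a block size chosen by `exists_block_size`. -/
theorem expected_error_le {n j a : ℕ} {ε : ℝ} (hn : 1 ≤ n) (hj : 1 ≤ j) (hε : 0 < ε) (hε' : ε ≤ 1)
    (hR : 2 ^ 9 * ((n : ℝ) / ε) ^ 2 ≤ 2 ^ j)
    (c : Fin (2 ^ n) → Fin (2 ^ n) → Circuit (Fin n ⊕ Fin a))
    (hc : ∀ r₁ r₂, Implements (c r₁ r₂) (conjugatedOQFT n (3 * j) r₁.val r₂.val))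
    (ψ : QState (Fin n)) (hψ : ‖ψ‖ = 1) :
    (∑ r₁ : Fin (2 ^ n), ∑ r₂ : Fin (2 ^ n), ‖(c r₁ r₂).op.app (withAncilla a ψ)
      - withAncilla a ((qft n).app ψ)‖ ^ 2) / ((2 : ℝ) ^ n) ^ 2 ≤ ε := by
  rw [expected_error_eq c hc, hψ, one_pow, mul_one]
  refine (fnorm_optimisticQFT_sub_sq_le hn hj).trans ?_
  rw [div_pow, mul_div_assoc', div_le_iff₀ (by positivity)] at hR
  rw [mul_div_assoc', div_le_iff₀ (by positivity)]
  -- The choice of `j` makes the error at most `ε ^ 2`.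
  have : ε ^ 2 ≤ ε := by nlinarith
  nlinarith [mul_le_mul_of_nonneg_right this (show (0 : ℝ) ≤ 2 ^ j by positivity)]

end RandQFT

end

/-! ### Choice of the parameters and the final bounds. -/

theorem mainTheorem5 :
    ∃ K : ℝ, 0 < K ∧
      ∀ (n : ℕ) (ε : ℝ), 0 < ε → ε ≤ 1 → 2 ≤ (n : ℝ) / ε →
        ∃ (m a : ℕ)
          (c : Fin (2 ^ n) → Fin (2 ^ n) → RandQFT.Circuit (Fin n ⊕ Fin a)),
          1 ≤ m ∧
          (m : ℝ) ≤ K * Real.log ((n : ℝ) / ε) ∧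
          (a : ℝ) ≤ K * ((n : ℝ) / Real.log ((n : ℝ) / ε)) ∧
          (∀ r₁ r₂ : Fin (2 ^ n),
            ((c r₁ r₂).gateCount : ℝ) ≤ K * ((n : ℝ) * Real.log ((n : ℝ) / ε)) ∧
            ((c r₁ r₂).depth : ℝ) ≤ K * Real.log ((n : ℝ) / ε) ∧
            RandQFT.Implements (c r₁ r₂) (RandQFT.conjugatedOQFT n m r₁.val r₂.val)) ∧
          (∀ ψ : RandQFT.QState (Fin n), ‖ψ‖ = 1 →
            (∑ r₁ : Fin (2 ^ n), ∑ r₂ : Fin (2 ^ n),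
              ‖(c r₁ r₂).op.app (RandQFT.withAncilla a ψ)
                - RandQFT.withAncilla a ((RandQFT.qft n).app ψ)‖ ^ 2) / ((2 : ℝ) ^ n) ^ 2 ≤ ε) := by
  -- The gate count dictates the constant: `3518 * 54 = 189972`, from `gate_bound` and `m ≤ 54 * L`.
  refine ⟨200000, by norm_num, fun n ε hε hε' hnε => ?_⟩
  have hn : 1 ≤ n := by
    by_contra h
    have : n = 0 := by omega
    rw [this, Nat.cast_zero, zero_div] at hnε
    linarith
  have hn' : (1 : ℝ) ≤ n := by exact_mod_cast hn
  obtain ⟨j, hj, hLj, hjL, hR⟩ := RandQFT.exists_block_size hnε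
  have herr := fun a => RandQFT.expected_error_le (a := a) hn hj hε hε' hR
  have hlog2 := Real.log_two_gt_d9
  have hL : Real.log 2 ≤ Real.log ((n : ℝ) / ε) := Real.log_le_log two_pos hnε
  have hnR : (n : ℝ) ≤ n / ε := by
    rw [le_div_iff₀ hε]; nlinarith
  have hlogn : Real.log n ≤ Real.log ((n : ℝ) / ε) := Real.log_le_log (by linarith) hnR
  generalize Real.log ((n : ℝ) / ε) = L at *
  have hL0 : 0 < L := by linarith
  have hm : ((3 * j : ℕ) : ℝ) ≤ 54 * L := by push_cast; linarith
  have hm' : L ≤ ((3 * j : ℕ) : ℝ) := by push_cast; linarith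
  have hm1 : 1 ≤ 3 * j := by omega
  generalize 3 * j = m at *
  have hnm : (n : ℝ) * m ≤ 54 * (n * L) := by nlinarith
  have hnL : 0 < (n : ℝ) * L := by positivity
  -- If one block contains all qubits, `n / L` may be arbitrarily small for tiny `ε`, so no ancilla
  -- is allowed. No adder is needed there, since the conjugated operator is the exact QFT.
  rcases le_or_gt n m with hmn | hmn
  · choose c hd hg hc using fun r₁ r₂ : Fin (2 ^ n) =>
      RandQFT.exists_circuit_of_le (r₁ := r₁.val) (r₂ := r₂.val) hn hmn
    refine ⟨m, 0, c, hm1, by linarith, by rw [Nat.cast_zero]; positivity,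
      fun r₁ r₂ => ⟨?_, ?_, hc r₁ r₂⟩, herr 0 c hc⟩
    · have : ((c r₁ r₂).gateCount : ℝ) ≤ 4 * ((n : ℝ) * m) := by exact_mod_cast hg r₁ r₂
      linarith
    · have : ((c r₁ r₂).depth : ℝ) ≤ 4 * m := by exact_mod_cast hd r₁ r₂
      linarith
  · obtain ⟨d, hd1, hd2⟩ := RandQFT.exists_pow_two_cover hm1 hmn
    obtain ⟨a, ha⟩ : ∃ a, a + 2 = 5 * 2 ^ (d + 1) :=
      ⟨5 * 2 ^ (d + 1) - 2, by have := Nat.one_le_two_pow (n := d + 1); omega⟩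
    choose c hd hg hc using fun r₁ r₂ : Fin (2 ^ n) =>
      RandQFT.exists_circuit_conjugatedOQFT hd1 ha r₁.isLt r₂.isLt
    have hd2' : (m : ℝ) * 2 ^ d < n := by exact_mod_cast hd2
    have hm1' : (1 : ℝ) ≤ m := by exact_mod_cast hm1
    have hpow : (0 : ℝ) < 2 ^ d := by positivity
    -- The tree height is controlled by `2 ^ d < n`, that is `d * log 2 ≤ log n ≤ L`, together with
    -- `log 2 > 1 / 2`.
    have hdL : (d : ℝ) ≤ 2 * L := by
      have h1 : Real.log (2 ^ d) ≤ Real.log n := Real.log_le_log hpow (by nlinarith)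
      rw [Real.log_pow] at h1
      nlinarith
    refine ⟨m, a, c, hm1, by linarith, ?_, fun r₁ r₂ => ⟨?_, ?_, hc r₁ r₂⟩, herr a c hc⟩
    · have h1 : (a : ℝ) + 2 = 5 * 2 ^ (d + 1) := by exact_mod_cast ha
      rw [mul_div_assoc', le_div_iff₀ hL0]
      have h2 : (a : ℝ) ≤ 10 * 2 ^ d := by rw [pow_succ] at h1; linarith
      -- The lower bound `L ≤ m` on the block size enters here: few blocks mean few ancillas.
      have h3 : (a : ℝ) * L ≤ 10 * 2 ^ d * m := by gcongr
      linarith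
    · have : ((c r₁ r₂).gateCount : ℝ) ≤ 3518 * ((n : ℝ) * m) := by
        exact_mod_cast (hg r₁ r₂).trans (RandQFT.gate_bound hm1 hmn hd2)
      linarith
    · have : ((c r₁ r₂).depth : ℝ) ≤ 414 * (m + 1) + 688 * (d + 1) + 48 * m + 2 := by
        exact_mod_cast hd r₁ r₂
      linarith
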